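/- Let $n\ge 0$ and let $C$ be the finite graph consisting of two triangles with exactly one common vertex together with a path of length $n$ (i.e. with $n$ edges) that starts at a non-common vertex of one of the triangles and is otherwise disjoint from the triangles. Call a graph $C$-free if it has no (not necessarily induced) subgraph isomorphic to $C$. Call a countable $C$-free graph $G$ existentially complete if, for every countable $C$-free graph $H$ containing $G$ as an induced subgraph, every existential first-order formula in the language of graphs with parameters from $G$ that is true in $H$ is also true in $G$. Let $T^*_C$ be the set of all first-order sentences in the language of graphs that are true in every existentially complete countable $C$-free graph. Then $T^*_C$ is $\aleph_0$-categorical: it has a countably infinite model, and every countable model is isomorphic to it. Consequently there is a universal countable $C$-free graph, that is, a countable $C$-free graph $G$ such that every countable $C$-free graph is isomorphic to an induced subgraph of $G$. -/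

import Mathlib

open FirstOrder

/-- Two triangles `{0, 1, 2}` and `{2, 3, 4}` with exactly the vertex `2` in common, together with
a path `4, 5, …, n + 4` of length `n` (that is, with `n` edges) starting at the vertex `4`. -/
def twoTrianglesPath (n : ℕ) : SimpleGraph (Fin (n + 5)) :=
  SimpleGraph.fromRel fun i j =>
    (i.val ≤ 2 ∧ j.val ≤ 2) ∨
    ((2 ≤ i.val ∧ i.val ≤ 4) ∧ (2 ≤ j.val ∧ j.val ≤ 4)) ∨
    (4 ≤ i.val ∧ j.val = i.val + 1)

/-- The truth of the first-order graph formula `φ` in the graph `G` under the assignment `v` of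
vertices to the free variables of `φ`. -/
def GraphRealize {V α : Type} (G : SimpleGraph V) (φ : Language.graph.Formula α) (v : α → V) :
    Prop :=
  letI := G.structure
  φ.Realize v

/-- `G`, regarded as an induced subgraph of `H` via `e`, is existentially complete in `H`: every
existential formula with parameters from `G` that is true in `H` is true in `G`. -/
def ExistentiallyCompleteIn {V W : Type} (G : SimpleGraph V) (H : SimpleGraph W) (e : G ↪g H) :
    Prop :=
  ∀ φ : Language.graph.Formula V, φ.IsExistential → GraphRealize H φ e → GraphRealize G φ id

/-- `G` is a countable graph that contains no copy of `C` as a (not necessarily induced)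
subgraph. -/
def IsCountableFree {U V : Type} (C : SimpleGraph U) (G : SimpleGraph V) : Prop :=
  Countable V ∧ C.Free G

/-- `G` is existentially complete in the class of countable `C`-free graphs. -/
def IsExistentiallyComplete {U V : Type} (C : SimpleGraph U) (G : SimpleGraph V) : Prop :=
  IsCountableFree C G ∧
    ∀ (W : Type) (H : SimpleGraph W), IsCountableFree C H →
      ∀ e : G ↪g H, ExistentiallyCompleteIn G H e

/-- The theory `T*_C`: all first-order sentences that are true in every existentially complete
countable `C`-free graph. -/
def existentiallyCompleteTheory {U : Type} (C : SimpleGraph U) : Language.graph.Theory :=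
  {φ | ∀ (V : Type) (G : SimpleGraph V), IsExistentiallyComplete C G →
    GraphRealize G φ Empty.elim}

/-- A theory is `ℵ₀`-categorical if it has a countably infinite model and every countable model is
isomorphic to it. -/
def IsAleph0Categorical {L : FirstOrder.Language.{0, 0}} (T : L.Theory) : Prop :=
  ∃ M : Language.Theory.ModelType.{0, 0, 0} T, Cardinal.mk M = Cardinal.aleph0 ∧
    ∀ N : Language.Theory.ModelType.{0, 0, 0} T, Countable N → Nonempty (N ≃[L] M)

/-- This notion of `ℵ₀`-categoricity implies Mathlib's, which does not assert that a model
exists. -/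
theorem IsAleph0Categorical.categorical {L : FirstOrder.Language.{0, 0}} {T : L.Theory}
    (h : IsAleph0Categorical T) : Cardinal.Categorical.{0, 0, 0} Cardinal.aleph0 T := by
  obtain ⟨M, -, h⟩ := h
  intro N N' hN hN'
  obtain ⟨f⟩ := h N (Cardinal.mk_le_aleph0_iff.1 hN.le)
  obtain ⟨g⟩ := h N' (Cardinal.mk_le_aleph0_iff.1 hN'.le)
  exact ⟨g.symm.comp f⟩

/-- `G` is universal for the class of countable `C`-free graphs: it belongs to the class, and every
graph in the class is isomorphic to an induced subgraph of `G`. -/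
def IsUniversalFree {U V : Type} (C : SimpleGraph U) (G : SimpleGraph V) : Prop :=
  IsCountableFree C G ∧
    ∀ (W : Type) (H : SimpleGraph W), IsCountableFree C H → Nonempty (H ↪g G)

/-! Call two triangles with a common vertex and a tail of length `n` a tadpole. The proof has three
ingredients.

Axioms. Existential completeness amounts to a retraction property (`LocallyRetracts`): a finite part
of any `C`-free extension of `G` can be copied into `G` over any finite part of `G`. It suffices to
test extensions by finitely many vertices attached along a finite tuple. Whether such an extension
contains `C` is a first-order condition on the tuple, so countable models of `T*_C` are again
existentially complete (`ModelsEC.isExistentiallyComplete`). Existentially complete extensions arise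
as limits of generic sequences of finite enlargements.

Amalgamation. A family of paths or triangles attached to fixed vertices is flexible if it has
members avoiding any given finite set. A set `A` is closed if, at each of its vertices, the
triangles and the paths of length at most `n` are either flexible as families or return to `A`, with
flexible links where the configuration has to be replaced. Amalgamate two tadpole-free graphs over a
closed set on which they agree, also about flexibility. In a tadpole of the union, the triangle
carrying the tail lies on one side; the other triangle and then the tail can be rerouted into that
side, which is impossible. So the amalgam is tadpole-free (`Overlap.not_hasTadpole`), and
existential completeness turns this into the extension step of a back-and-forth
(`IsGoodIso.extend`).

Finite closure. A family at `a` fails to be flexible only because attaching a new member creates a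
tadpole. The at most `n + 5` old vertices of that tadpole then meet every member, in any
tadpole-free graph containing a copy of them (`IsExistentiallyComplete.exists_blocks`). This yields
finite certificates: a finite set `K a` to which configurations at `a` return, and a finite set of
witnesses. Closing under `K` stops because sequences of distinct vertices with each term in `K` of
the preceding one are bounded (`length_le_of_isChain`). Consecutive terms are joined by flexible
links, so a long sequence expands to a long path; in its middle no vertex can be near a tadpole, as
the path would provide the missing tail. There `K` can only come from triangles, and successive
triangles without outer vertices of bowties cannot involve six distinct vertices in a row
(`false_of_triangle_chain`). Since certificates refer to finitely many vertices, closedness and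
flexibility transfer along finite partial isomorphisms. Hence any two existentially complete graphs
are isomorphic, and both conclusions follow. -/

/-! ### Existential completeness as a retraction property; first-order definability -/

section Definability

open Language

/-- The map `j` is an isomorphism of induced subgraphs from `Z` onto its image. -/
def InducedOn {V W : Type} (H : SimpleGraph W) (G : SimpleGraph V) (j : W → V) (Z : Set W) : Prop :=
  Set.InjOn j Z ∧ ∀ x ∈ Z, ∀ y ∈ Z, G.Adj (j x) (j y) ↔ H.Adj x y

/-- Every finite part of `H` can be mapped back into `G`, fixing a given finite part of `G`. -/
def LocallyRetracts {V W : Type} (G : SimpleGraph V) (H : SimpleGraph W) (e : V → W) : Prop :=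
  ∀ (R : Finset V) (S : Finset W), S.Nonempty →
    ∃ j : W → V, (∀ r ∈ R, j (e r) = r) ∧ InducedOn H G j (↑S ∪ e '' ↑R)

/-- Vertices of `S` that already come from `G` must be copied to themselves, so they can be moved
into the fixed part `R`; only the genuinely new ones remain to be placed. -/
theorem LocallyRetracts.of_disjoint {V W : Type} {G : SimpleGraph V} {H : SimpleGraph W}
    (e : G ↪g H)
    (h : ∀ (R : Finset V) (S : Finset W), S.Nonempty → (∀ w ∈ S, ∀ v, e v ≠ w) →
      ∃ y : W → V, Set.InjOn y S ∧ (∀ w ∈ S, ∀ r ∈ R, r ≠ y w) ∧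
        (∀ w ∈ S, ∀ w' ∈ S, G.Adj (y w) (y w') ↔ H.Adj w w') ∧
        (∀ w ∈ S, ∀ r ∈ R, G.Adj r (y w) ↔ H.Adj (e r) w)) :
    LocallyRetracts G H e := by
  classical
  intro R S hS
  set S' := S.filter (fun w => ∀ v, e v ≠ w) with hS'
  set R' := R ∪ S.preimage e e.injective.injOn with hR'
  obtain ⟨y, hy1, hy2, hy3, hy4⟩ : ∃ y : W → V, Set.InjOn y S' ∧ (∀ w ∈ S', ∀ r ∈ R', r ≠ y w) ∧
        (∀ w ∈ S', ∀ w' ∈ S', G.Adj (y w) (y w') ↔ H.Adj w w') ∧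
        (∀ w ∈ S', ∀ r ∈ R', G.Adj r (y w) ↔ H.Adj (e r) w) := by
    rcases S'.eq_empty_or_nonempty with h0 | h0
    · obtain ⟨w, hw⟩ := hS
      have : ¬ ∀ v, e v ≠ w := by
        intro hn
        have : w ∈ S' := Finset.mem_filter.2 ⟨hw, hn⟩
        simp [h0] at this
      push Not at this
      obtain ⟨v, -⟩ := this
      exact ⟨fun _ => v, by simp [h0]⟩
    · exact h R' S' h0 (fun w hw => (Finset.mem_filter.1 hw).2)
  let j : W → V := fun w => if h : ∃ v, e v = w then h.choose else y w
  have hj : ∀ v, j (e v) = v := by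
    intro v
    have h : ∃ v', e v' = e v := ⟨v, rfl⟩
    have : j (e v) = h.choose := dif_pos h
    rw [this]
    exact e.injective h.choose_spec
  have hj' : ∀ w, (∀ v, e v ≠ w) → j w = y w := fun w hw =>
    dif_neg (by simpa using hw)
  have key : ∀ x ∈ (↑S ∪ e '' ↑R : Set W), (∃ r ∈ R', x = e r) ∨ x ∈ S' := by
    rintro x (hx | ⟨r, hr, rfl⟩)
    · by_cases hn : ∀ v, e v ≠ x
      · exact Or.inr (Finset.mem_filter.2 ⟨hx, hn⟩)
      · push Not at hn
        obtain ⟨v, rfl⟩ := hn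
        exact Or.inl ⟨v, by simpa [hR'] using Or.inr hx, rfl⟩
    · exact Or.inl ⟨r, Finset.mem_union_left _ hr, rfl⟩
  have hjS : ∀ x ∈ S', j x = y x := fun x hx => hj' x (Finset.mem_filter.1 hx).2
  refine ⟨j, fun r _ => hj r, ?_, ?_⟩
  · intro x hx x' hx' hxx
    rcases key x hx with ⟨r, hr, rfl⟩ | h1 <;> rcases key x' hx' with ⟨r', hr', rfl⟩ | h2
    · rw [hj, hj] at hxx; rw [hxx]
    · rw [hj, hjS _ h2] at hxx
      exact absurd hxx (hy2 _ h2 _ hr)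
    · rw [hj, hjS _ h1] at hxx
      exact absurd hxx.symm (hy2 _ h1 _ hr')
    · rw [hjS _ h1, hjS _ h2] at hxx
      exact hy1 h1 h2 hxx
  · intro x hx x' hx'
    rcases key x hx with ⟨r, hr, rfl⟩ | h1 <;> rcases key x' hx' with ⟨r', hr', rfl⟩ | h2
    · rw [hj, hj, e.map_adj_iff]
    · rw [hj, hjS _ h2, hy4 _ h2 _ hr]
    · rw [hj, hjS _ h1, G.adj_comm, hy4 _ h1 _ hr', H.adj_comm]
    · rw [hjS _ h1, hjS _ h2, hy3 _ h1 _ h2]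

theorem isQF_iInf {L : FirstOrder.Language.{0, 0}} {α β : Type} [Finite β] {n : ℕ}
    {f : β → L.BoundedFormula α n} (h : ∀ b, (f b).IsQF) : (BoundedFormula.iInf f).IsQF := by
  unfold BoundedFormula.iInf
  dsimp only
  generalize (@Finset.univ β (Fintype.ofFinite β)).toList = l
  induction l with
  | nil => exact BoundedFormula.IsQF.top
  | cons a l ih => exact (h a).inf ih

theorem isQF_iSup {L : FirstOrder.Language.{0, 0}} {α β : Type} [Finite β] {n : ℕ}
    {f : β → L.BoundedFormula α n} (h : ∀ b, (f b).IsQF) : (BoundedFormula.iSup f).IsQF := by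
  unfold BoundedFormula.iSup
  dsimp only
  generalize (@Finset.univ β (Fintype.ofFinite β)).toList = l
  induction l with
  | nil => exact BoundedFormula.isQF_bot
  | cons a l ih => exact (h a).sup ih

theorem isExistential_exs {L : FirstOrder.Language.{0, 0}} {α : Type} {n : ℕ}
    {φ : L.BoundedFormula α n} (h : φ.IsExistential) :
    BoundedFormula.IsExistential (n := 0) φ.exs := by
  induction n with
  | zero => exact h
  | succ n ih => exact ih h.ex

theorem isExistential_iExs {L : FirstOrder.Language.{0, 0}} {α β : Type} [Finite β]
    {φ : L.Formula (α ⊕ β)} (h : φ.IsQF) : BoundedFormula.IsExistential (n := 0) (φ.iExs β) := by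
  unfold Formula.iExs
  exact isExistential_exs (h.relabel _).isExistential

/-- The property `P` of tuples of vertices is defined by a first-order formula. -/
def FODefinable {α : Type} (P : ∀ V : Type, SimpleGraph V → (α → V) → Prop) : Prop :=
  ∃ φ : Language.graph.Formula α, ∀ V G v, GraphRealize G φ v ↔ P V G v

/-- A finite tuple has only finitely many patterns of adjacencies and equalities. The formula is the
disjunction, over the patterns satisfying `Q`, of their complete descriptions. -/
theorem exists_isQF_realize_iff {α : Type} [Finite α]
    (Q : (α → α → Prop) → (α → α → Prop) → Prop) :
    ∃ φ : Language.graph.Formula α, BoundedFormula.IsQF φ ∧ ∀ (V : Type) (G : SimpleGraph V) v,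
      GraphRealize G φ v ↔ Q (fun i j => G.Adj (v i) (v j)) (fun i j => v i = v j) := by
  classical
  let adjF : α → α → Language.graph.Formula α := fun i j =>
    Language.adj.formula₂ (Term.var i) (Term.var j)
  let eqF : α → α → Language.graph.Formula α := fun i j => Term.equal (Term.var i) (Term.var j)
  have hadj : ∀ (V : Type) (G : SimpleGraph V) (v : α → V) i j,
      GraphRealize G (adjF i j) v ↔ G.Adj (v i) (v j) := by
    intro V G v i j
    let := G.structure
    change (adjF i j).Realize v ↔ _
    simp only [adjF, Formula.realize_rel₂]
    rfl
  have heq : ∀ (V : Type) (G : SimpleGraph V) (v : α → V) i j,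
      GraphRealize G (eqF i j) v ↔ v i = v j := by
    intro V G v i j
    let := G.structure
    change (eqF i j).Realize v ↔ _
    simp [eqF]
  let lit : Language.graph.Formula α → Prop → Language.graph.Formula α := fun φ p =>
    if p then φ else φ.not
  have hlit : ∀ (V : Type) (G : SimpleGraph V) (v : α → V) φ p,
      GraphRealize G (lit φ p) v ↔ (GraphRealize G φ v ↔ p) := by
    intro V G v φ p
    let := G.structure
    change (lit φ p).Realize v ↔ (φ.Realize v ↔ p)
    by_cases hp : p <;> simp [lit, hp]
  have hlitQ : ∀ φ p, BoundedFormula.IsQF φ → BoundedFormula.IsQF (lit φ p) := by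
    intro φ p h
    by_cases hp : p
    · simpa [lit, hp] using h
    · simpa [lit, hp] using h.not
  let I := {p : (α → α → Prop) × (α → α → Prop) // Q p.1 p.2}
  let body : I → α × α → Language.graph.Formula α := fun p ij =>
    lit (adjF ij.1 ij.2) (p.1.1 ij.1 ij.2) ⊓ lit (eqF ij.1 ij.2) (p.1.2 ij.1 ij.2)
  refine ⟨Formula.iSup fun p : I => Formula.iInf (body p), ?_, ?_⟩
  · refine isQF_iSup fun p => isQF_iInf fun ij => ?_
    refine BoundedFormula.IsQF.inf (hlitQ _ _ ?_) (hlitQ _ _ ?_)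
    · exact (BoundedFormula.IsAtomic.rel _ _).isQF
    · exact (BoundedFormula.IsAtomic.equal _ _).isQF
  · intro V G v
    have : GraphRealize G (Formula.iSup fun p : I => Formula.iInf (body p)) v ↔
        ∃ p : I, ∀ ij : α × α, (G.Adj (v ij.1) (v ij.2) ↔ p.1.1 ij.1 ij.2) ∧
          ((v ij.1 = v ij.2) ↔ p.1.2 ij.1 ij.2) := by
      let := G.structure
      change (Formula.iSup fun p : I => Formula.iInf (body p)).Realize v ↔ _
      rw [Formula.realize_iSup]
      refine exists_congr fun p => ?_
      rw [Formula.realize_iInf]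
      refine forall_congr' fun ij => ?_
      rw [Formula.realize_inf, ← hadj V G v, ← heq V G v]
      exact and_congr (hlit V G v _ _) (hlit V G v _ _)
    rw [this]
    constructor
    · rintro ⟨⟨⟨r, s⟩, hQ⟩, h⟩
      have hr : (fun i j => G.Adj (v i) (v j)) = r := by
        funext i j; exact propext (h (i, j)).1
      have hs : (fun i j => v i = v j) = s := by
        funext i j; exact propext (h (i, j)).2
      rw [hr, hs]; exact hQ
    · intro h
      exact ⟨⟨⟨_, _⟩, h⟩, fun ij => ⟨Iff.rfl, Iff.rfl⟩⟩

namespace FODefinable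

theorem of_local {α : Type} [Finite α] (Q : (α → α → Prop) → (α → α → Prop) → Prop) :
    FODefinable (α := α) fun _ G v => Q (fun i j => G.Adj (v i) (v j)) (fun i j => v i = v j) :=
  let ⟨φ, _, h⟩ := exists_isQF_realize_iff Q
  ⟨φ, h⟩

theorem imp {α : Type} {P Q : ∀ V : Type, SimpleGraph V → (α → V) → Prop}
    (hP : FODefinable P) (hQ : FODefinable Q) :
    FODefinable fun V G v => P V G v → Q V G v := by
  obtain ⟨φ, hφ⟩ := hP
  obtain ⟨ψ, hψ⟩ := hQ
  refine ⟨φ.imp ψ, fun V G v => ?_⟩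
  exact (@Formula.realize_imp _ _ G.structure _ _ _ _).trans (imp_congr (hφ V G v) (hψ V G v))

theorem or {α : Type} {P Q : ∀ V : Type, SimpleGraph V → (α → V) → Prop}
    (hP : FODefinable P) (hQ : FODefinable Q) :
    FODefinable fun V G v => P V G v ∨ Q V G v := by
  obtain ⟨φ, hφ⟩ := hP
  obtain ⟨ψ, hψ⟩ := hQ
  refine ⟨φ ⊔ ψ, fun V G v => ?_⟩
  exact (@Formula.realize_sup _ _ G.structure _ _ _ _).trans (or_congr (hφ V G v) (hψ V G v))

theorem exists_tuple {α β : Type} [Finite β] {P : ∀ V : Type, SimpleGraph V → (α ⊕ β → V) → Prop}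
    (hP : FODefinable P) :
    FODefinable fun V G v => ∃ w : β → V, P V G (Sum.elim v w) := by
  obtain ⟨φ, hφ⟩ := hP
  refine ⟨φ.iExs β, fun V G v => ?_⟩
  simp only [← hφ]
  exact @Formula.realize_iExs _ _ G.structure _ _ _ _ _

theorem forall_tuple {α β : Type} [Finite β] {P : ∀ V : Type, SimpleGraph V → (α ⊕ β → V) → Prop}
    (hP : FODefinable P) :
    FODefinable fun V G v => ∀ w : β → V, P V G (Sum.elim v w) := by
  obtain ⟨φ, hφ⟩ := hP
  refine ⟨φ.iAlls β, fun V G v => ?_⟩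
  simp only [← hφ]
  exact @Formula.realize_iAlls _ _ G.structure _ _ _ _ _

end FODefinable

/-- The quantifier-free diagram of `S` over `R`, with the vertices of `S` quantified existentially,
is true in `H` and hence in `G`. Its witnesses in `G` define the map `j`. -/
theorem IsExistentiallyComplete.locallyRetracts {U V W : Type} {C : SimpleGraph U}
    {G : SimpleGraph V} (hG : IsExistentiallyComplete C G) {H : SimpleGraph W}
    (hH : IsCountableFree C H) (e : G ↪g H) : LocallyRetracts G H e := by
  classical
  intro R S hS
  let p : R ⊕ S → W := Sum.elim (fun r => e r.1) (fun s => s.1)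
  obtain ⟨φ, hφ, hreal⟩ := exists_isQF_realize_iff (α := R ⊕ S) fun adj eq =>
    adj = (fun i j => H.Adj (p i) (p j)) ∧ eq = (fun i j => p i = p j)
  let ψ : Language.graph.Formula (V ⊕ S) := φ.relabel (Sum.map Subtype.val id)
  have hψ : BoundedFormula.IsQF ψ := hφ.relabel _
  have hreal' : ∀ (V' : Type) (G' : SimpleGraph V') (f : V → V'),
      GraphRealize G' (ψ.iExs S) f ↔ ∃ w : S → V',
        GraphRealize G' φ (Sum.elim (fun r : R => f r.1) w) := by
    intro V' G' f
    let := G'.structure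
    change (ψ.iExs S).Realize f ↔ ∃ w : S → V', φ.Realize _
    rw [Formula.realize_iExs]
    refine exists_congr fun w => ?_
    rw [Formula.realize_relabel]
    have : (Sum.elim f w ∘ Sum.map Subtype.val id : R ⊕ S → V') =
        Sum.elim (fun r : R => f r.1) w := by
      funext x; rcases x with x | x <;> rfl
    rw [this]
  have h1 : GraphRealize H (ψ.iExs S) e := by
    rw [hreal']
    exact ⟨fun s => s.1, (hreal _ _ _).2 ⟨rfl, rfl⟩⟩
  have h2 := hG.2 W H hH e _ (isExistential_iExs hψ) h1
  rw [hreal'] at h2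
  obtain ⟨w, hw⟩ := h2
  rw [hreal] at hw
  obtain ⟨hadj, heq⟩ := hw
  set q : R ⊕ S → V := Sum.elim (fun r : R => id r.1) w with hq
  have hadj' : ∀ i j, G.Adj (q i) (q j) ↔ H.Adj (p i) (p j) := fun i j =>
    iff_of_eq (congrFun (congrFun hadj i) j)
  have heq' : ∀ i j, q i = q j ↔ p i = p j := fun i j =>
    iff_of_eq (congrFun (congrFun heq i) j)
  obtain ⟨s₀, hs₀⟩ := hS
  let j : W → V := fun x => if h : ∃ i, p i = x then q h.choose else w ⟨s₀, hs₀⟩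
  have hj : ∀ i, j (p i) = q i := by
    intro i
    have h : ∃ i', p i' = p i := ⟨i, rfl⟩
    have : j (p i) = q h.choose := dif_pos h
    rw [this, heq']
    exact h.choose_spec
  have key : ∀ x ∈ (↑S ∪ e '' ↑R : Set W), ∃ i, x = p i := by
    rintro x (hx | ⟨r, hr, rfl⟩)
    · exact ⟨Sum.inr ⟨x, hx⟩, rfl⟩
    · exact ⟨Sum.inl ⟨r, hr⟩, rfl⟩
  refine ⟨j, fun r hr => hj (Sum.inl ⟨r, hr⟩), ?_, ?_⟩
  · intro x hx y hy hxy
    obtain ⟨i, rfl⟩ := key x hx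
    obtain ⟨i', rfl⟩ := key y hy
    rwa [hj, hj, heq'] at hxy
  · intro x hx y hy
    obtain ⟨i, rfl⟩ := key x hx
    obtain ⟨i', rfl⟩ := key y hy
    rw [hj, hj, hadj']

/-- A quantifier-free formula mentions finitely many parameters, collected in `R`; its truth depends
only on the graph induced on these and on the values of the variables. -/
theorem BoundedFormula.IsQF.realize_of_inducedOn {V W : Type} {G : SimpleGraph V}
    {H : SimpleGraph W} {e : V → W} {k : ℕ} {φ : Language.graph.BoundedFormula V k}
    (hφ : φ.IsQF) :
    ∃ R : Finset V, ∀ (xs : Fin k → W) (j : W → V), (∀ r ∈ R, j (e r) = r) →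
      InducedOn H G j (Set.range xs ∪ e '' ↑R) →
      (@BoundedFormula.Realize _ _ H.structure _ _ φ e xs ↔
        @BoundedFormula.Realize _ _ G.structure _ _ φ id (j ∘ xs)) := by
  classical
  have hterm : ∀ t : Language.graph.Term (V ⊕ Fin k), ∃ R : Finset V,
      ∀ (xs : Fin k → W) (j : W → V), (∀ r ∈ R, j (e r) = r) →
        @Term.realize _ _ H.structure _ (Sum.elim e xs) t ∈ (Set.range xs ∪ e '' ↑R : Set W) ∧
        @Term.realize _ _ G.structure _ (Sum.elim id (j ∘ xs)) t =
          j (@Term.realize _ _ H.structure _ (Sum.elim e xs) t) := by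
    intro t
    match t with
    | .var (.inl v) =>
      refine ⟨{v}, fun xs j hj => ⟨Or.inr ⟨v, by simp, rfl⟩, ?_⟩⟩
      exact (hj v (by simp)).symm
    | .var (.inr i) => exact ⟨∅, fun xs j _ => ⟨Or.inl ⟨i, rfl⟩, rfl⟩⟩
    | .func f _ => exact isEmptyElim f
  have mono : ∀ {R R' : Finset V} (xs : Fin k → W), R ⊆ R' →
      (Set.range xs ∪ e '' ↑R : Set W) ⊆ Set.range xs ∪ e '' ↑R' := fun xs h =>
    Set.union_subset_union_right _ (Set.image_mono h)
  induction hφ with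
  | falsum => exact ⟨∅, fun _ _ _ _ => Iff.rfl⟩
  | of_isAtomic hA =>
    cases hA with
    | equal t₁ t₂ =>
      obtain ⟨R₁, h₁⟩ := hterm t₁
      obtain ⟨R₂, h₂⟩ := hterm t₂
      refine ⟨R₁ ∪ R₂, fun xs j hj hI => ?_⟩
      obtain ⟨m₁, e₁⟩ := h₁ xs j fun r hr => hj r (Finset.mem_union_left _ hr)
      obtain ⟨m₂, e₂⟩ := h₂ xs j fun r hr => hj r (Finset.mem_union_right _ hr)
      rw [@BoundedFormula.realize_bdEqual _ _ G.structure,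
        @BoundedFormula.realize_bdEqual _ _ H.structure, e₁, e₂]
      exact (hI.1.eq_iff (mono xs Finset.subset_union_left m₁)
        (mono xs Finset.subset_union_right m₂)).symm
    | @rel l r ts =>
      match l, r, ts with
      | 2, .adj, ts =>
        obtain ⟨R₁, h₁⟩ := hterm (ts 0)
        obtain ⟨R₂, h₂⟩ := hterm (ts 1)
        refine ⟨R₁ ∪ R₂, fun xs j hj hI => ?_⟩
        obtain ⟨m₁, e₁⟩ := h₁ xs j fun r hr => hj r (Finset.mem_union_left _ hr)
        obtain ⟨m₂, e₂⟩ := h₂ xs j fun r hr => hj r (Finset.mem_union_right _ hr)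
        change H.Adj (@Term.realize _ _ H.structure _ (Sum.elim e xs) (ts 0))
            (@Term.realize _ _ H.structure _ (Sum.elim e xs) (ts 1)) ↔
          G.Adj (@Term.realize _ _ G.structure _ (Sum.elim id (j ∘ xs)) (ts 0))
            (@Term.realize _ _ G.structure _ (Sum.elim id (j ∘ xs)) (ts 1))
        rw [e₁, e₂]
        exact (hI.2 _ (mono xs Finset.subset_union_left m₁) _
          (mono xs Finset.subset_union_right m₂)).symm
  | imp _ _ ih₁ ih₂ =>
    obtain ⟨R₁, h₁⟩ := ih₁
    obtain ⟨R₂, h₂⟩ := ih₂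
    refine ⟨R₁ ∪ R₂, fun xs j hj hI => ?_⟩
    have sub : ∀ {R : Finset V}, R ⊆ R₁ ∪ R₂ → InducedOn H G j (Set.range xs ∪ e '' ↑R) :=
      fun hR => ⟨hI.1.mono (mono xs hR), fun x hx y hy => hI.2 x (mono xs hR hx) y (mono xs hR hy)⟩
    have a₁ := h₁ xs j (fun r hr => hj r (Finset.mem_union_left _ hr))
      (sub Finset.subset_union_left)
    have a₂ := h₂ xs j (fun r hr => hj r (Finset.mem_union_right _ hr))
      (sub Finset.subset_union_right)
    rw [@BoundedFormula.realize_imp _ _ G.structure, @BoundedFormula.realize_imp _ _ H.structure,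
      a₁, a₂]

/-- `S` collects witnesses in `H` for the quantifiers; their images under `j` are witnesses in `G`.
-/
theorem BoundedFormula.IsExistential.realize_of_inducedOn {V W : Type} {G : SimpleGraph V}
    {H : SimpleGraph W} {e : V → W} {k : ℕ} {φ : Language.graph.BoundedFormula V k}
    (hφ : φ.IsExistential) :
    ∀ xs : Fin k → W, @BoundedFormula.Realize _ _ H.structure _ _ φ e xs →
      ∃ (R : Finset V) (S : Finset W), ∀ j : W → V, (∀ r ∈ R, j (e r) = r) →
      InducedOn H G j (Set.range xs ∪ ↑S ∪ e '' ↑R) →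
        @BoundedFormula.Realize _ _ G.structure _ _ φ id (j ∘ xs) := by
  classical
  induction hφ with
  | of_isQF h =>
    intro xs hxs
    obtain ⟨R, hR⟩ := BoundedFormula.IsQF.realize_of_inducedOn (G := G) (H := H) (e := e) h
    refine ⟨R, ∅, fun j hj hI => (hR xs j hj ?_).1 hxs⟩
    simpa using hI
  | ex _ ih =>
    intro xs hxs
    rw [@BoundedFormula.realize_ex _ _ H.structure] at hxs
    obtain ⟨a, ha⟩ := hxs
    obtain ⟨R, S, h⟩ := ih _ ha
    refine ⟨R, insert a S, fun j hj hI => ?_⟩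
    rw [@BoundedFormula.realize_ex _ _ G.structure]
    refine ⟨j a, ?_⟩
    rw [← Fin.comp_snoc]
    refine h j hj ?_
    have : Set.range (Fin.snoc xs a : Fin (_ + 1) → W) ∪ ↑S ∪ e '' ↑R ⊆
        Set.range xs ∪ ↑(insert a S) ∪ e '' ↑R := by
      refine Set.union_subset_union_left _ (Set.union_subset ?_ ?_)
      · rintro _ ⟨i, rfl⟩
        refine Fin.lastCases ?_ (fun i => ?_) i
        · right; simp
        · left; simp
      · exact fun x hx => Or.inr (by simp [Finset.mem_coe.1 hx])
    exact ⟨hI.1.mono this, fun x hx y hy => hI.2 x (this hx) y (this hy)⟩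

theorem isExistentiallyComplete_of_locallyRetracts {U V : Type} {C : SimpleGraph U}
    {G : SimpleGraph V} [Nonempty V] (hG : IsCountableFree C G)
    (h : ∀ (W : Type) (H : SimpleGraph W), IsCountableFree C H → ∀ e : G ↪g H,
      LocallyRetracts G H e) :
    IsExistentiallyComplete C G := by
  classical
  refine ⟨hG, fun W H hH e φ hφ hr => ?_⟩
  obtain ⟨R, S, hRS⟩ := BoundedFormula.IsExistential.realize_of_inducedOn (G := G) (H := H)
    (e := e) hφ default hr
  obtain ⟨v₀⟩ := ‹Nonempty V›
  -- The set of witnesses may be empty, whereas `LocallyRetracts` speaks of nonempty sets; adding a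
  -- vertex of `G` is harmless.
  obtain ⟨j, hj, hI⟩ := h W H hH e R (insert (e v₀) S) ⟨_, Finset.mem_insert_self _ _⟩
  have := hRS j hj ?_
  · change @BoundedFormula.Realize _ _ G.structure _ _ φ id _
    convert this
  · have hsub : Set.range (default : Fin 0 → W) ∪ ↑S ∪ e '' ↑R ⊆
        (↑(insert (e v₀) S) ∪ e '' ↑R : Set W) := by
      refine Set.union_subset_union_left _ (Set.union_subset ?_ ?_)
      · rintro _ ⟨i, -⟩; exact i.elim0
      · exact fun x hx => by simp [Finset.mem_coe.1 hx]
    exact ⟨hI.1.mono hsub, fun x hx y hy => hI.2 x (hsub hx) y (hsub hy)⟩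

end Definability

/-! ### Countable models of `T*_C` are existentially complete -/

section Axiomatization

open Language

/-- `G` with the new vertices of `D` attached along `x`. -/
def glue {V R T : Type} (G : SimpleGraph V) (x : R → V) (D : SimpleGraph (R ⊕ T)) :
    SimpleGraph (V ⊕ T) where
  Adj
    | .inl v, .inl w => G.Adj v w
    | .inl v, .inr t => ∃ r, x r = v ∧ D.Adj (.inl r) (.inr t)
    | .inr t, .inl v => ∃ r, x r = v ∧ D.Adj (.inl r) (.inr t)
    | .inr t, .inr t' => D.Adj (.inr t) (.inr t')
  symm := ⟨by
    rintro (v | t) (w | t') h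
    · exact SimpleGraph.Adj.symm (G := G) h
    · exact h
    · exact h
    · exact SimpleGraph.Adj.symm (G := D) h⟩
  loopless := ⟨by
    rintro (v | t) h
    · exact G.loopless.irrefl _ h
    · exact D.loopless.irrefl _ h⟩

/-- The left side can be expressed in `G` alone when `U`, `R` and `T` are finite: `σ` selects the
vertices of `C` that go to new vertices, and `g` places the others. The values of `g` where `σ` is
not `none` are irrelevant, but require `V` to be nonempty. -/
theorem exists_tuple_of_isContained_glue {U V R T : Type} [Nonempty V] {C : SimpleGraph U}
    {G : SimpleGraph V} {x : R → V} {D : SimpleGraph (R ⊕ T)} :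
    (∃ g : U → V, ∃ σ : U → Option T, ∀ u u',
      (σ u = none → σ u' = none → (C.Adj u u' → G.Adj (g u) (g u')) ∧ (g u = g u' → u = u')) ∧
      (∀ t, σ u = none → σ u' = some t → C.Adj u u' → ∃ r, x r = g u ∧ D.Adj (.inl r) (.inr t)) ∧
      (∀ t t', σ u = some t → σ u' = some t' →
        (C.Adj u u' → D.Adj (.inr t) (.inr t')) ∧ (t = t' → u = u'))) ↔ C.IsContained (glue G x D) := by
  classical
  constructor
  · rintro ⟨g, σ, h⟩
    let f : U → V ⊕ T := fun u => match σ u with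
      | none => .inl (g u)
      | some t => .inr t
    have f0 : ∀ u, σ u = none → f u = .inl (g u) := fun u hu => by simp only [f, hu]
    have f1 : ∀ u t, σ u = some t → f u = .inr t := fun u t hu => by simp only [f, hu]
    refine ⟨⟨⟨f, ?_⟩, ?_⟩⟩
    · intro u u' huu
      rcases h0 : σ u with _ | t <;> rcases h1 : σ u' with _ | t'
      · rw [f0 u h0, f0 u' h1]; exact ((h u u').1 h0 h1).1 huu
      · rw [f0 u h0, f1 u' t' h1]; exact (h u u').2.1 t' h0 h1 huu
      · rw [f1 u t h0, f0 u' h1]; exact (h u' u).2.1 t h1 h0 huu.symm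
      · rw [f1 u t h0, f1 u' t' h1]; exact ((h u u').2.2 t t' h0 h1).1 huu
    · intro u u' huu
      change f u = f u' at huu
      rcases h0 : σ u with _ | t <;> rcases h1 : σ u' with _ | t'
      · rw [f0 u h0, f0 u' h1] at huu; exact ((h u u').1 h0 h1).2 (Sum.inl.inj huu)
      · rw [f0 u h0, f1 u' t' h1] at huu; simp at huu
      · rw [f1 u t h0, f0 u' h1] at huu; simp at huu
      · rw [f1 u t h0, f1 u' t' h1] at huu
        exact ((h u u').2.2 t t' h0 h1).2 (Sum.inr.inj huu)
  · rintro ⟨f, hf⟩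
    obtain ⟨v₀⟩ := ‹Nonempty V›
    refine ⟨fun u => (f u).elim id fun _ => v₀, fun u => (f u).elim (fun _ => none) some, ?_⟩
    intro u u'
    have hadj : C.Adj u u' → (glue G x D).Adj (f u) (f u') := fun h => f.map_adj h
    have hinj : f u = f u' → u = u' := fun h => hf h
    rcases h0 : f u with v | t <;> rcases h1 : f u' with v' | t' <;> rw [h0, h1] at hadj hinj <;>
      simp_all [glue]

theorem IsExistentiallyComplete.nonempty {U V : Type} [Nonempty U] {C : SimpleGraph U}
    (hC : ∀ u, ∃ v, C.Adj u v) {G : SimpleGraph V} (hG : IsExistentiallyComplete C G) :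
    Nonempty V := by
  by_contra hV
  rw [not_nonempty_iff] at hV
  have hf : IsCountableFree C (⊥ : SimpleGraph Unit) := by
    refine ⟨inferInstance, ?_⟩
    rintro ⟨f, -⟩
    obtain ⟨u⟩ := ‹Nonempty U›
    obtain ⟨v, hv⟩ := hC u
    exact f.map_adj hv
  let e : G ↪g (⊥ : SimpleGraph Unit) := ⟨⟨isEmptyElim, fun a => isEmptyElim a⟩, fun {a} => isEmptyElim a⟩
  obtain ⟨j, -⟩ := hG.locallyRetracts hf e ∅ {()} (by simp)
  exact isEmptyElim (j ())

/-- `G` satisfies every sentence of `T*_C`. -/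
def ModelsEC {U V : Type} (C : SimpleGraph U) (G : SimpleGraph V) : Prop :=
  ∀ φ ∈ existentiallyCompleteTheory C, GraphRealize G φ Empty.elim

theorem ModelsEC.transfer {U V : Type} {C : SimpleGraph U} {G : SimpleGraph V}
    (hG : ModelsEC C G) {P : ∀ V : Type, SimpleGraph V → (Empty → V) → Prop}
    (hP : FODefinable P)
    (h : ∀ (V : Type) (G : SimpleGraph V), IsExistentiallyComplete C G → P V G Empty.elim) :
    P V G Empty.elim := by
  obtain ⟨φ, hφ⟩ := hP
  exact (hφ _ _ _).1 (hG φ fun V G h' => (hφ _ _ _).2 (h V G h'))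

theorem ModelsEC.free {U V : Type} [Finite U] {C : SimpleGraph U} {G : SimpleGraph V}
    (hG : ModelsEC C G) : C.Free G := by
  have hP : FODefinable (α := Empty) fun V G v => ∀ g : U → V,
      ¬ ((∀ u u', C.Adj u u' → G.Adj (g u) (g u')) ∧ ∀ u u', g u = g u' → u = u') :=
    FODefinable.forall_tuple (α := Empty) (β := U)
      (P := fun V G v => ¬ ((∀ u u', C.Adj u u' → G.Adj (v (.inr u)) (v (.inr u'))) ∧
        ∀ u u', v (.inr u) = v (.inr u') → u = u'))
      (FODefinable.of_local (α := Empty ⊕ U) fun adj eq =>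
        ¬ ((∀ u u', C.Adj u u' → adj (.inr u) (.inr u')) ∧ ∀ u u', eq (.inr u) (.inr u') → u = u'))
  have := hG.transfer hP (by
    rintro V G h g ⟨h1, h2⟩
    exact h.1.2 ⟨⟨⟨g, fun {a b} => h1 a b⟩, fun a b => h2 a b⟩⟩)
  rintro ⟨f, hf⟩
  exact this f ⟨fun u u' h => f.map_adj h, fun u u' h => hf h⟩

theorem IsExistentiallyComplete.exists_tuple {U V R T : Type} [Finite R] [Finite T] [Nonempty T]
    {C : SimpleGraph U} {G : SimpleGraph V} (hG : IsExistentiallyComplete C G)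
    (D : SimpleGraph (R ⊕ T)) (x : R → V)
    (hx : ∀ r r', (x r = x r' → r = r') ∧ (G.Adj (x r) (x r') ↔ D.Adj (.inl r) (.inl r')))
    (hfree : C.Free (glue G x D)) :
    ∃ y : T → V, (∀ t t', (y t = y t' → t = t') ∧ (G.Adj (y t) (y t') ↔ D.Adj (.inr t) (.inr t'))) ∧
      ∀ r t, x r ≠ y t ∧ (G.Adj (x r) (y t) ↔ D.Adj (.inl r) (.inr t)) := by
  classical
  have := Fintype.ofFinite R
  have := Fintype.ofFinite T
  have := hG.1.1
  let e : G ↪g glue G x D := ⟨⟨Sum.inl, Sum.inl_injective⟩, Iff.rfl⟩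
  obtain ⟨j, hj, hI⟩ := hG.locallyRetracts (H := glue G x D) ⟨inferInstance, hfree⟩ e
    (Finset.univ.image x) (Finset.univ.image Sum.inr) (by simp)
  have mT : ∀ t : T, (Sum.inr t : V ⊕ T) ∈
      (↑(Finset.univ.image (Sum.inr : T → V ⊕ T)) ∪ e '' ↑(Finset.univ.image x) : Set (V ⊕ T)) :=
    fun t => Or.inl (by simp)
  have mR : ∀ r : R, (Sum.inl (x r) : V ⊕ T) ∈
      (↑(Finset.univ.image (Sum.inr : T → V ⊕ T)) ∪ e '' ↑(Finset.univ.image x) : Set (V ⊕ T)) :=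
    fun r => Or.inr ⟨x r, by simp, rfl⟩
  have jx : ∀ r, j (Sum.inl (x r)) = x r := fun r => hj (x r) (by simp)
  refine ⟨fun t => j (.inr t), fun t t' => ⟨fun h => ?_, ?_⟩, fun r t => ⟨fun h => ?_, ?_⟩⟩
  · exact Sum.inr_injective (hI.1 (mT t) (mT t') h)
  · exact hI.2 _ (mT t) _ (mT t')
  · rw [← jx r] at h
    exact Sum.inl_ne_inr (hI.1 (mR r) (mT t) h)
  · have := hI.2 _ (mR r) _ (mT t)
    rw [jx] at this
    rw [this]
    change (∃ r', x r' = x r ∧ _) ↔ _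
    constructor
    · rintro ⟨r', h, h'⟩
      rwa [(hx r' r).1 h] at h'
    · exact fun h => ⟨r, rfl, h⟩

/-- For fixed `D`, the statement that each tuple `x` of the right type either makes the glued graph
contain `C` or extends to a copy of `D` is a first-order sentence. It holds in existentially
complete graphs, hence belongs to `T*_C`. -/
theorem ModelsEC.exists_tuple {U V R T : Type} [Finite U] [Nonempty U] [Finite R] [Finite T]
    [Nonempty T] [Nonempty V] {C : SimpleGraph U} (hC : ∀ u, ∃ v, C.Adj u v)
    {G : SimpleGraph V} (hG : ModelsEC C G)
    (D : SimpleGraph (R ⊕ T)) (x : R → V)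
    (hx : ∀ r r', (x r = x r' → r = r') ∧ (G.Adj (x r) (x r') ↔ D.Adj (.inl r) (.inl r')))
    (hfree : C.Free (glue G x D)) :
    ∃ y : T → V, (∀ t t', (y t = y t' → t = t') ∧ (G.Adj (y t) (y t') ↔ D.Adj (.inr t) (.inr t'))) ∧
      ∀ r t, x r ≠ y t ∧ (G.Adj (x r) (y t) ↔ D.Adj (.inl r) (.inr t)) := by
  have hP : FODefinable (α := Empty) fun V G _ => ∀ x : R → V,
      (∀ r r', (x r = x r' → r = r') ∧ (G.Adj (x r) (x r') ↔ D.Adj (.inl r) (.inl r'))) →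
      (∃ g : U → V, ∃ σ : U → Option T, ∀ u u',
      (σ u = none → σ u' = none → (C.Adj u u' → G.Adj (g u) (g u')) ∧ (g u = g u' → u = u')) ∧
      (∀ t, σ u = none → σ u' = some t → C.Adj u u' → ∃ r, x r = g u ∧ D.Adj (.inl r) (.inr t)) ∧
      (∀ t t', σ u = some t → σ u' = some t' →
        (C.Adj u u' → D.Adj (.inr t) (.inr t')) ∧ (t = t' → u = u'))) ∨
      ∃ y : T → V, (∀ t t', (y t = y t' → t = t') ∧
        (G.Adj (y t) (y t') ↔ D.Adj (.inr t) (.inr t'))) ∧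
      ∀ r t, x r ≠ y t ∧ (G.Adj (x r) (y t) ↔ D.Adj (.inl r) (.inr t)) := by
    refine FODefinable.forall_tuple (α := Empty) (β := R) (P := fun V G v =>
      (∀ r r', (v (.inr r) = v (.inr r') → r = r') ∧
        (G.Adj (v (.inr r)) (v (.inr r')) ↔ D.Adj (.inl r) (.inl r'))) →
      (∃ g : U → V, ∃ σ : U → Option T, ∀ u u',
      (σ u = none → σ u' = none → (C.Adj u u' → G.Adj (g u) (g u')) ∧ (g u = g u' → u = u')) ∧
      (∀ t, σ u = none → σ u' = some t → C.Adj u u' →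
        ∃ r, v (.inr r) = g u ∧ D.Adj (.inl r) (.inr t)) ∧
      (∀ t t', σ u = some t → σ u' = some t' →
        (C.Adj u u' → D.Adj (.inr t) (.inr t')) ∧ (t = t' → u = u'))) ∨
      ∃ y : T → V, (∀ t t', (y t = y t' → t = t') ∧
        (G.Adj (y t) (y t') ↔ D.Adj (.inr t) (.inr t'))) ∧
      ∀ r t, v (.inr r) ≠ y t ∧ (G.Adj (v (.inr r)) (y t) ↔ D.Adj (.inl r) (.inr t))) ?_
    refine FODefinable.imp ?_ (FODefinable.or ?_ ?_)
    · exact FODefinable.of_local (α := Empty ⊕ R) fun adj eq =>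
        ∀ r r', (eq (.inr r) (.inr r') → r = r') ∧
          (adj (.inr r) (.inr r') ↔ D.Adj (.inl r) (.inl r'))
    · exact FODefinable.exists_tuple (α := Empty ⊕ R) (β := U)
        (FODefinable.of_local (α := (Empty ⊕ R) ⊕ U) fun adj eq =>
          ∃ σ : U → Option T, ∀ u u',
          (σ u = none → σ u' = none → (C.Adj u u' → adj (.inr u) (.inr u')) ∧
            (eq (.inr u) (.inr u') → u = u')) ∧
          (∀ t, σ u = none → σ u' = some t → C.Adj u u' →
            ∃ r, eq (.inl (.inr r)) (.inr u) ∧ D.Adj (.inl r) (.inr t)) ∧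
          (∀ t t', σ u = some t → σ u' = some t' →
            (C.Adj u u' → D.Adj (.inr t) (.inr t')) ∧ (t = t' → u = u')))
    · exact FODefinable.exists_tuple (α := Empty ⊕ R) (β := T)
        (FODefinable.of_local (α := (Empty ⊕ R) ⊕ T) fun adj eq =>
          (∀ t t', (eq (.inr t) (.inr t') → t = t') ∧
            (adj (.inr t) (.inr t') ↔ D.Adj (.inr t) (.inr t'))) ∧
          ∀ r t, ¬ eq (.inl (.inr r)) (.inr t) ∧
            (adj (.inl (.inr r)) (.inr t) ↔ D.Adj (.inl r) (.inr t)))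
  have key := hG.transfer hP (by
    intro V G h x hx
    have := h.nonempty hC
    rw [or_iff_not_imp_left, exists_tuple_of_isContained_glue]
    exact fun hfree => h.exists_tuple D x hx hfree)
  exact (key x hx).resolve_left fun h => hfree (exists_tuple_of_isContained_glue.1 h)

/-- The countable models of `T*_C` are existentially complete. -/
theorem ModelsEC.isExistentiallyComplete {U V : Type} [Finite U] [Nonempty U] [Countable V]
    [Nonempty V] {C : SimpleGraph U} (hC : ∀ u, ∃ v, C.Adj u v) {G : SimpleGraph V}
    (hG : ModelsEC C G) : IsExistentiallyComplete C G := by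
  classical
  refine isExistentiallyComplete_of_locallyRetracts ⟨inferInstance, hG.free⟩ fun W H hH e => ?_
  refine LocallyRetracts.of_disjoint e fun R S hS hdisj => ?_
  have : Nonempty S := hS.to_subtype
  let p : R ⊕ S → W := Sum.elim (fun r => e r.1) (fun s => s.1)
  let D : SimpleGraph (R ⊕ S) := H.comap p
  -- The glued graph omits all edges between `S` and vertices of `G` outside `R`, so it maps
  -- injectively into `H` as a subgraph, not necessarily induced. This is enough for freeness.
  have hfree : C.Free (glue G (fun r : R => r.1) D) := by
    refine fun hc => hH.2 (hc.trans ⟨⟨⟨Sum.elim e Subtype.val, ?_⟩, ?_⟩⟩)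
    · rintro (v | t) (v' | t') h
      · exact e.map_adj_iff.2 h
      · obtain ⟨r, rfl, hr⟩ := h
        exact hr
      · obtain ⟨r, rfl, hr⟩ := h
        exact SimpleGraph.Adj.symm (G := H) hr
      · exact h
    · rintro (v | t) (v' | t') h
      · exact congrArg _ (e.injective h)
      · exact absurd h (hdisj _ t'.2 v)
      · exact absurd h.symm (hdisj _ t.2 v')
      · exact congrArg _ (Subtype.ext h)
  obtain ⟨y, hy1, hy2⟩ := hG.exists_tuple hC D (fun r : R => r.1)
    (fun r r' => ⟨fun h => Subtype.ext h, e.map_adj_iff.symm⟩) hfree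
  obtain ⟨v₀⟩ := ‹Nonempty V›
  refine ⟨fun w => if h : w ∈ S then y ⟨w, h⟩ else v₀, ?_, ?_, ?_, ?_⟩
  · intro w hw w' hw' h
    have hw : w ∈ S := hw
    have hw' : w' ∈ S := hw'
    simp only [hw, hw', dif_pos] at h
    exact congrArg Subtype.val ((hy1 _ _).1 h)
  · intro w hw r hr
    simp only [hw, dif_pos]
    exact (hy2 ⟨r, hr⟩ ⟨w, hw⟩).1
  · intro w hw w' hw'
    simp only [hw, hw', dif_pos]
    exact (hy1 _ _).2
  · intro w hw r hr
    simp only [hw, dif_pos]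
    exact (hy2 ⟨r, hr⟩ ⟨w, hw⟩).2

end Axiomatization

/-! ### Existentially complete extensions as limits of generic sequences -/

section ExistentiallyCompleteExtension

theorem SimpleGraph.Free.map {U V W : Type} {C : SimpleGraph U} (hC : ∀ u, ∃ v, C.Adj u v)
    {G : SimpleGraph V} (hG : C.Free G) (e : V ↪ W) : C.Free (G.map e) := by
  rintro ⟨f, hf⟩
  have h : ∀ u, ∃ v, e v = f u := by
    intro u
    obtain ⟨u', hu⟩ := hC u
    obtain ⟨v, w, -, h1, -⟩ := (SimpleGraph.map_adj _ _ _ _).1 (f.map_adj hu)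
    exact ⟨v, h1⟩
  choose g hg using h
  refine hG ⟨⟨⟨g, ?_⟩, ?_⟩⟩
  · intro u u' hu
    have := f.map_adj hu
    rwa [← hg, ← hg, SimpleGraph.map_adj_apply] at this
  · intro u u' hu
    apply hf
    rw [← hg, ← hg]
    exact congrArg e hu

variable {U V₀ : Type} {C : SimpleGraph U}

/-- The vertices in use after adding the finite set `t` of new vertices. -/
def stageCarrier (V₀ : Type) (t : Finset ℕ) : Set (V₀ ⊕ ℕ) :=
  {x | ∀ i, x = Sum.inr i → i ∈ t}

theorem stageCarrier_mono {t t' : Finset ℕ} (h : t ⊆ t') :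
    stageCarrier V₀ t ⊆ stageCarrier V₀ t' := fun _ hx i hi => h (hx i hi)

/-- A `C`-free graph obtained by adding finitely many vertices to `V₀`. -/
structure ExtensionStage (C : SimpleGraph U) (V₀ : Type) where
  /-- The new vertices. -/
  new : Finset ℕ
  /-- The graph. -/
  graph : SimpleGraph (V₀ ⊕ ℕ)
  supp : ∀ x y, graph.Adj x y → x ∈ stageCarrier V₀ new
  free : C.Free graph

instance : Preorder (ExtensionStage C V₀) where
  le p q := p.new ⊆ q.new ∧ ∀ x ∈ stageCarrier V₀ p.new, ∀ y ∈ stageCarrier V₀ p.new,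
    q.graph.Adj x y ↔ p.graph.Adj x y
  le_refl p := ⟨subset_rfl, fun _ _ _ _ => Iff.rfl⟩
  le_trans p q r hpq hqr := ⟨hpq.1.trans hqr.1, fun x hx y hy =>
    (hqr.2 x (stageCarrier_mono hpq.1 hx) y (stageCarrier_mono hpq.1 hy)).trans
      (hpq.2 x hx y hy)⟩

/-- An isomorphism type of finite extensions of a finite set of vertices. -/
abbrev ExtensionTask (V₀ : Type) : Type :=
  Σ (R : Finset (V₀ ⊕ ℕ)) (k : ℕ), SimpleGraph (R ⊕ Fin k)

/-- The extension prescribed by `τ` is present in `p`. -/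
def ExtensionStage.Realizes (p : ExtensionStage C V₀) (τ : ExtensionTask V₀) : Prop :=
  ∃ y : Fin τ.2.1 → V₀ ⊕ ℕ, (∀ a, Sum.elim (fun r : τ.1 => r.1) y a ∈ stageCarrier V₀ p.new) ∧
    Function.Injective (Sum.elim (fun r : τ.1 => r.1) y) ∧
    ∀ a b, p.graph.Adj (Sum.elim (fun r : τ.1 => r.1) y a) (Sum.elim (fun r : τ.1 => r.1) y b) ↔
      τ.2.2.Adj a b

/-- The stages at which `τ` is either present or impossible to add. -/
def decidingStages (C : SimpleGraph U) (τ : ExtensionTask V₀) :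
    Order.Cofinal (ExtensionStage C V₀) where
  carrier := {p | p.Realizes τ ∨ ∀ q, p ≤ q → ¬ q.Realizes τ}
  isCofinal p := by
    by_cases h : ∃ q, p ≤ q ∧ q.Realizes τ
    · obtain ⟨q, hpq, hq⟩ := h
      exact ⟨q, Or.inl hq, hpq⟩
    · push Not at h
      exact ⟨p, Or.inr h, le_rfl⟩

/-- The union of an increasing sequence of stages. -/
def stageLimit (p : ℕ → ExtensionStage C V₀) :
    SimpleGraph {x : V₀ ⊕ ℕ | ∃ n, x ∈ stageCarrier V₀ (p n).new} where
  Adj x y := ∃ n, (p n).graph.Adj x y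
  symm := ⟨fun _ _ ⟨n, h⟩ => ⟨n, h.symm⟩⟩
  loopless := ⟨fun _ ⟨_, h⟩ => SimpleGraph.irrefl _ h⟩

theorem stageLimit_adj_iff {p : ℕ → ExtensionStage C V₀} (hp : Monotone p) {n : ℕ}
    {x y : {x : V₀ ⊕ ℕ | ∃ n, x ∈ stageCarrier V₀ (p n).new}}
    (hx : x.1 ∈ stageCarrier V₀ (p n).new) (hy : y.1 ∈ stageCarrier V₀ (p n).new) :
    (stageLimit p).Adj x y ↔ (p n).graph.Adj x y := by
  constructor
  · rintro ⟨m, h⟩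
    have h1 : (p (max n m)).graph.Adj x y :=
      ((hp (le_max_right n m)).2 _ ((p m).supp _ _ h) _ ((p m).supp _ _ h.symm)).2 h
    exact ((hp (le_max_left n m)).2 _ hx _ hy).1 h1
  · exact fun h => ⟨n, h⟩

theorem exists_stage_mem {p : ℕ → ExtensionStage C V₀} (hp : Monotone p) {ι : Type} [Finite ι]
    (f : ι → V₀ ⊕ ℕ) (hf : ∀ i, ∃ n, f i ∈ stageCarrier V₀ (p n).new) (n : ℕ) :
    ∃ m, n ≤ m ∧ ∀ i, f i ∈ stageCarrier V₀ (p m).new := by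
  choose g hg using hf
  have := Fintype.ofFinite ι
  refine ⟨max n (Finset.univ.sup g), le_max_left _ _, fun i => ?_⟩
  exact stageCarrier_mono (hp ((Finset.le_sup (Finset.mem_univ i)).trans (le_max_right _ _))).1
    (hg i)

theorem stageLimit_free [Finite U] {p : ℕ → ExtensionStage C V₀} (hp : Monotone p) :
    C.Free (stageLimit p) := by
  rintro ⟨f, hf⟩
  obtain ⟨m, -, hm⟩ := exists_stage_mem hp (fun u => (f u).1) (fun u => (f u).2) 0
  refine (p m).free ⟨⟨⟨fun u => (f u).1, ?_⟩, ?_⟩⟩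
  · intro u u' h
    exact (stageLimit_adj_iff hp (hm u) (hm u')).1 (f.map_adj h)
  · exact fun u u' h => hf (Subtype.ext h)

/-- A finite part of a `C`-free extension of the limit can be added to a stage. -/
theorem exists_stage_extending (hC : ∀ u, ∃ v, C.Adj u v) {p : ℕ → ExtensionStage C V₀}
    (hp : Monotone p) {W : Type} {H : SimpleGraph W} (hH : C.Free H) (e : stageLimit p ↪g H)
    (m : ℕ) {k : ℕ} (s : Fin k → W) (hs : Function.Injective s) (hdisj : ∀ i v, e v ≠ s i)
    (w₀ : W) :
    ∃ q, p m ≤ q ∧ ∃ y : Fin k → V₀ ⊕ ℕ, Function.Injective y ∧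
      (∀ i, y i ∈ stageCarrier V₀ q.new ∧ y i ∉ stageCarrier V₀ (p m).new) ∧
      (∀ i j, q.graph.Adj (y i) (y j) ↔ H.Adj (s i) (s j)) ∧
      ∀ i x, x.1 ∈ stageCarrier V₀ (p m).new → (q.graph.Adj x.1 (y i) ↔ H.Adj (e x) (s i)) := by
  classical
  obtain ⟨N, hN⟩ : ∃ N, ∀ i ∈ (p m).new, i < N :=
    ⟨(p m).new.sup id + 1, fun i hi => Nat.lt_succ_of_le (Finset.le_sup (f := id) hi)⟩
  let s' : ℕ → W := fun i => if h : i < k then s ⟨i, h⟩ else w₀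
  let ψ : V₀ ⊕ ℕ → W := fun x =>
    if h : x ∈ stageCarrier V₀ (p m).new then e ⟨x, m, h⟩
    else s' (x.elim (fun _ => 0) (fun i => i - N))
  let T : Finset ℕ := (p m).new ∪ (Finset.range k).image (N + ·)
  -- Numbers from `N` on are unused at stage `m`. The next stage is the pullback of `H` along `ψ`,
  -- with no edges at unused vertices.
  let y : Fin k → V₀ ⊕ ℕ := fun i => Sum.inr (N + i)
  have yT : ∀ i, y i ∈ stageCarrier V₀ T := by
    rintro i _ h
    obtain rfl := Sum.inr_injective h
    exact Finset.mem_union_right _ (Finset.mem_image_of_mem _ (by simp))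
  have yn : ∀ i, y i ∉ stageCarrier V₀ (p m).new := by
    intro i h
    have := hN _ (h _ rfl)
    omega
  have ψy : ∀ i, ψ (y i) = s i := by
    intro i
    have : ψ (y i) = s' (N + i - N) := dif_neg (yn i)
    rw [this]
    simp [s']
  have ψe : ∀ x (h : x ∈ stageCarrier V₀ (p m).new), ψ x = e ⟨x, m, h⟩ := fun x h => dif_pos h
  have cases : ∀ x ∈ stageCarrier V₀ T, x ∈ stageCarrier V₀ (p m).new ∨ ∃ i, x = y i := by
    intro x hx
    rcases x with v | i
    · exact Or.inl fun _ h => by simp at h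
    · rcases Finset.mem_union.1 (hx i rfl) with h | h
      · left
        rintro _ h'
        obtain rfl := Sum.inr_injective h'
        exact h
      · right
        obtain ⟨a, ha, rfl⟩ := Finset.mem_image.1 h
        exact ⟨⟨a, by simpa using ha⟩, rfl⟩
  have ψinj : Set.InjOn ψ (stageCarrier V₀ T) := by
    intro x hx x' hx' h
    rcases cases x hx with h1 | ⟨i, rfl⟩ <;> rcases cases x' hx' with h2 | ⟨i', rfl⟩
    · rw [ψe x h1, ψe x' h2] at h
      exact congrArg Subtype.val (e.injective h)
    · rw [ψe x h1, ψy] at h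
      exact absurd h (hdisj _ _)
    · rw [ψe x' h2, ψy] at h
      exact absurd h.symm (hdisj _ _)
    · rw [ψy, ψy] at h
      rw [hs h]
  let q : ExtensionStage C V₀ :=
    { new := T
      graph :=
        { Adj := fun x x' => x ∈ stageCarrier V₀ T ∧ x' ∈ stageCarrier V₀ T ∧ H.Adj (ψ x) (ψ x')
          symm := ⟨fun _ _ h => ⟨h.2.1, h.1, h.2.2.symm⟩⟩
          loopless := ⟨fun _ h => SimpleGraph.irrefl _ h.2.2⟩ }
      supp := fun _ _ h => h.1
      free := by
        rintro ⟨f, hf⟩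
        -- `C` has no isolated vertex, so a copy of `C` stays among the used vertices, where `ψ` is
        -- injective.
        have hT : ∀ u, f u ∈ stageCarrier V₀ T := fun u =>
          let ⟨_, hu⟩ := hC u
          (f.map_adj hu).1
        exact hH ⟨⟨⟨fun u => ψ (f u), fun h => (f.map_adj h).2.2⟩,
          fun u u' h => hf (ψinj (hT u) (hT u') h)⟩⟩ }
  have sub : (p m).new ⊆ T := Finset.subset_union_left
  refine ⟨q, ⟨sub, fun x hx x' hx' => ?_⟩, y, ?_, fun i => ⟨yT i, yn i⟩, fun i j => ?_,
    fun i x hx => ?_⟩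
  · have : q.graph.Adj x x' ↔ H.Adj (ψ x) (ψ x') :=
      ⟨fun h => h.2.2, fun h => ⟨stageCarrier_mono sub hx, stageCarrier_mono sub hx', h⟩⟩
    rw [this, ψe x hx, ψe x' hx', e.map_adj_iff]
    exact stageLimit_adj_iff hp hx hx'
  · intro i j h
    have := Sum.inr_injective h
    exact Fin.ext (by simpa using this)
  · rw [← ψy, ← ψy]
    exact ⟨fun h => h.2.2, fun h => ⟨yT _, yT _, h⟩⟩
  · rw [← ψy]
    have : e x = ψ x.1 := (ψe x.1 hx).symm
    rw [this]
    exact ⟨fun h => h.2.2, fun h => ⟨stageCarrier_mono sub hx, yT _, h⟩⟩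

/-- Each finite extension task is decided at some stage. It cannot be decided negatively, because
the extension `H` of the limit shows that a still later stage can be enlarged to realize it. -/
theorem stageLimit_locallyRetracts (hC : ∀ u, ∃ v, C.Adj u v) {p : ℕ → ExtensionStage C V₀}
    (hp : Monotone p) (hτ : ∀ τ, ∃ n, p n ∈ decidingStages C τ)
    {W : Type} {H : SimpleGraph W} (hH : C.Free H) (e : stageLimit p ↪g H) :
    LocallyRetracts (stageLimit p) H e := by
  classical
  refine LocallyRetracts.of_disjoint e fun R S hS hdisj => ?_
  obtain ⟨w₀, hw₀⟩ := hS
  let ε : S ≃ Fin S.card := S.equivFin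
  let s : Fin S.card → W := fun i => (ε.symm i).1
  have hs : Function.Injective s := Subtype.val_injective.comp ε.symm.injective
  have hsε : ∀ w (hw : w ∈ S), s (ε ⟨w, hw⟩) = w := fun w hw => by simp [s]
  let R₀ : Finset (V₀ ⊕ ℕ) := R.map ⟨Subtype.val, Subtype.val_injective⟩
  have hR₀ : ∀ r : R₀, ∃ n, r.1 ∈ stageCarrier V₀ (p n).new := by
    rintro ⟨r, hr⟩
    obtain ⟨x, -, rfl⟩ := Finset.mem_map.1 hr
    exact x.2
  let P : R₀ ⊕ Fin S.card → W := Sum.elim (fun r => e ⟨r.1, hR₀ r⟩) s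
  let τ : ExtensionTask V₀ := ⟨R₀, S.card, H.comap P⟩
  obtain ⟨n, hn⟩ := hτ τ
  have hreal : (p n).Realizes τ := by
    refine hn.resolve_right fun hno => ?_
    obtain ⟨m, hnm, hm⟩ := exists_stage_mem hp (fun r : R₀ => r.1) hR₀ n
    obtain ⟨q, hq, y, hy1, hy2, hy3, hy4⟩ := exists_stage_extending hC hp hH e m s hs
      (fun i v => hdisj _ (ε.symm i).2 v) w₀
    refine hno q ((hp hnm).trans hq) ⟨y, ?_, ?_, ?_⟩
    · rintro (r | i)
      · exact stageCarrier_mono hq.1 (hm r)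
      · exact (hy2 i).1
    · rintro (r | i) (r' | i') h
      · exact congrArg _ (Subtype.ext h)
      · have h' : r.1 = y i' := h
        exact absurd (h' ▸ hm r) (hy2 i').2
      · have h' : r'.1 = y i := h.symm
        exact absurd (h' ▸ hm r') (hy2 i).2
      · exact congrArg _ (hy1 h)
    · rintro (r | i) (r' | i')
      · change q.graph.Adj r.1 r'.1 ↔ H.Adj (e ⟨r.1, hR₀ r⟩) (e ⟨r'.1, hR₀ r'⟩)
        rw [hq.2 _ (hm r) _ (hm r'), e.map_adj_iff]
        exact (stageLimit_adj_iff hp (x := ⟨r.1, hR₀ r⟩) (y := ⟨r'.1, hR₀ r'⟩) (hm r) (hm r')).symm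
      · exact hy4 i' ⟨r.1, hR₀ r⟩ (hm r)
      · change q.graph.Adj (y i) r'.1 ↔ H.Adj (s i) (e ⟨r'.1, hR₀ r'⟩)
        rw [SimpleGraph.adj_comm, H.adj_comm]
        exact hy4 i ⟨r'.1, hR₀ r'⟩ (hm r')
      · exact hy3 i i'
  obtain ⟨y, hy1, hy2, hy3⟩ := hreal
  have mR : ∀ r ∈ R, r.1 ∈ R₀ := fun r hr => Finset.mem_map_of_mem _ hr
  let y' : W → {x : V₀ ⊕ ℕ | ∃ n, x ∈ stageCarrier V₀ (p n).new} := fun w =>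
    if h : w ∈ S then ⟨y (ε ⟨w, h⟩), n, hy1 (.inr _)⟩ else ⟨y (ε ⟨w₀, hw₀⟩), n, hy1 (.inr _)⟩
  have hy' : ∀ w (h : w ∈ S), y' w = ⟨y (ε ⟨w, h⟩), n, hy1 (.inr _)⟩ := fun w h => dif_pos h
  refine ⟨y', ?_, ?_, ?_, ?_⟩
  · intro w hw w' hw' h
    rw [hy' w hw, hy' w' hw'] at h
    have h1 : (Sum.inr (ε ⟨w, hw⟩) : R₀ ⊕ Fin S.card) = Sum.inr (ε ⟨w', hw'⟩) :=
      hy2 (congrArg Subtype.val h)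
    exact congrArg Subtype.val (ε.injective (Sum.inr_injective h1))
  · intro w hw r hr h
    rw [hy' w hw] at h
    have h1 : (Sum.inl ⟨r.1, mR r hr⟩ : R₀ ⊕ Fin S.card) = Sum.inr (ε ⟨w, hw⟩) :=
      hy2 (congrArg Subtype.val h)
    exact Sum.inl_ne_inr h1
  · intro w hw w' hw'
    rw [hy' w hw, hy' w' hw', stageLimit_adj_iff hp (n := n) (hy1 (.inr _)) (hy1 (.inr _))]
    have := hy3 (.inr (ε ⟨w, hw⟩)) (.inr (ε ⟨w', hw'⟩))
    refine this.trans ?_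
    change H.Adj (s _) (s _) ↔ _
    rw [hsε, hsε]
  · intro w hw r hr
    rw [hy' w hw, stageLimit_adj_iff hp (n := n) (hy1 (.inl ⟨r.1, mR r hr⟩)) (hy1 (.inr _))]
    have := hy3 (.inl ⟨r.1, mR r hr⟩) (.inr (ε ⟨w, hw⟩))
    refine this.trans ?_
    change H.Adj (e r) (s _) ↔ _
    rw [hsε]

/-- Every countable `C`-free graph is an induced subgraph of an existentially complete one. -/
theorem exists_isExistentiallyComplete_embedding [Finite U] [Nonempty U]
    (hC : ∀ u, ∃ v, C.Adj u v) {G₀ : SimpleGraph V₀} (hG₀ : IsCountableFree C G₀) :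
    ∃ (V : Type) (G : SimpleGraph V), IsExistentiallyComplete C G ∧ Nonempty (G₀ ↪g G) := by
  classical
  have := hG₀.1
  have : Encodable (ExtensionTask V₀) := Encodable.ofCountable _
  have hin : ∀ (t : Finset ℕ) v, (Sum.inl v : V₀ ⊕ ℕ) ∈ stageCarrier V₀ t := fun t v i h => by
    simp at h
  let p₀ : ExtensionStage C V₀ :=
    -- One extra vertex ensures that the limit is nonempty even if `V₀` is empty.
    { new := {0}
      graph := G₀.map Function.Embedding.inl
      supp := by
        rintro x y h
        obtain ⟨v, w, -, rfl, -⟩ := (SimpleGraph.map_adj _ _ _ _).1 h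
        exact hin _ _
      free := hG₀.2.map hC _ }
  let p := Order.sequenceOfCofinals p₀ (decidingStages C)
  have hp : Monotone p := Order.sequenceOfCofinals.monotone _ _
  have hτ : ∀ τ, ∃ n, p n ∈ decidingStages C τ := fun τ =>
    ⟨_, Order.sequenceOfCofinals.encode_mem p₀ (decidingStages C) τ⟩
  have h0 : p 0 = p₀ := rfl
  have hne : Nonempty {x : V₀ ⊕ ℕ | ∃ n, x ∈ stageCarrier V₀ (p n).new} :=
    ⟨⟨Sum.inr 0, 0, fun i h => by rw [h0, ← Sum.inr_injective h]; simp [p₀]⟩⟩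
  refine ⟨_, stageLimit p, isExistentiallyComplete_of_locallyRetracts
    ⟨inferInstance, stageLimit_free hp⟩
    (fun W H hH e => stageLimit_locallyRetracts hC hp hτ hH.2 e), ⟨⟨⟨fun v =>
      ⟨Sum.inl v, 0, hin _ _⟩, fun v w h => ?_⟩, ?_⟩⟩⟩
  · exact Sum.inl_injective (congrArg Subtype.val h)
  · intro v w
    refine (stageLimit_adj_iff hp (n := 0) (hin _ _) (hin _ _)).trans ?_
    change (G₀.map Function.Embedding.inl).Adj (Function.Embedding.inl v)
      (Function.Embedding.inl w) ↔ _
    rw [SimpleGraph.map_adj_apply]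

end ExistentiallyCompleteExtension

/-! ### Tadpoles: the forbidden graph in terms of lists -/

section Tadpoles

variable {V W : Type}

/-- Two triangles `p q c` and `c r s` with a common vertex `c` and a path with vertices `s :: t`. -/
structure IsTadpole (G : SimpleGraph V) (p q c r s : V) (t : List V) : Prop where
  cp : G.Adj c p
  cq : G.Adj c q
  pq : G.Adj p q
  cr : G.Adj c r
  cs : G.Adj c s
  rs : G.Adj r s
  chain : (s :: t).IsChain G.Adj
  nodup : (p :: q :: c :: r :: s :: t).Nodup

/-- `G` contains two triangles with a common vertex and a path of length `n` attached. -/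
def HasTadpole (G : SimpleGraph V) (n : ℕ) : Prop :=
  ∃ p q c r s t, IsTadpole G p q c r s t ∧ t.length = n

theorem IsTadpole.isContained {G : SimpleGraph V} {p q c r s : V} {t : List V}
    (h : IsTadpole G p q c r s t) : (twoTrianglesPath t.length).IsContained G := by
  set L := p :: q :: c :: r :: s :: t with hL
  have hlen : L.length = t.length + 5 := by simp [hL]
  let f : Fin (t.length + 5) → V := fun i => L[i.val]'(by omega)
  have key : ∀ i j : Fin (t.length + 5), i ≠ j → ((i.val ≤ 2 ∧ j.val ≤ 2) ∨
      ((2 ≤ i.val ∧ i.val ≤ 4) ∧ (2 ≤ j.val ∧ j.val ≤ 4)) ∨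
      (4 ≤ i.val ∧ j.val = i.val + 1)) → G.Adj (f i) (f j) := by
    rintro ⟨i, hi⟩ ⟨j, hj⟩ hij hh
    simp only [ne_eq, Fin.mk.injEq] at hij hh
    rcases hh with ⟨h1, h2⟩ | ⟨⟨h1, h2⟩, h3, h4⟩ | ⟨h1, h2⟩
    · interval_cases i <;> interval_cases j <;> first | exact absurd rfl hij |
        simp [f, L, h.cp, h.cq, h.pq, h.cp.symm, h.cq.symm, h.pq.symm]
    · interval_cases i <;> interval_cases j <;> first | exact absurd rfl hij |
        simp [f, L, h.cr, h.cs, h.rs, h.cr.symm, h.cs.symm, h.rs.symm]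
    · obtain ⟨k, rfl⟩ := Nat.exists_eq_add_of_le' h1
      subst h2
      have := List.isChain_iff_getElem.1 h.chain k (by simp; omega)
      simpa [f, L] using this
  refine ⟨⟨⟨f, ?_⟩, ?_⟩⟩
  · intro i j hij
    rw [twoTrianglesPath, SimpleGraph.fromRel_adj] at hij
    rcases hij with ⟨hne, h1 | h1⟩
    · exact key i j hne h1
    · exact (key j i hne.symm h1).symm
  · intro i j hij
    have hi : i.val < L.length := by omega
    have hj : j.val < L.length := by omega
    exact Fin.ext ((h.nodup.getElem_inj_iff (hi := hi) (hj := hj)).1 hij)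

theorem hasTadpole_iff (G : SimpleGraph V) (n : ℕ) :
    HasTadpole G n ↔ (twoTrianglesPath n).IsContained G := by
  constructor
  · rintro ⟨p, q, c, r, s, t, h, rfl⟩
    exact h.isContained
  · rintro ⟨f, hf⟩
    have hadj : ∀ i j : Fin (n + 5), i ≠ j → ((i.val ≤ 2 ∧ j.val ≤ 2) ∨
        ((2 ≤ i.val ∧ i.val ≤ 4) ∧ (2 ≤ j.val ∧ j.val ≤ 4)) ∨
        (4 ≤ i.val ∧ j.val = i.val + 1)) → G.Adj (f i) (f j) := by
      intro i j hij h
      refine f.map_adj ?_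
      rw [twoTrianglesPath, SimpleGraph.fromRel_adj]
      exact ⟨hij, Or.inl h⟩
    let g : ℕ → V := fun i => if h : i < n + 5 then f ⟨i, h⟩ else f ⟨0, by omega⟩
    have hg : ∀ i (h : i < n + 5), g i = f ⟨i, h⟩ := fun i h => dif_pos h
    have gadj : ∀ i j, i < n + 5 → j < n + 5 → i ≠ j → ((i ≤ 2 ∧ j ≤ 2) ∨
        ((2 ≤ i ∧ i ≤ 4) ∧ (2 ≤ j ∧ j ≤ 4)) ∨ (4 ≤ i ∧ j = i + 1)) → G.Adj (g i) (g j) := by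
      intro i j hi hj hij h
      rw [hg i hi, hg j hj]
      exact hadj _ _ (by simpa using hij) h
    have hl : g 0 :: g 1 :: g 2 :: g 3 :: g 4 :: (List.range n).map (fun i => g (i + 5)) =
        (List.range (n + 5)).map g := by
      apply List.ext_getElem
      · simp
      · intro i h1 h2
        match i with
        | 0 => simp
        | 1 => simp
        | 2 => simp
        | 3 => simp
        | 4 => simp
        | i + 5 => simp
    have hs : g 4 :: (List.range n).map (fun i => g (i + 5)) =
        (List.range (n + 1)).map (fun i => g (i + 4)) := by
      apply List.ext_getElem
      · simp
      · intro i h1 h2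
        match i with
        | 0 => simp
        | i + 1 => simp
    refine ⟨g 0, g 1, g 2, g 3, g 4, (List.range n).map (fun i => g (i + 5)), ⟨?_, ?_, ?_, ?_, ?_,
      ?_, ?_, ?_⟩, by simp⟩
    · exact gadj _ _ (by omega) (by omega) (by omega) (by omega)
    · exact gadj _ _ (by omega) (by omega) (by omega) (by omega)
    · exact gadj _ _ (by omega) (by omega) (by omega) (by omega)
    · exact gadj _ _ (by omega) (by omega) (by omega) (by omega)
    · exact gadj _ _ (by omega) (by omega) (by omega) (by omega)
    · exact gadj _ _ (by omega) (by omega) (by omega) (by omega)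
    · rw [hs, List.isChain_iff_getElem]
      intro i hi
      simp only [List.length_map, List.length_range] at hi
      simp only [List.getElem_map, List.getElem_range]
      exact gadj _ _ (by omega) (by omega) (by omega) (by omega)
    · rw [hl]
      refine List.Nodup.map_on ?_ List.nodup_range
      intro i hi j hj h
      rw [List.mem_range] at hi hj
      rw [hg i hi, hg j hj] at h
      exact congrArg Fin.val (hf h)

theorem free_iff_not_hasTadpole {G : SimpleGraph V} {n : ℕ} :
    (twoTrianglesPath n).Free G ↔ ¬ HasTadpole G n := by
  rw [hasTadpole_iff]

theorem twoTrianglesPath_exists_adj (n : ℕ) (u : Fin (n + 5)) :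
    ∃ v, (twoTrianglesPath n).Adj u v := by
  obtain ⟨u, hu⟩ := u
  simp only [twoTrianglesPath, SimpleGraph.fromRel_adj]
  rcases Nat.lt_or_ge u 2 with h | h
  · exact ⟨⟨2, by omega⟩, by simp; omega, Or.inl (Or.inl ⟨by omega, by simp⟩)⟩
  rcases Nat.lt_or_ge u 4 with h4 | h4
  · exact ⟨⟨4, by omega⟩, by simp; omega, Or.inl (Or.inr (Or.inl (by simp; omega)))⟩
  rcases Nat.eq_or_lt_of_le h4 with rfl | h4
  · exact ⟨⟨3, by omega⟩, by simp, Or.inl (Or.inr (Or.inl (by simp)))⟩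
  · exact ⟨⟨u - 1, by omega⟩, by simp; omega, Or.inr (Or.inr (Or.inr (by simp; omega)))⟩

theorem IsTadpole.take {G : SimpleGraph V} {p q c r s : V} {t : List V}
    (h : IsTadpole G p q c r s t) (k : ℕ) : IsTadpole G p q c r s (t.take k) where
  cp := h.cp
  cq := h.cq
  pq := h.pq
  cr := h.cr
  cs := h.cs
  rs := h.rs
  chain := by simpa using h.chain.take (k + 1)
  nodup := by simpa using h.nodup.sublist (List.take_sublist (k + 5) _)

theorem IsTadpole.hasTadpole {G : SimpleGraph V} {p q c r s : V} {t : List V}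
    (h : IsTadpole G p q c r s t) {n : ℕ} (hn : n ≤ t.length) : HasTadpole G n :=
  ⟨p, q, c, r, s, t.take n, h.take n, by simpa using hn⟩

/-- The symmetries of two triangles with a common vertex. -/
theorem IsTadpole.swap {G : SimpleGraph V} {p q c r s : V}
    (h : IsTadpole G p q c r s []) : IsTadpole G q p c r s [] ∧ IsTadpole G p q c s r [] ∧
      IsTadpole G r s c p q [] := by
  obtain ⟨cp, cq, pq, cr, cs, rs, -, nd⟩ := h
  simp only [List.nodup_cons, List.mem_cons, not_or, List.not_mem_nil, not_false_eq_true, and_true,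
    List.nodup_nil] at nd
  refine ⟨⟨cq, cp, pq.symm, cr, cs, rs, by simp, ?_⟩, ⟨cp, cq, pq, cs, cr, rs.symm, by simp, ?_⟩,
    ⟨cr, cs, rs, cp, cq, pq, by simp, ?_⟩⟩ <;> simp <;> grind

theorem IsTadpole.append {G : SimpleGraph V} {p q c r s : V}
    {t l : List V} (h : IsTadpole G p q c r s t) (hc : (s :: (t ++ l)).IsChain G.Adj)
    (hl : l.Nodup) (hd : ∀ x ∈ l, x ∉ p :: q :: c :: r :: s :: t) :
    IsTadpole G p q c r s (t ++ l) where
  cp := h.cp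
  cq := h.cq
  pq := h.pq
  cr := h.cr
  cs := h.cs
  rs := h.rs
  chain := hc
  nodup := by
    have : p :: q :: c :: r :: s :: (t ++ l) = (p :: q :: c :: r :: s :: t) ++ l := by simp
    rw [this, List.nodup_append]
    exact ⟨h.nodup, hl, fun a ha b hb hab => hd b hb (hab ▸ ha)⟩

/-- A path of length `n` leaving a tadpole at a vertex other than its centre yields a tadpole with
a tail of length `n`. -/
theorem IsTadpole.hasTadpole_of_path {G : SimpleGraph V} {p q c r s : V} {t : List V}
    (h : IsTadpole G p q c r s t) {x : V} (hx : x ∈ p :: q :: c :: r :: s :: t) (hxc : x ≠ c)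
    {l : List V} (hl : (x :: l).IsChain G.Adj) (hnd : l.Nodup)
    (hd : ∀ y ∈ l, y ∉ p :: q :: c :: r :: s :: t) {n : ℕ} (hn : n ≤ l.length) :
    HasTadpole G n := by
  have h0 : IsTadpole G p q c r s [] := h.take 0
  have hd0 : ∀ y ∈ l, y ∉ [p, q, c, r, s] := fun y hy hy' => hd y hy (by
    simp only [List.mem_cons, List.not_mem_nil, or_false] at hy' ⊢; tauto)
  have start : ∀ {p q c r x}, IsTadpole G p q c r x [] → (x :: l).IsChain G.Adj →
      (∀ y ∈ l, y ∉ [p, q, c, r, x]) → HasTadpole G n := by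
    intro p q c r x h hl hd
    exact (h.append (l := l) (by simpa using hl) hnd hd).hasTadpole (by simpa using hn)
  -- On the tail, the tadpole is cut off at `x` and continued along `l`. Otherwise `x` is `p`, `q`
  -- or `r`, and the symmetries of the bowtie let `x` play the role of `s`.
  by_cases hst : x ∈ s :: t
  · obtain ⟨t₁, t₂, ht⟩ := List.append_of_mem hst
    rcases t₁ with _ | ⟨s', t₁⟩
    · obtain ⟨rfl, rfl⟩ : s = x ∧ t = t₂ := by simpa using ht
      exact start h0 hl hd0
    · obtain ⟨rfl, ht'⟩ : s = s' ∧ t = t₁ ++ x :: t₂ := by simpa using ht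
      have h1 : IsTadpole G p q c r s (t₁ ++ [x]) := by
        have := h.take (t₁.length + 1)
        rw [ht', List.take_append, List.take_of_length_le (by omega),
          Nat.add_sub_cancel_left] at this
        simpa using this
      have h2 := h1.append (l := l) ?_ hnd ?_
      · exact h2.hasTadpole (by simp; omega)
      · have := h1.chain
        rw [List.append_assoc, ← List.cons_append, List.singleton_append, List.isChain_split]
        exact ⟨by simpa using this, by simpa using hl⟩
      · intro y hy hy'
        refine hd y hy ?_
        rw [ht']
        simp only [List.mem_cons, List.mem_append, List.not_mem_nil, or_false] at hy' ⊢
        tauto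
  · have hx' : x = p ∨ x = q ∨ x = r := by
      simp only [List.mem_cons] at hx hst; tauto
    rcases hx' with rfl | rfl | rfl
    · refine start h0.swap.2.2.swap.2.1 hl fun y hy hy' => hd0 y hy ?_
      simp only [List.mem_cons, List.not_mem_nil, or_false] at hy' ⊢; tauto
    · refine start h0.swap.2.2 hl fun y hy hy' => hd0 y hy ?_
      simp only [List.mem_cons, List.not_mem_nil, or_false] at hy' ⊢; tauto
    · refine start h0.swap.2.1 hl fun y hy hy' => hd0 y hy ?_
      simp only [List.mem_cons, List.not_mem_nil, or_false] at hy' ⊢; tauto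

end Tadpoles

/-! ### Amalgamation over closed sets creates no tadpole -/

section Amalgamation

variable {V W : Type}

/-- A family of lists contains a member avoiding any given finite set. -/
def Flexible (S : Set (List V)) : Prop :=
  ∀ F : Finset V, ∃ l ∈ S, ∀ x ∈ l, x ∉ F

/-- The paths of length `m` from `a`, without their first vertex. -/
def pathsFrom (G : SimpleGraph V) (m : ℕ) (a : V) : Set (List V) :=
  {l | l.length = m ∧ (a :: l).IsChain G.Adj ∧ (a :: l).Nodup}

/-- The sequences of `k` interior vertices of paths from `a` to `h`. -/
def linksBetween (G : SimpleGraph V) (k : ℕ) (a h : V) : Set (List V) :=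
  {l | l.length = k ∧ (a :: (l ++ [h])).IsChain G.Adj ∧ (a :: (l ++ [h])).Nodup}

/-- The triangles at `a`, without the vertex `a`. -/
def trianglesAt (G : SimpleGraph V) (a : V) : Set (List V) :=
  {l | ∃ u v, l = [u, v] ∧ G.Adj a u ∧ G.Adj a v ∧ G.Adj u v}

/-- The triangles at the vertices of `A` that cannot be moved away meet `A`. -/
def ClosedForTriangles (G : SimpleGraph V) (A : Set V) : Prop :=
  ∀ a ∈ A, Flexible (trianglesAt G a) ∨ ∀ u v, G.Adj a u → G.Adj a v → G.Adj u v →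
    (u ∈ A ∧ (v ∈ A ∨ Flexible (linksBetween G 1 a u))) ∨
      (v ∈ A ∧ (u ∈ A ∨ Flexible (linksBetween G 1 a v)))

/-- The paths of length at most `n` from vertices of `A` that cannot be moved away return to `A`. -/
def ClosedForPaths (n : ℕ) (G : SimpleGraph V) (A : Set V) : Prop :=
  ∀ a ∈ A, ∀ m ≤ n, Flexible (pathsFrom G m a) ∨ ∀ l ∈ pathsFrom G m a,
    ∃ l₁ h l₂, l = l₁ ++ h :: l₂ ∧ h ∈ A ∧ Flexible (linksBetween G l₁.length a h)

/-- Two graphs that agree on `A` and are otherwise disjoint. -/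
structure Overlap (n : ℕ) (G₁ G₂ : SimpleGraph W) (A : Set W) : Prop where
  separated : ∀ v u u', v ∉ A → G₁.Adj v u → ¬ G₂.Adj v u'
  agree : ∀ a ∈ A, ∀ b ∈ A, G₁.Adj a b ↔ G₂.Adj a b
  triangles₁ : ClosedForTriangles G₁ A
  triangles₂ : ClosedForTriangles G₂ A
  paths₁ : ClosedForPaths n G₁ A
  paths₂ : ClosedForPaths n G₂ A
  tri_iff : ∀ a ∈ A, Flexible (trianglesAt G₁ a) ↔ Flexible (trianglesAt G₂ a)
  path_iff : ∀ a ∈ A, ∀ m ≤ n, Flexible (pathsFrom G₁ m a) ↔ Flexible (pathsFrom G₂ m a)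
  link_iff : ∀ a ∈ A, ∀ b ∈ A, ∀ k ≤ n + 1,
    Flexible (linksBetween G₁ k a b) ↔ Flexible (linksBetween G₂ k a b)

namespace Overlap

variable {n : ℕ} {G₁ G₂ : SimpleGraph W} {A : Set W}

theorem symm (h : Overlap n G₁ G₂ A) : Overlap n G₂ G₁ A where
  separated v u u' hv h1 h2 := h.separated v u' u hv h2 h1
  agree a ha b hb := (h.agree a ha b hb).symm
  triangles₁ := h.triangles₂
  triangles₂ := h.triangles₁
  paths₁ := h.paths₂
  paths₂ := h.paths₁
  tri_iff a ha := (h.tri_iff a ha).symm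
  path_iff a ha m hm := (h.path_iff a ha m hm).symm
  link_iff a ha b hb k hk := (h.link_iff a ha b hb k hk).symm

/-- A vertex outside `A` has edges from only one of the two graphs, so a walk can change sides only
at an interior vertex in `A`. -/
theorem chain_side (h : Overlap n G₁ G₂ A) (a : W) (l : List W)
    (hl : (a :: l).IsChain (G₁ ⊔ G₂).Adj) (hA : ∀ x ∈ l.dropLast, x ∉ A) :
    (a :: l).IsChain G₁.Adj ∨ (a :: l).IsChain G₂.Adj := by
  induction l generalizing a with
  | nil => left; simp
  | cons b l ih =>
    rw [List.isChain_cons_cons] at hl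
    rcases l with _ | ⟨d, l⟩
    · rcases hl.1 with h1 | h1
      · left; simpa using h1
      · right; simpa using h1
    · have hb : b ∉ A := hA b (by simp)
      have := ih b hl.2 (fun x hx => hA x (by simpa using Or.inr hx))
      rcases hl.1 with h1 | h1
      · rcases this with h2 | h2
        · left; exact List.isChain_cons_cons.2 ⟨h1, h2⟩
        · exact absurd (List.isChain_cons_cons.1 h2).1 (h.separated b a d hb h1.symm)
      · rcases this with h2 | h2
        · exact absurd h1.symm (h.separated b d a hb (List.isChain_cons_cons.1 h2).1)
        · right; exact List.isChain_cons_cons.2 ⟨h1, h2⟩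

/-- If one edge is on the other side from the remaining two, both its ends lie in `A`, where the
graphs agree. -/
theorem triangle_side (h : Overlap n G₁ G₂ A) {x y z : W} (xy : (G₁ ⊔ G₂).Adj x y)
    (xz : (G₁ ⊔ G₂).Adj x z) (yz : (G₁ ⊔ G₂).Adj y z) :
    (G₁.Adj x y ∧ G₁.Adj x z ∧ G₁.Adj y z) ∨ (G₂.Adj x y ∧ G₂.Adj x z ∧ G₂.Adj y z) := by
  have sep := h.separated
  have agr := h.agree
  have s1 := fun a b => G₁.adj_comm a b
  have s2 := fun a b => G₂.adj_comm a b
  simp only [SimpleGraph.sup_adj] at xy xz yz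
  grind

theorem exists_first_mem (A : Set W) (l : List W) :
    (∀ x ∈ l, x ∉ A) ∨ ∃ l₁ h l₂, l = l₁ ++ h :: l₂ ∧ h ∈ A ∧ ∀ x ∈ l₁, x ∉ A := by
  induction l with
  | nil => simp
  | cons b l ih =>
    by_cases hb : b ∈ A
    · exact Or.inr ⟨[], b, l, rfl, hb, by simp⟩
    · rcases ih with h | ⟨l₁, h, l₂, rfl, hA, h1⟩
      · left; simpa [hb] using h
      · right; exact ⟨b :: l₁, h, l₂, rfl, hA, by simpa [hb] using h1⟩

/-- Joining a path to a second path that starts at its last vertex. -/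
theorem _root_.mem_pathsFrom_append {G : SimpleGraph V} {a h : V} {l₁ l₂ : List V}
    (h₁ : l₁ ∈ linksBetween G l₁.length a h) (h₂ : l₂ ∈ pathsFrom G l₂.length h)
    (hd : ∀ x ∈ l₂, x ∉ a :: l₁) : l₁ ++ h :: l₂ ∈ pathsFrom G (l₁ ++ h :: l₂).length a := by
  refine ⟨rfl, ?_, ?_⟩
  · rw [← List.cons_append, List.isChain_split]
    exact ⟨h₁.2.1, h₂.2.1⟩
  · have e : a :: (l₁ ++ h :: l₂) = (a :: (l₁ ++ [h])) ++ l₂ := by simp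
    rw [e, List.nodup_append]
    refine ⟨h₁.2.2, (List.nodup_cons.1 h₂.2.2).2, ?_⟩
    rintro x hx y hy rfl
    have hxh : x ≠ h := fun e => (List.nodup_cons.1 h₂.2.2).1 (e ▸ hy)
    have := hd x hy
    simp only [List.mem_cons, List.mem_append, List.not_mem_nil, or_false] at hx this
    tauto

theorem _root_.pathsFrom_split {G : SimpleGraph V} {a h : V} {l₁ l₂ : List V} {m : ℕ}
    (hl : l₁ ++ h :: l₂ ∈ pathsFrom G m a) :
    l₁ ∈ linksBetween G l₁.length a h ∧ l₂ ∈ pathsFrom G l₂.length h ∧ ∀ x ∈ l₂, x ∉ a :: l₁ := by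
  obtain ⟨-, h1, h2⟩ := hl
  rw [← List.cons_append, List.isChain_split] at h1
  have e : a :: (l₁ ++ h :: l₂) = (a :: (l₁ ++ [h])) ++ l₂ := by simp
  have h3 := h2
  rw [e, List.nodup_append] at h2
  refine ⟨⟨rfl, h1.1, h2.1⟩, ⟨rfl, h1.2, ?_⟩, ?_⟩
  · exact h3.sublist (by rw [← List.cons_append]; exact List.sublist_append_right _ _)
  · intro x hx hx'
    exact h2.2.2 x (by simp only [List.mem_cons, List.mem_append] at hx' ⊢; tauto) x hx rfl

/-- A path from a vertex of `A` can be moved into `G₁`. -/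
theorem move_path (h : Overlap n G₁ G₂ A) : ∀ m ≤ n, ∀ a ∈ A, ∀ l ∈ pathsFrom (G₁ ⊔ G₂) m a,
    ∀ F : Finset W, ∃ l' ∈ pathsFrom G₁ m a, ∀ x ∈ l', x ∈ F → x ∈ l := by
  classical
  -- The induction on the length needs both sides at once, since a path starting in `G₂` is first
  -- moved entirely into `G₂`.
  suffices H : ∀ m ≤ n, ∀ G₁ G₂, Overlap n G₁ G₂ A → ∀ a ∈ A, ∀ l ∈ pathsFrom (G₁ ⊔ G₂) m a,
    ∀ F : Finset W, ∃ l' ∈ pathsFrom G₁ m a, ∀ x ∈ l', x ∈ F → x ∈ l from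
    fun m hm => H m hm G₁ G₂ h
  clear h
  intro m
  induction m using Nat.strong_induction_on with
  | _ m IH =>
  intro hm G₁ G₂ h a ha l hl F
  rcases exists_first_mem A l with hA | ⟨l₁, b, l₂, rfl, hb, hl₁⟩
  · rcases h.chain_side a l hl.2.1 (fun x hx => hA x (List.mem_of_mem_dropLast hx)) with h1 | h1
    · exact ⟨l, ⟨hl.1, h1, hl.2.2⟩, fun x hx _ => hx⟩
    · rcases h.paths₂ a ha m hm with h2 | h2
      · obtain ⟨l', hl', hF⟩ := (h.path_iff a ha m hm).2 h2 F
        exact ⟨l', hl', fun x hx hx' => absurd hx' (hF x hx)⟩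
      · obtain ⟨u, b, w, rfl, hb, -⟩ := h2 l ⟨hl.1, h1, hl.2.2⟩
        exact absurd hb (hA b (by simp))
  · obtain ⟨s1, s2, s3⟩ := pathsFrom_split hl
    have hlen : l₁.length + 1 + l₂.length = m := by
      have := hl.1
      simp only [List.length_append, List.length_cons] at this
      omega
    have hside := h.chain_side a (l₁ ++ [b]) s1.2.1 (by simpa using hl₁)
    rcases hside with h1 | h1
    · obtain ⟨l', hl', hF⟩ := IH l₂.length (by omega) (by omega) G₁ G₂ h b hb l₂ s2
        (F ∪ (a :: l₁).toFinset)
      refine ⟨l₁ ++ b :: l', ?_, ?_⟩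
      · have := mem_pathsFrom_append (G := G₁) (a := a) (h := b) (l₁ := l₁) (l₂ := l')
          ⟨rfl, h1, s1.2.2⟩ (by rw [hl'.1]; exact hl') (fun x hx hx' =>
            s3 x (hF x hx (Finset.mem_union_right _ (List.mem_toFinset.2 hx'))) hx')
        have e : (l₁ ++ b :: l').length = m := by simp [hl'.1]; omega
        rwa [e] at this
      · intro x hx hxF
        simp only [List.mem_append, List.mem_cons] at hx ⊢
        rcases hx with hx | hx | hx
        · exact Or.inl hx
        · exact Or.inr (Or.inl hx)
        · exact Or.inr (Or.inr (hF x hx (Finset.mem_union_left _ hxF)))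
    -- The part up to the first return to `A` lies in `G₂`. Moving the rest there gives a path in
    -- `G₂`, to which closedness applies.
    · obtain ⟨l', hl', hF⟩ := IH l₂.length (by omega) (by omega) G₂ G₁ h.symm b hb l₂
        (by rw [sup_comm]; exact s2) (F ∪ (a :: l₁).toFinset)
      have hP : l₁ ++ b :: l' ∈ pathsFrom G₂ m a := by
        have := mem_pathsFrom_append (G := G₂) (a := a) (h := b) (l₁ := l₁) (l₂ := l')
          ⟨rfl, h1, s1.2.2⟩ (by rw [hl'.1]; exact hl') (fun x hx hx' =>
            s3 x (hF x hx (Finset.mem_union_right _ (List.mem_toFinset.2 hx'))) hx')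
        have e : (l₁ ++ b :: l').length = m := by simp [hl'.1]; omega
        rwa [e] at this
      have hPF : ∀ x ∈ l₁ ++ b :: l', x ∈ F → x ∈ l₁ ++ b :: l₂ := by
        intro x hx hxF
        simp only [List.mem_append, List.mem_cons] at hx ⊢
        rcases hx with hx | hx | hx
        · exact Or.inl hx
        · exact Or.inr (Or.inl hx)
        · exact Or.inr (Or.inr (hF x hx (Finset.mem_union_left _ hxF)))
      rcases h.paths₂ a ha m hm with h2 | h2
      · obtain ⟨l'', hl'', hF⟩ := (h.path_iff a ha m hm).2 h2 F
        exact ⟨l'', hl'', fun x hx hx' => absurd hx' (hF x hx)⟩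
      -- The path returns to `A` at `b'` along a flexible link. First the remainder `w` is moved
      -- into `G₁`, then the link is replaced by one in `G₁` that avoids the moved remainder.
      · obtain ⟨u, b', w, huw, hb', hflex⟩ := h2 _ hP
        rw [huw] at hP hPF
        obtain ⟨p1, p2, p3⟩ := pathsFrom_split hP
        have hlen' : u.length + 1 + w.length = m := by
          have := hP.1
          simp only [List.length_append, List.length_cons] at this
          omega
        have p2' : w ∈ pathsFrom (G₁ ⊔ G₂) w.length b' :=
          ⟨rfl, p2.2.1.imp fun _ _ h => Or.inr h, p2.2.2⟩
        obtain ⟨w', hw', hwF⟩ := IH w.length (by omega) (by omega) G₁ G₂ h b' hb' w p2'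
          (F ∪ {a})
        obtain ⟨u', hu', huF⟩ := (h.link_iff a ha b' hb' u.length (by omega)).2 hflex
          (F ∪ w'.toFinset)
        refine ⟨u' ++ b' :: w', ?_, ?_⟩
        · have := mem_pathsFrom_append (G := G₁) (a := a) (h := b') (l₁ := u') (l₂ := w')
            (by rw [hu'.1]; exact hu') (by rw [hw'.1]; exact hw') (fun x hx hx' => by
              rcases List.mem_cons.1 hx' with rfl | hx'
              · exact p3 x (hwF x hx (by simp)) (by simp)
              · exact huF x hx' (by simp [hx]))
          have e : (u' ++ b' :: w').length = m := by simp [hw'.1, hu'.1]; omega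
          rwa [e] at this
        · intro x hx hxF
          simp only [List.mem_append, List.mem_cons] at hx
          rcases hx with hx | rfl | hx
          · exact absurd (Finset.mem_union_left _ hxF) (huF x hx)
          · exact hPF x (by simp) hxF
          · exact hPF x (by simp [hwF x hx (Finset.mem_union_left _ hxF)]) hxF

theorem _root_.linksBetween_one {G : SimpleGraph V} {a b x : V} :
    [x] ∈ linksBetween G 1 a b ↔ a ≠ b ∧ G.Adj a x ∧ G.Adj x b := by
  simp only [linksBetween, Set.mem_ofPred_eq, List.length_cons, List.length_nil, zero_add, true_and,
    List.singleton_append, List.isChain_cons_cons, List.isChain_singleton, and_true,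
    List.nodup_cons, List.mem_cons, List.not_mem_nil, or_false, not_false_eq_true, List.nodup_nil,
    not_or]
  constructor
  · tauto
  · rintro ⟨h1, h2, h3⟩
    exact ⟨⟨h2, h3⟩, ⟨h2.ne, h1⟩, h3.ne⟩

/-- If the triangle at the start of the tail lies in `G₁`, then so may the other triangle. -/
theorem move_triangle (h : Overlap n G₁ G₂ A) {p q c r : W} (cp : (G₁ ⊔ G₂).Adj c p)
    (cq : (G₁ ⊔ G₂).Adj c q) (pq : (G₁ ⊔ G₂).Adj p q) (cr : G₁.Adj c r) (F : Finset W)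
    (hp : p ∉ F) (hq : q ∉ F) :
    ∃ p' q', G₁.Adj c p' ∧ G₁.Adj c q' ∧ G₁.Adj p' q' ∧ p' ∉ F ∧ q' ∉ F := by
  classical
  rcases h.triangle_side cp cq pq with ⟨h1, h2, h3⟩ | ⟨h1, h2, h3⟩
  · exact ⟨p, q, h1, h2, h3, hp, hq⟩
  -- The centre has an edge on each side, so it lies in `A`.
  · have hc : c ∈ A := by
      by_contra hc
      exact h.separated c r p hc cr h1
    have key : ∀ u v, G₂.Adj c u → G₂.Adj c v → G₂.Adj u v → u ∉ F → v ∉ F → u ∈ A →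
        (v ∈ A ∨ Flexible (linksBetween G₂ 1 c u)) →
        ∃ p' q', G₁.Adj c p' ∧ G₁.Adj c q' ∧ G₁.Adj p' q' ∧ p' ∉ F ∧ q' ∉ F := by
      rintro u v cu cv uv hu hv hA (hvA | hflex)
      · exact ⟨u, v, (h.agree c hc u hA).2 cu, (h.agree c hc v hvA).2 cv,
          (h.agree u hA v hvA).2 uv, hu, hv⟩
      -- Links with one interior vertex are needed even for `n = 0`, which explains the bound `n +
      -- 1` in `link_iff`.
      · obtain ⟨l, hl, hF⟩ := (h.link_iff c hc u hA 1 (by omega)).2 hflex F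
        obtain ⟨x, rfl⟩ := List.length_eq_one_iff.1 hl.1
        obtain ⟨-, h4, h5⟩ := linksBetween_one.1 hl
        exact ⟨u, x, (h.agree c hc u hA).2 cu, h4, h5.symm, hu, hF x (by simp)⟩
    rcases h.triangles₂ c hc with hflex | hcl
    · obtain ⟨l, ⟨u, v, rfl, h4, h5, h6⟩, hF⟩ := (h.tri_iff c hc).2 hflex F
      exact ⟨u, v, h4, h5, h6, hF u (by simp), hF v (by simp)⟩
    · rcases hcl p q h1 h2 h3 with ⟨hA, h'⟩ | ⟨hA, h'⟩
      · exact key p q h1 h2 h3 hp hq hA h'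
      · exact key q p h2 h1 h3.symm hq hp hA h'

/-- If `s ∉ A`, the edge `rs` forces the tail to stay in `G₁` until it first meets `A`; from there
on, or from `s` itself if `s ∈ A`, `move_path` applies. -/
theorem move_tail (h : Overlap n G₁ G₂ A) {m : ℕ} (hm : m ≤ n) {r s : W} (rs : G₁.Adj r s)
    {t : List W} (ht : t ∈ pathsFrom (G₁ ⊔ G₂) m s) (F : Finset W) (hF : ∀ x ∈ t, x ∉ F) :
    ∃ t' ∈ pathsFrom G₁ m s, ∀ x ∈ t', x ∉ F := by
  classical
  by_cases hs : s ∈ A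
  · obtain ⟨t', ht', h'⟩ := h.move_path m hm s hs t ht F
    exact ⟨t', ht', fun x hx hxF => hF x (h' x hx hxF) hxF⟩
  have side : ∀ l : List W, (s :: l).IsChain (G₁ ⊔ G₂).Adj → (∀ x ∈ l.dropLast, x ∉ A) →
      (s :: l).IsChain G₁.Adj := by
    intro l hl hA
    rcases h.chain_side s l hl hA with h1 | h1
    · exact h1
    · rcases l with _ | ⟨b, l⟩
      · simp
      · exact absurd (List.isChain_cons_cons.1 h1).1 (h.separated s r b hs rs.symm)
  rcases exists_first_mem A t with hA | ⟨l₁, b, l₂, rfl, hb, hl₁⟩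
  · exact ⟨t, ⟨ht.1, side t ht.2.1 fun x hx => hA x (List.mem_of_mem_dropLast hx), ht.2.2⟩, hF⟩
  · obtain ⟨s1, s2, s3⟩ := pathsFrom_split ht
    have hlen : l₁.length + 1 + l₂.length = m := by
      have := ht.1
      simp only [List.length_append, List.length_cons] at this
      omega
    obtain ⟨l', hl', hF'⟩ := h.move_path l₂.length (by omega) b hb l₂ s2
      (F ∪ (s :: l₁).toFinset)
    refine ⟨l₁ ++ b :: l', ?_, ?_⟩
    · have := mem_pathsFrom_append (G := G₁) (a := s) (h := b) (l₁ := l₁) (l₂ := l')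
        ⟨rfl, side _ s1.2.1 (by simpa using hl₁), s1.2.2⟩ (by rw [hl'.1]; exact hl')
        (fun x hx hx' => s3 x (hF' x hx (Finset.mem_union_right _ (List.mem_toFinset.2 hx'))) hx')
      have e : (l₁ ++ b :: l').length = m := by simp [hl'.1]; omega
      rwa [e] at this
    · intro x hx hxF
      simp only [List.mem_append, List.mem_cons] at hx
      rcases hx with hx | hx | hx
      · exact hF x (by simp [hx]) hxF
      · exact hF x (by simp [hx]) hxF
      · exact hF x (by simp [hF' x hx (Finset.mem_union_left _ hxF)]) hxF

/-- The order of the moves matters: the far triangle is moved off `r`, `s` and the old tail. The old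
tail then avoids the new triangle, so the tail can be moved while keeping off it. -/
theorem not_hasTadpole_of_side (h : Overlap n G₁ G₂ A) (h₁ : ¬ HasTadpole G₁ n)
    {p q c r s : W} {t : List W} (ht : IsTadpole (G₁ ⊔ G₂) p q c r s t) (hn : t.length = n)
    (cr : G₁.Adj c r) (cs : G₁.Adj c s) (rs : G₁.Adj r s) : False := by
  classical
  have nd := ht.nodup
  simp only [List.nodup_cons, List.mem_cons, not_or] at nd
  obtain ⟨p', q', cp, cq, pq, hp, hq⟩ := h.move_triangle ht.cp ht.cq ht.pq cr
    (r :: s :: t).toFinset (by simp; tauto) (by simp; tauto)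
  simp only [List.mem_toFinset, List.mem_cons, not_or] at hp hq
  obtain ⟨t', ht', hF⟩ := h.move_tail le_rfl rs (t := t) (s := s)
    ⟨hn, ht.chain, by simp only [List.nodup_cons]; tauto⟩ {p', q', c, r} (by
      intro x hx hx'
      simp only [Finset.mem_insert, Finset.mem_singleton] at hx'
      rcases hx' with rfl | rfl | rfl | rfl <;> tauto)
  refine h₁ ⟨p', q', c, r, s, t', ⟨cp, cq, pq, cr, cs, rs, ht'.2.1, ?_⟩, ht'.1⟩
  have hF' : p' ∉ t' ∧ q' ∉ t' ∧ c ∉ t' ∧ r ∉ t' :=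
    ⟨fun h => hF _ h (by simp), fun h => hF _ h (by simp), fun h => hF _ h (by simp),
      fun h => hF _ h (by simp)⟩
  have n2 := List.nodup_cons.1 ht'.2.2
  have := pq.ne
  have := cp.ne
  have := cq.ne
  simp only [List.nodup_cons, List.mem_cons, not_or]
  grind

theorem not_hasTadpole (h : Overlap n G₁ G₂ A) (h₁ : ¬ HasTadpole G₁ n)
    (h₂ : ¬ HasTadpole G₂ n) : ¬ HasTadpole (G₁ ⊔ G₂) n := by
  rintro ⟨p, q, c, r, s, t, ht, hn⟩
  rcases h.triangle_side ht.cr ht.cs ht.rs with ⟨a, b, d⟩ | ⟨a, b, d⟩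
  · exact h.not_hasTadpole_of_side h₁ ht hn a b d
  · rw [sup_comm] at ht
    exact h.symm.not_hasTadpole_of_side h₂ ht hn a b d

end Overlap

end Amalgamation

/-! ### Non-flexible families are blocked by at most `n + 5` vertices -/

section Blocking

variable {V V' : Type}

/-- The kinds of configurations that are attached to vertices of a graph. -/
inductive Shape (V : Type) : Type
  /-- The paths of length `m` from `a`. -/
  | path (m : ℕ) (a : V) : Shape V
  /-- The paths from `a` to `h` with `k` interior vertices. -/
  | link (k : ℕ) (a h : V) : Shape V
  /-- The triangles at `a`. -/
  | tri (a : V) : Shape V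

namespace Shape

/-- The sequences of new vertices of the configurations of the given shape. -/
def lists (G : SimpleGraph V) : Shape V → Set (List V)
  | path m a => pathsFrom G m a
  | link k a h => linksBetween G k a h
  | tri a => trianglesAt G a

/-- The image of a shape under a map of vertices. -/
def map (ι : V → V') : Shape V → Shape V'
  | path m a => path m (ι a)
  | link k a h => link k (ι a) (ι h)
  | tri a => tri (ι a)

/-- The vertices to which the configurations are attached. -/
def roots : Shape V → Set V
  | path _ a => {a}
  | link _ a h => {a, h}
  | tri a => {a}

theorem roots_finite (σ : Shape V) : σ.roots.Finite := by
  cases σ <;> simp [roots]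

@[simp]
theorem map_id (σ : Shape V) : σ.map id = σ := by
  cases σ <;> rfl

end Shape

theorem InducedOn.mono {G : SimpleGraph V} {G' : SimpleGraph V'} {ι : V → V'} {Q Q' : Set V}
    (h : InducedOn G G' ι Q) (hQ : Q' ⊆ Q) : InducedOn G G' ι Q' :=
  ⟨h.1.mono hQ, fun x hx y hy => h.2 x (hQ hx) y (hQ hy)⟩

theorem inducedOn_id (G : SimpleGraph V) (Q : Set V) : InducedOn G G id Q :=
  ⟨fun _ _ _ _ h => h, fun _ _ _ _ => Iff.rfl⟩

theorem InducedOn.isChain_map {G : SimpleGraph V} {G' : SimpleGraph V'} {ι : V → V'} {Q : Set V}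
    (h : InducedOn G G' ι Q) {l : List V} (hl : ∀ x ∈ l, x ∈ Q) (hc : l.IsChain G.Adj) :
    (l.map ι).IsChain G'.Adj := by
  induction l with
  | nil => simp
  | cons a l ih =>
    rcases l with _ | ⟨b, l⟩
    · simp
    · rw [List.isChain_cons_cons] at hc
      rw [List.map_cons, List.map_cons, List.isChain_cons_cons]
      exact ⟨(h.2 a (hl a (by simp)) b (hl b (by simp))).2 hc.1,
        ih (fun x hx => hl x (List.mem_cons_of_mem _ hx)) hc.2⟩

theorem InducedOn.nodup_map {G : SimpleGraph V} {G' : SimpleGraph V'} {ι : V → V'} {Q : Set V}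
    (h : InducedOn G G' ι Q) {l : List V} (hl : ∀ x ∈ l, x ∈ Q) (hc : l.Nodup) :
    (l.map ι).Nodup :=
  hc.map_on fun x hx y hy hxy => h.1 (hl x hx) (hl y hy) hxy

theorem Shape.map_mem_lists {G : SimpleGraph V} {G' : SimpleGraph V'} {ι : V → V'} {Q : Set V}
    (h : InducedOn G G' ι Q) {σ : Shape V} (hσ : σ.roots ⊆ Q) {l : List V} (hQ : ∀ x ∈ l, x ∈ Q)
    (hl : l ∈ σ.lists G) : l.map ι ∈ (σ.map ι).lists G' := by
  cases σ with
  | path m a =>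
    obtain ⟨h1, h2, h3⟩ := hl
    have : ∀ x ∈ a :: l, x ∈ Q := by
      simp only [List.mem_cons, forall_eq_or_imp]
      exact ⟨hσ (by simp [roots]), hQ⟩
    exact ⟨by simpa using h1, by simpa using h.isChain_map this h2, by
      simpa using h.nodup_map this h3⟩
  | link k a b =>
    obtain ⟨h1, h2, h3⟩ := hl
    have : ∀ x ∈ a :: (l ++ [b]), x ∈ Q := by
      simp only [List.mem_cons, List.mem_append, List.not_mem_nil, or_false]
      rintro x (rfl | hx | rfl)
      · exact hσ (by simp [roots])
      · exact hQ x hx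
      · exact hσ (by simp [roots])
    exact ⟨by simpa using h1, by simpa using h.isChain_map this h2, by
      simpa using h.nodup_map this h3⟩
  | tri a =>
    obtain ⟨u, v, rfl, h1, h2, h3⟩ := hl
    have ha : a ∈ Q := hσ (by simp [roots])
    have hu : u ∈ Q := hQ u (by simp)
    have hv : v ∈ Q := hQ v (by simp)
    exact ⟨ι u, ι v, rfl, (h.2 a ha u hu).2 h1, (h.2 a ha v hv).2 h2, (h.2 u hu v hv).2 h3⟩

/-- `G` with new vertices `0, …, k - 1` forming a path, the first of which is joined to `a` and the
last of which is joined to the vertices of `E`. -/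
def attachPath (G : SimpleGraph V) (a : V) (k : ℕ) (E : Set V) : SimpleGraph (V ⊕ ℕ) where
  Adj
    | .inl v, .inl w => G.Adj v w
    | .inl v, .inr i => i < k ∧ ((v = a ∧ i = 0) ∨ (v ∈ E ∧ i + 1 = k))
    | .inr i, .inl v => i < k ∧ ((v = a ∧ i = 0) ∨ (v ∈ E ∧ i + 1 = k))
    | .inr i, .inr j => i < k ∧ j < k ∧ (j = i + 1 ∨ i = j + 1)
  symm := ⟨by
    rintro (v | i) (w | j) h
    · exact SimpleGraph.Adj.symm (G := G) h
    · exact h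
    · exact h
    · exact ⟨h.2.1, h.1, h.2.2.symm⟩⟩
  loopless := ⟨by
    rintro (v | i) h
    · exact G.loopless.irrefl _ h
    · obtain ⟨-, -, h | h⟩ := h <;> omega⟩

/-- `y 0, …, y (k - 1)` are the vertices of a path in `G` attached to `a` and `E` as in
`attachPath`. -/
structure IsAttached (G : SimpleGraph V) (a : V) (k : ℕ) (E : Set V) (y : ℕ → V) : Prop where
  start : 0 < k → G.Adj a (y 0)
  step : ∀ i, i + 1 < k → G.Adj (y i) (y (i + 1))
  cutoff : ∀ e ∈ E, ∀ i, i + 1 = k → G.Adj e (y i)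
  inj : ∀ i < k, ∀ j < k, y i = y j → i = j

/-- A tadpole in a graph with a path attached uses only boundedly many old vertices. -/
theorem exists_block_of_hasTadpole {n : ℕ} {G : SimpleGraph V} {a : V} {k : ℕ} {E : Set V}
    (h : HasTadpole (attachPath G a k E) n) :
    ∃ W : Finset V, W.card ≤ n + 5 ∧ ∀ (V' : Type) (G' : SimpleGraph V') (ι : V → V'),
      InducedOn G G' ι W → ¬ HasTadpole G' n → ∀ y, IsAttached G' (ι a) k (ι '' E) y →
        ∃ w ∈ W, ∃ i < k, y i = ι w := by
  classical
  rw [hasTadpole_iff] at h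
  obtain ⟨f, hf⟩ := h
  let W : Finset V := (Finset.univ.image f).preimage Sum.inl Sum.inl_injective.injOn
  have hW : ∀ v, v ∈ W ↔ ∃ i, f i = Sum.inl v := fun v => by simp [W]
  refine ⟨W, ?_, ?_⟩
  · calc W.card = (W.image (Sum.inl : V → V ⊕ ℕ)).card :=
          (Finset.card_image_of_injective _ Sum.inl_injective).symm
      _ ≤ (Finset.univ.image f).card := Finset.card_le_card (by
          intro x hx
          obtain ⟨v, hv, rfl⟩ := Finset.mem_image.1 hx
          exact Finset.mem_preimage.1 hv)
      _ ≤ (Finset.univ : Finset (Fin (n + 5))).card := Finset.card_image_le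
      _ = n + 5 := by simp
  · intro V' G' ι hι hfree y hy
    -- If `y` avoids the copy of `W`, then `ι` on the old vertices and `y` on the new ones carry the
    -- tadpole injectively into `G'`.
    by_contra hno
    push Not at hno
    refine hfree ((hasTadpole_iff _ _).2 ⟨⟨⟨fun i => Sum.elim ι y (f i), ?_⟩, ?_⟩⟩)
    · intro i j hij
      have hij := f.map_adj hij
      rcases hi : f i with v | s <;> rcases hj : f j with w | t <;> rw [hi, hj] at hij
      · exact (hι.2 v ((hW v).2 ⟨i, hi⟩) w ((hW w).2 ⟨j, hj⟩)).2 hij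
      · obtain ⟨h1, ⟨rfl, rfl⟩ | ⟨hE, h2⟩⟩ := hij
        · exact hy.start h1
        · exact hy.cutoff _ ⟨v, hE, rfl⟩ t h2
      · obtain ⟨h1, ⟨rfl, rfl⟩ | ⟨hE, h2⟩⟩ := hij
        · exact (hy.start h1).symm
        · exact (hy.cutoff _ ⟨w, hE, rfl⟩ s h2).symm
      · obtain ⟨h1, h2, rfl | rfl⟩ := hij
        · exact hy.step _ h2
        · exact (hy.step _ h1).symm
    · intro i j hij
      have lt : ∀ i s, f i = Sum.inr s → s < k := by
        intro i s hs
        obtain ⟨j, hj⟩ := twoTrianglesPath_exists_adj n i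
        have := f.map_adj hj
        rw [hs] at this
        generalize f j = x at this
        rcases x with w | t
        · exact this.1
        · exact this.1
      change Sum.elim ι y (f i) = Sum.elim ι y (f j) at hij
      rcases hi : f i with v | s <;> rcases hj : f j with w | t <;> rw [hi, hj] at hij
      · refine hf (hi.trans ?_)
        rw [hι.1 ((hW v).2 ⟨i, hi⟩) ((hW w).2 ⟨j, hj⟩) hij]
        exact hj.symm
      · exact absurd hij.symm (hno v ((hW v).2 ⟨i, hi⟩) t (lt j t hj))
      · exact absurd hij (hno w ((hW w).2 ⟨j, hj⟩) s (lt i s hi))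
      · refine hf (hi.trans ?_)
        rw [hy.inj s (lt i s hi) t (lt j t hj) hij]
        exact hj.symm

/-- If the graph with the path attached is tadpole-free, it is an admissible extension; retracting
it over `F`, `a` and `E` yields a copy of the path off these vertices. -/
theorem IsExistentiallyComplete.exists_isAttached {n : ℕ} {G : SimpleGraph V}
    (hG : IsExistentiallyComplete (twoTrianglesPath n) G) {a : V} {k : ℕ} (hk : 0 < k) {E : Set V}
    (hE : E.Finite) (h : ¬ HasTadpole (attachPath G a k E) n) (F : Finset V) :
    ∃ y, IsAttached G a k E y ∧ ∀ i < k, y i ∉ F ∧ y i ≠ a ∧ y i ∉ E := by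
  classical
  have := hG.1.1
  let e : G ↪g attachPath G a k E := ⟨⟨Sum.inl, Sum.inl_injective⟩, Iff.rfl⟩
  obtain ⟨j, hj, hI⟩ := hG.locallyRetracts (H := attachPath G a k E)
    ⟨inferInstance, free_iff_not_hasTadpole.2 h⟩ e (insert a (F ∪ hE.toFinset))
    ((Finset.range k).image Sum.inr) (by simpa using hk.ne')
  set Z : Set (V ⊕ ℕ) := ↑((Finset.range k).image (Sum.inr : ℕ → V ⊕ ℕ)) ∪
    e '' ↑(insert a (F ∪ hE.toFinset)) with hZ
  have mr : ∀ i < k, (Sum.inr i : V ⊕ ℕ) ∈ Z := fun i hi => Or.inl (by simpa using hi)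
  have ml : ∀ v ∈ insert a (F ∪ hE.toFinset), (Sum.inl v : V ⊕ ℕ) ∈ Z := fun v hv =>
    Or.inr ⟨v, hv, rfl⟩
  have jl : ∀ v ∈ insert a (F ∪ hE.toFinset), j (Sum.inl v) = v := fun v hv => hj v hv
  have ma : a ∈ insert a (F ∪ hE.toFinset) := Finset.mem_insert_self _ _
  have mE : ∀ v ∈ E, v ∈ insert a (F ∪ hE.toFinset) := fun v hv => by simp [hv]
  have ne : ∀ i < k, ∀ v ∈ insert a (F ∪ hE.toFinset), j (Sum.inr i) ≠ v := by
    intro i hi v hv hne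
    rw [← jl v hv] at hne
    exact Sum.inr_ne_inl (hI.1 (mr i hi) (ml v hv) hne)
  refine ⟨fun i => j (Sum.inr i), ⟨fun h0 => ?_, fun i hi => ?_, fun v hv i hi => ?_,
    fun i hi i' hi' h => ?_⟩, fun i hi => ⟨fun hF => ne i hi _ (by simp [hF]) rfl,
      ne i hi a ma, fun hF => ne i hi _ (mE _ hF) rfl⟩⟩
  · have := (hI.2 _ (ml a ma) _ (mr 0 h0)).2 ⟨h0, Or.inl ⟨rfl, rfl⟩⟩
    rwa [jl a ma] at this
  · exact (hI.2 _ (mr i (by omega)) _ (mr (i + 1) hi)).2 ⟨by omega, hi, Or.inl rfl⟩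
  · have := (hI.2 _ (ml v (mE v hv)) _ (mr i (by omega))).2 ⟨by omega, Or.inr ⟨hv, hi⟩⟩
    rwa [jl v (mE v hv)] at this
  · exact Sum.inr_injective (hI.1 (mr i hi) (mr i' hi') h)

theorem IsAttached.isChain {G : SimpleGraph V} {a : V} {k : ℕ} {E : Set V} {y : ℕ → V}
    (h : IsAttached G a k E y) : (a :: (List.range k).map y).IsChain G.Adj := by
  rw [List.isChain_iff_getElem]
  intro i hi
  simp only [List.length_cons, List.length_map, List.length_range] at hi
  match i with
  | 0 => simpa using h.start (by omega)
  | i + 1 => simpa using h.step i (by omega)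

theorem IsAttached.isChain_append {G : SimpleGraph V} {a b : V} {k : ℕ} {y : ℕ → V}
    (h : IsAttached G a (k + 1) {b} y) :
    (a :: ((List.range (k + 1)).map y ++ [b])).IsChain G.Adj := by
  have h1 := h.isChain
  rw [List.range_succ, List.map_append, List.map_cons, List.map_nil] at h1 ⊢
  rw [List.append_assoc, ← List.cons_append, List.singleton_append, List.isChain_split]
  exact ⟨by simpa using h1, by simpa using (h.cutoff b rfl k rfl).symm⟩

theorem IsAttached.nodup {G : SimpleGraph V} {a : V} {k : ℕ} {E : Set V} {y : ℕ → V}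
    (h : IsAttached G a k E y) : ((List.range k).map y).Nodup :=
  List.nodup_range.map_on fun i hi j hj hij =>
    h.inj i (List.mem_range.1 hi) j (List.mem_range.1 hj) hij

theorem isAttached_of_list {G : SimpleGraph V} {a : V} {l : List V} {E : Set V}
    (hc : (a :: l).IsChain G.Adj) (hn : l.Nodup)
    (hE : ∀ e ∈ E, ∀ l' x, l = l' ++ [x] → G.Adj e x) :
    IsAttached G a l.length E (fun i => l.getD i a) := by
  have hD : ∀ i (hi : i < l.length), l.getD i a = l[i] := fun i hi => by simp [hi]
  rw [List.isChain_iff_getElem] at hc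
  refine ⟨fun h0 => ?_, fun i hi => ?_, fun e he i hi => ?_, fun i hi j hj h => ?_⟩
  · rw [hD 0 h0]
    simpa using hc 0 (by simpa using h0)
  · rw [hD i (by omega), hD (i + 1) hi]
    exact hc (i + 1) (by simpa using hi)
  · rw [hD i (by omega)]
    refine hE e he l.dropLast _ ?_
    have hne : l ≠ [] := by
      rintro rfl
      simp at hi
    conv_lhs => rw [← List.dropLast_append_getLast hne]
    congr 2
    rw [List.getLast_eq_getElem]
    congr 1
    omega
  · rw [hD i hi, hD j hj] at h
    exact (hn.getElem_inj_iff).1 h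

/-- Every configuration of shape `σ`, in any tadpole-free graph containing a copy of `W`, meets
that copy. -/
def Blocks (n : ℕ) (G : SimpleGraph V) (σ : Shape V) (W : Finset V) : Prop :=
  ∀ (V' : Type) (G' : SimpleGraph V') (ι : V → V'), InducedOn G G' ι W → ¬ HasTadpole G' n →
    ∀ l ∈ (σ.map ι).lists G', ∃ w ∈ W, ι w ∈ l

theorem exists_getD_mem {l : List V} {a : V} {i : ℕ} (hi : i < l.length) : l.getD i a ∈ l := by
  simp [hi]

/-- Nondegenerate shapes are attached paths with a suitable `E`. If attaching a new one creates no
tadpole, existential completeness makes the family flexible; otherwise the old vertices of a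
resulting tadpole block it. -/
theorem IsExistentiallyComplete.exists_blocks {n : ℕ} {G : SimpleGraph V}
    (hG : IsExistentiallyComplete (twoTrianglesPath n) G) (σ : Shape V)
    (hσ : ¬ Flexible (σ.lists G)) : ∃ W : Finset V, W.card ≤ n + 5 ∧ Blocks n G σ W := by
  classical
  have main : ∀ (a : V) (k : ℕ) (E : Set V), 0 < k → E.Finite →
      (∀ y, IsAttached G a k E y → (∀ i < k, y i ≠ a ∧ y i ∉ E) →
        (List.range k).map y ∈ σ.lists G) →
      (∀ (V' : Type) (G' : SimpleGraph V') (ι : V → V'), ∀ l ∈ (σ.map ι).lists G',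
        l.length = k ∧ IsAttached G' (ι a) k (ι '' E) (fun i => l.getD i (ι a))) →
      ∃ W : Finset V, W.card ≤ n + 5 ∧ Blocks n G σ W := by
    intro a k E hk hE h1 h2
    by_cases h : HasTadpole (attachPath G a k E) n
    · obtain ⟨W, hW, hb⟩ := exists_block_of_hasTadpole h
      refine ⟨W, hW, fun V' G' ι hι hfree l hl => ?_⟩
      obtain ⟨h3, h4⟩ := h2 V' G' ι l hl
      obtain ⟨w, hw, i, hi, hyi⟩ := hb V' G' ι hι hfree _ h4
      exact ⟨w, hw, hyi ▸ exists_getD_mem (h3 ▸ hi)⟩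
    · refine absurd (fun F => ?_) hσ
      obtain ⟨y, hy, hF⟩ := hG.exists_isAttached hk hE h F
      refine ⟨_, h1 y hy fun i hi => (hF i hi).2, fun x hx => ?_⟩
      obtain ⟨i, hi, rfl⟩ := List.mem_map.1 hx
      exact (hF i (List.mem_range.1 hi)).1
  cases σ with
  | path m a =>
    rcases Nat.eq_zero_or_pos m with rfl | hm
    · exact absurd (fun F => ⟨[], ⟨rfl, by simp, by simp⟩, by simp⟩) hσ
    · refine main a m ∅ hm Set.finite_empty (fun y hy hn => ⟨by simp, hy.isChain, ?_⟩) ?_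
      · rw [List.nodup_cons]
        refine ⟨fun h => ?_, hy.nodup⟩
        obtain ⟨i, hi, h'⟩ := List.mem_map.1 h
        exact (hn i (List.mem_range.1 hi)).1 h'
      · rintro V' G' ι l ⟨h1, h2, h3⟩
        refine ⟨h1, ?_⟩
        rw [← h1]
        exact isAttached_of_list h2 (List.nodup_cons.1 h3).2 (by simp)
  | link k a b =>
    rcases k with _ | k
    -- A link without interior vertices is an edge. Here there is none, and a copy of `{a, b}`
    -- preserves this.
    · refine ⟨{a, b}, (Finset.card_le_two).trans (by omega), ?_⟩
      rintro V' G' ι hι - l ⟨h1, h2, h3⟩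
      obtain rfl := List.length_eq_zero_iff.1 h1
      have hadj : G'.Adj (ι a) (ι b) := by simpa using h2
      have hadj' : G.Adj a b := (hι.2 a (by simp) b (by simp)).1 hadj
      exact absurd (fun F => ⟨[], ⟨rfl, by simpa using hadj', by simpa using hadj'.ne⟩, by simp⟩) hσ
    · by_cases hab : a = b
      · refine ⟨∅, by simp, ?_⟩
        rintro V' G' ι hι - l ⟨h1, h2, h3⟩
        subst hab
        simp at h3
      · refine main a (k + 1) {b} (by omega) (Set.finite_singleton b)
          (fun y hy hn => ⟨by simp, hy.isChain_append, ?_⟩) ?_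
        · have e : a :: ((List.range (k + 1)).map y ++ [b]) =
            (a :: (List.range (k + 1)).map y) ++ [b] := by simp
          have nm : ∀ x ∈ (List.range (k + 1)).map y, x ≠ a ∧ x ∉ ({b} : Set V) := by
            intro x hx
            obtain ⟨i, hi, rfl⟩ := List.mem_map.1 hx
            exact hn i (List.mem_range.1 hi)
          rw [e, List.nodup_append]
          refine ⟨List.nodup_cons.2 ⟨fun h => (nm a h).1 rfl, hy.nodup⟩, by simp, ?_⟩
          rintro x hx z hz rfl
          obtain rfl : x = b := by simpa using hz
          rcases List.mem_cons.1 hx with h | h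
          · exact hab h.symm
          · exact (nm x h).2 rfl
        · rintro V' G' ι l ⟨h1, h2, h3⟩
          refine ⟨h1, ?_⟩
          rw [← h1]
          have h2' := h2
          rw [← List.cons_append, List.isChain_append] at h2'
          have h3' := h3
          rw [← List.cons_append, List.nodup_append] at h3'
          refine isAttached_of_list h2'.1 (List.nodup_cons.1 h3'.1).2 ?_
          rintro _ ⟨b', rfl, rfl⟩ l' x rfl
          have h4 := h2
          rw [List.append_assoc, ← List.cons_append, List.singleton_append,
            List.isChain_split] at h4
          have := h4.2
          simp only [List.isChain_cons_cons] at this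
          exact this.1.symm
  | tri a =>
    -- A triangle at `a` is an attached path with two vertices whose end is joined back to `a`.
    refine main a 2 {a} (by omega) (Set.finite_singleton a)
      (fun y hy hn => ⟨y 0, y 1, by simp [List.range_succ], hy.start (by omega),
        hy.cutoff a rfl 1 rfl, hy.step 0 (by omega)⟩) ?_
    rintro V' G' ι l ⟨u, v, rfl, h1, h2, h3⟩
    refine ⟨rfl, ?_⟩
    refine isAttached_of_list (l := [u, v]) (by simpa using ⟨h1, h3⟩) (by simpa using h3.ne) ?_
    rintro _ ⟨b', rfl, rfl⟩ l' x hx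
    have : [u] ++ [v] = l' ++ [x] := hx
    obtain rfl : v = x := by simpa using (List.append_inj' this rfl).2
    exact h2

end Blocking

/-! ### Finite certificates for flexibility and for returning -/

section Certificates

variable {V V' : Type} {n : ℕ} {G : SimpleGraph V}

theorem Flexible.exists_seq {S : Set (List V)} (hS : Flexible S) :
    ∃ f : ℕ → List V, (∀ i, f i ∈ S) ∧ ∀ i j, i ≠ j → ∀ x ∈ f i, x ∉ f j := by
  classical
  have : Std.Symm fun l l' : List V => ∀ x ∈ l, x ∉ l' := ⟨fun _ _ h x hx hx' => h x hx' hx⟩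
  obtain ⟨f, h1, h2⟩ := exists_seq_of_forall_finset_exists' (· ∈ S)
    (fun l l' : List V => ∀ x ∈ l, x ∉ l') (by
      intro s _
      obtain ⟨l, hl, hF⟩ := hS (s.biUnion List.toFinset)
      refine ⟨l, hl, fun l' hl' x hx hx' => hF x hx' ?_⟩
      exact Finset.mem_biUnion.2 ⟨l', hl', List.mem_toFinset.2 hx⟩)
  exact ⟨f, h1, fun i j hij => h2 hij⟩

theorem Blocks.not_flexible {σ : Shape V} {W : Finset V} (hW : Blocks n G σ W)
    {G' : SimpleGraph V'} {ι : V → V'} (hι : InducedOn G G' ι W) (hG' : ¬ HasTadpole G' n) :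
    ¬ Flexible ((σ.map ι).lists G') := by
  classical
  intro hf
  obtain ⟨l, hl, hF⟩ := hf (W.image ι)
  obtain ⟨w, hw, hwl⟩ := hW V' G' ι hι hG' l hl
  exact hF _ hwl (Finset.mem_image_of_mem _ hw)

theorem IsExistentiallyComplete.not_hasTadpole
    (hG : IsExistentiallyComplete (twoTrianglesPath n) G) : ¬ HasTadpole G n :=
  free_iff_not_hasTadpole.1 hG.1.2

/-- A finite part of an existentially complete graph decides whether a family is flexible. -/
theorem IsExistentiallyComplete.exists_flexible_iff
    (hG : IsExistentiallyComplete (twoTrianglesPath n) G) (σ : Shape V) :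
    ∃ Q : Finset V, ∀ (V' : Type) (G' : SimpleGraph V') (ι : V → V'),
      IsExistentiallyComplete (twoTrianglesPath n) G' → InducedOn G G' ι Q →
      (Flexible (σ.lists G) ↔ Flexible ((σ.map ι).lists G')) := by
  classical
  by_cases hf : Flexible (σ.lists G)
  · obtain ⟨f, hf1, hf2⟩ := hf.exists_seq
    -- The images of `n + 6` pairwise disjoint members cannot all be met by a block with at most `n
    -- + 5` vertices.
    refine ⟨σ.roots_finite.toFinset ∪ (Finset.range (n + 6)).biUnion (fun i => (f i).toFinset),
      fun V' G' ι hG' hι => iff_of_true hf ?_⟩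
    by_contra hno
    obtain ⟨W, hW, hb⟩ := hG'.exists_blocks _ hno
    have mem : ∀ i < n + 6, ∀ x ∈ f i, x ∈ (↑(σ.roots_finite.toFinset ∪
        (Finset.range (n + 6)).biUnion (fun i => (f i).toFinset)) : Set V) := by
      intro i hi x hx
      refine Finset.mem_coe.2 (Finset.mem_union_right _ (Finset.mem_biUnion.2 ⟨i, ?_, ?_⟩))
      · simpa using hi
      · simpa using hx
    have hit : ∀ i < n + 6, ∃ x ∈ f i, ι x ∈ W := by
      intro i hi
      have hl := Shape.map_mem_lists hι (σ := σ) (l := f i) (by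
        intro x hx
        simp [hx]) (mem i hi) (hf1 i)
      obtain ⟨w, hw, hwl⟩ := hb V' G' id (inducedOn_id _ _) hG'.not_hasTadpole _
        (by rw [Shape.map_id]; exact hl)
      obtain ⟨x, hx, hxw⟩ := List.mem_map.1 hwl
      exact ⟨x, hx, by rw [hxw]; exact hw⟩
    have hv : ∃ g : ℕ → V, ∀ i < n + 6, g i ∈ f i ∧ ι (g i) ∈ W := by
      obtain ⟨x₀, -⟩ := hit 0 (by omega)
      refine ⟨fun i => if h : i < n + 6 then (hit i h).choose else x₀, fun i hi => ?_⟩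
      simp only [hi, dif_pos]
      exact (hit i hi).choose_spec
    obtain ⟨g, hg⟩ := hv
    obtain ⟨i, hi, j, hj, hij, heq⟩ := Finset.exists_ne_map_eq_of_card_lt_of_maps_to
      (s := Finset.range (n + 6)) (t := W) (f := fun i => ι (g i)) (by simp; omega)
      (fun i hi => (hg i (by simpa using hi)).2)
    rw [Finset.mem_range] at hi hj
    have := hι.1 (mem i hi _ (hg i hi).1) (mem j hj _ (hg j hj).1) heq
    exact hf2 i j hij _ (hg i hi).1 (this ▸ (hg j hj).1)
  · obtain ⟨W, -, hb⟩ := hG.exists_blocks σ hf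
    exact ⟨W, fun V' G' ι hG' hι => iff_of_false hf (hb.not_flexible hι hG'.not_hasTadpole)⟩

theorem linksBetween_of_append {a h x : V} {l₁ l₂ : List V} {k : ℕ}
    (hl : l₁ ++ x :: l₂ ∈ linksBetween G k a h) : l₁ ∈ linksBetween G l₁.length a x := by
  obtain ⟨-, h1, h2⟩ := hl
  have e : a :: (l₁ ++ x :: l₂ ++ [h]) = (a :: (l₁ ++ [x])) ++ (l₂ ++ [h]) := by simp
  rw [e] at h1 h2
  exact ⟨rfl, (List.isChain_append.1 h1).1, (List.nodup_append.1 h2).1⟩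

/-- If the links to `h` are flexible, `h` itself is the return point. Otherwise every link meets a
finite block, at a vertex `w` reached by a strictly shorter link from `a`, and the induction applies
to `w`. -/
theorem IsExistentiallyComplete.exists_link_certificate
    (hG : IsExistentiallyComplete (twoTrianglesPath n) G) (a : V) (k : ℕ) : ∀ h : V,
    ∃ K Q : Finset V, (∀ y ∈ K, ∃ k' ≤ k, Flexible (linksBetween G k' a y)) ∧
      ∀ (V' : Type) (G' : SimpleGraph V') (ι : V → V'), InducedOn G G' ι Q → ¬ HasTadpole G' n →
        ∀ l ∈ linksBetween G' k (ι a) (ι h), ∃ l₁ y l₂, l ++ [ι h] = l₁ ++ ι y :: l₂ ∧ y ∈ K ∧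
          Flexible (linksBetween G l₁.length a y) := by
  classical
  induction k using Nat.strong_induction_on with
  | _ k IH =>
  intro h
  by_cases hf : Flexible (linksBetween G k a h)
  · refine ⟨{h}, ∅, fun y hy => ⟨k, le_rfl, by rwa [Finset.mem_singleton.1 hy]⟩,
      fun V' G' ι _ _ l hl => ⟨l, h, [], rfl, by simp, by rw [hl.1]; exact hf⟩⟩
  · obtain ⟨W, -, hb⟩ := hG.exists_blocks (.link k a h) hf
    -- The induction hypothesis in a total form suitable for `choose`; the empty sets for `p.1 ≥ k`
    -- are placeholders.
    have IH' : ∀ p : ℕ × V, ∃ K Q : Finset V, p.1 < k →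
        (∀ y ∈ K, ∃ k' ≤ p.1, Flexible (linksBetween G k' a y)) ∧
        ∀ (V' : Type) (G' : SimpleGraph V') (ι : V → V'), InducedOn G G' ι Q → ¬ HasTadpole G' n →
          ∀ l ∈ linksBetween G' p.1 (ι a) (ι p.2), ∃ l₁ y l₂, l ++ [ι p.2] = l₁ ++ ι y :: l₂ ∧
            y ∈ K ∧ Flexible (linksBetween G l₁.length a y) := by
      rintro ⟨i, w⟩
      by_cases hi : i < k
      · obtain ⟨K, Q, h'⟩ := IH i hi w
        exact ⟨K, Q, fun _ => h'⟩
      · exact ⟨∅, ∅, fun h' => absurd h' hi⟩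
    choose K Q hKQ using IH'
    refine ⟨(Finset.range k ×ˢ W).biUnion K, W ∪ (Finset.range k ×ˢ W).biUnion Q, ?_, ?_⟩
    · intro y hy
      obtain ⟨p, hp, hy⟩ := Finset.mem_biUnion.1 hy
      have hp1 : p.1 < k := by simpa using (Finset.mem_product.1 hp).1
      obtain ⟨k', hk', h'⟩ := (hKQ p hp1).1 y hy
      exact ⟨k', by omega, h'⟩
    · intro V' G' ι hι hfree l hl
      obtain ⟨w, hw, hwl⟩ := hb V' G' ι (hι.mono (by simp)) hfree l hl
      obtain ⟨l₁, l₂, rfl⟩ := List.append_of_mem hwl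
      have hlt : l₁.length < k := by
        have := hl.1
        simp only [List.length_append, List.length_cons] at this
        omega
      have hmem : (l₁.length, w) ∈ Finset.range k ×ˢ W := by simp [hlt, hw]
      obtain ⟨u, y, v, huv, hy, hfl⟩ := (hKQ (l₁.length, w) hlt).2 V' G' ι (hι.mono (by
        intro x hx
        exact Finset.mem_coe.2 (Finset.mem_union_right _ (Finset.mem_biUnion.2 ⟨_, hmem, hx⟩))))
        hfree l₁ (linksBetween_of_append hl)
      refine ⟨u, y, v ++ (l₂ ++ [ι h]), ?_, Finset.mem_biUnion.2 ⟨_, hmem, hy⟩, hfl⟩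
      have e : l₁ ++ ι w :: l₂ ++ [ι h] = (l₁ ++ [ι w]) ++ (l₂ ++ [ι h]) := by simp
      rw [e, huv]
      simp

/-- Every path meets a finite block; the part before the hit is a link, to which
`exists_link_certificate` applies. -/
theorem IsExistentiallyComplete.exists_path_certificate
    (hG : IsExistentiallyComplete (twoTrianglesPath n) G) (a : V) (m : ℕ)
    (hf : ¬ Flexible (pathsFrom G m a)) :
    ∃ K Q : Finset V, (∀ y ∈ K, ∃ k' < m, Flexible (linksBetween G k' a y)) ∧
      ∀ (V' : Type) (G' : SimpleGraph V') (ι : V → V'), InducedOn G G' ι Q → ¬ HasTadpole G' n →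
        ∀ l ∈ pathsFrom G' m (ι a), ∃ l₁ y l₂, l = l₁ ++ ι y :: l₂ ∧ y ∈ K ∧
          Flexible (linksBetween G l₁.length a y) := by
  classical
  obtain ⟨W, -, hb⟩ := hG.exists_blocks (.path m a) hf
  choose K Q hK hQ using hG.exists_link_certificate a
  refine ⟨(Finset.range m ×ˢ W).biUnion fun p => K p.1 p.2,
    W ∪ (Finset.range m ×ˢ W).biUnion fun p => Q p.1 p.2, ?_, ?_⟩
  · intro y hy
    obtain ⟨p, hp, hy⟩ := Finset.mem_biUnion.1 hy
    have hp1 : p.1 < m := by simpa using (Finset.mem_product.1 hp).1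
    obtain ⟨k', hk', h'⟩ := hK p.1 p.2 y hy
    exact ⟨k', by omega, h'⟩
  · intro V' G' ι hι hfree l hl
    obtain ⟨w, hw, hwl⟩ := hb V' G' ι (hι.mono (by simp)) hfree l hl
    obtain ⟨l₁, l₂, rfl⟩ := List.append_of_mem hwl
    have hlt : l₁.length < m := by
      have := hl.1
      simp only [List.length_append, List.length_cons] at this
      omega
    have hmem : (l₁.length, w) ∈ Finset.range m ×ˢ W := by simp [hlt, hw]
    obtain ⟨u, y, v, huv, hy, hfl⟩ := hQ l₁.length w V' G' ι (hι.mono (by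
      intro x hx
      exact Finset.mem_coe.2 (Finset.mem_union_right _ (Finset.mem_biUnion.2 ⟨_, hmem, hx⟩))))
      hfree l₁ (pathsFrom_split hl).1
    refine ⟨u, y, v ++ l₂, ?_, Finset.mem_biUnion.2 ⟨_, hmem, hy⟩, hfl⟩
    have e : l₁ ++ ι w :: l₂ = (l₁ ++ [ι w]) ++ l₂ := by simp
    rw [e, huv]
    simp

/-- Every triangle at `a` has a vertex `w` in a finite block `W`. Its third vertex can either be
varied freely, or lies in a block `B w` for the links from `a` to `w`. Restricting `K` to vertices
on triangles with `a` is what bounds the closure later. -/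
theorem IsExistentiallyComplete.exists_triangle_certificate
    (hG : IsExistentiallyComplete (twoTrianglesPath n) G) (a : V)
    (hf : ¬ Flexible (trianglesAt G a)) :
    ∃ K Q : Finset V, (∀ y ∈ K, ∃ x, G.Adj a y ∧ G.Adj a x ∧ G.Adj y x) ∧
      ∀ (V' : Type) (G' : SimpleGraph V') (ι : V → V'), InducedOn G G' ι Q → ¬ HasTadpole G' n →
        ∀ u v, G'.Adj (ι a) u → G'.Adj (ι a) v → G'.Adj u v →
          (∃ y ∈ K, u = ι y ∧ ((∃ z ∈ K, v = ι z) ∨ Flexible (linksBetween G 1 a y))) ∨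
          (∃ y ∈ K, v = ι y ∧ ((∃ z ∈ K, u = ι z) ∨ Flexible (linksBetween G 1 a y))) := by
  classical
  obtain ⟨W, -, hb⟩ := hG.exists_blocks (.tri a) hf
  have hB : ∀ w, ∃ B : Finset V, ¬ Flexible (linksBetween G 1 a w) → Blocks n G (.link 1 a w) B := by
    intro w
    by_cases h : Flexible (linksBetween G 1 a w)
    · exact ⟨∅, fun h' => absurd h h'⟩
    · obtain ⟨B, -, hB⟩ := hG.exists_blocks (.link 1 a w) h
      exact ⟨B, fun _ => hB⟩
  choose B hB using hB
  set Z := W ∪ W.biUnion B with hZ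
  refine ⟨Z.filter fun y => ∃ x, G.Adj a y ∧ G.Adj a x ∧ G.Adj y x, insert a Z,
    fun y hy => (Finset.mem_filter.1 hy).2, ?_⟩
  intro V' G' ι hι hfree
  have ha : a ∈ (↑(insert a Z) : Set V) := by simp
  have hZ' : ∀ x ∈ Z, x ∈ (↑(insert a Z) : Set V) := fun x hx => by simp [hx]
  have hW : ∀ w ∈ W, w ∈ Z := fun w hw => Finset.mem_union_left _ hw
  have key : ∀ w ∈ W, ∀ v, G'.Adj (ι a) (ι w) → G'.Adj (ι a) v → G'.Adj (ι w) v →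
      ∃ y ∈ Z.filter fun y => ∃ x, G.Adj a y ∧ G.Adj a x ∧ G.Adj y x, ι w = ι y ∧
        ((∃ z ∈ Z.filter fun y => ∃ x, G.Adj a y ∧ G.Adj a x ∧ G.Adj y x, v = ι z) ∨
          Flexible (linksBetween G 1 a y)) := by
    intro w hw v h1 h2 h3
    have h1' : G.Adj a w := (hι.2 a ha w (hZ' w (hW w hw))).1 h1
    by_cases hfl : Flexible (linksBetween G 1 a w)
    · refine ⟨w, Finset.mem_filter.2 ⟨hW w hw, ?_⟩, rfl, Or.inr hfl⟩
      obtain ⟨l, hl, -⟩ := hfl ∅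
      obtain ⟨x, rfl⟩ := List.length_eq_one_iff.1 hl.1
      obtain ⟨-, h4, h5⟩ := linksBetween_one.1 hl
      exact ⟨x, h1', h4, h5.symm⟩
    · have hmem : ∀ x ∈ B w, x ∈ Z := fun x hx =>
        Finset.mem_union_right _ (Finset.mem_biUnion.2 ⟨w, hw, hx⟩)
      obtain ⟨x, hx, hxl⟩ := hB w hfl V' G' ι (hι.mono fun x hx => hZ' x (hmem x hx)) hfree [v]
        (linksBetween_one.2 ⟨h1.ne, h2, h3.symm⟩)
      obtain rfl : ι x = v := by simpa using hxl
      have hxZ := hmem x hx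
      have h2' : G.Adj a x := (hι.2 a ha x (hZ' x hxZ)).1 h2
      have h3' : G.Adj w x := (hι.2 w (hZ' w (hW w hw)) x (hZ' x hxZ)).1 h3
      exact ⟨w, Finset.mem_filter.2 ⟨hW w hw, x, h1', h2', h3'⟩, rfl, Or.inl
        ⟨x, Finset.mem_filter.2 ⟨hxZ, w, h2', h1', h3'.symm⟩, rfl⟩⟩
  intro u v h1 h2 h3
  obtain ⟨w, hw, hwl⟩ := hb V' G' ι (hι.mono fun x hx => hZ' x (hW x hx)) hfree [u, v]
    ⟨u, v, rfl, h1, h2, h3⟩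
  simp only [List.mem_cons, List.not_mem_nil, or_false] at hwl
  rcases hwl with rfl | rfl
  · exact Or.inl (key w hw v h1 h2 h3)
  · exact Or.inr (key w hw u h2 h1 h3.symm)

/-- `a` lies on a tadpole with a short tail, away from its centre. -/
def NearTadpole (G : SimpleGraph V) (n : ℕ) (a : V) : Prop :=
  ∃ p q c r s t, IsTadpole G p q c r s t ∧ t.length < n ∧ a ∈ s :: t

theorem exists_map_inl_or (l : List (V ⊕ ℕ)) : (∃ l' : List V, l = l'.map Sum.inl) ∨
    ∃ (l' : List V) (i : ℕ) (l'' : List (V ⊕ ℕ)), l = l'.map Sum.inl ++ Sum.inr i :: l'' := by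
  induction l with
  | nil => exact Or.inl ⟨[], rfl⟩
  | cons x l ih =>
    rcases x with v | i
    · rcases ih with ⟨l', rfl⟩ | ⟨l', i, l'', rfl⟩
      · exact Or.inl ⟨v :: l', rfl⟩
      · exact Or.inr ⟨v :: l', i, l'', rfl⟩
    · exact Or.inr ⟨[], i, l, rfl⟩

/-- With `E = ∅` the new path is pendant, so no triangle passes through a new vertex. -/
theorem attachPath_triangle {a : V} {k : ℕ} {x y z : V ⊕ ℕ}
    (xy : (attachPath G a k ∅).Adj x y) (xz : (attachPath G a k ∅).Adj x z)
    (yz : (attachPath G a k ∅).Adj y z) : ∃ v, x = Sum.inl v := by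
  rcases x with v | i
  · exact ⟨v, rfl⟩
  · exfalso
    rcases y with v | j <;> rcases z with w | l
    · obtain ⟨-, ⟨rfl, -⟩ | ⟨h, -⟩⟩ := xy
      · obtain ⟨-, ⟨rfl, -⟩ | ⟨h, -⟩⟩ := xz
        · exact G.loopless.irrefl _ yz
        · exact h
      · exact h
    · obtain ⟨-, ⟨rfl, h1⟩ | ⟨h, -⟩⟩ := xy
      · obtain ⟨-, ⟨-, h2⟩ | ⟨h, -⟩⟩ := yz
        · obtain ⟨-, -, h3⟩ := xz
          omega
        · exact h
      · exact h
    · obtain ⟨-, ⟨rfl, h1⟩ | ⟨h, -⟩⟩ := xz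
      · obtain ⟨-, ⟨-, h2⟩ | ⟨h, -⟩⟩ := yz
        · obtain ⟨-, -, h3⟩ := xy
          omega
        · exact h
      · exact h
    · obtain ⟨-, -, h1⟩ := xy
      obtain ⟨-, -, h2⟩ := xz
      obtain ⟨-, -, h3⟩ := yz
      omega

theorem IsTadpole.of_attachPath {a : V} {k : ℕ} {E : Set V} {p q c r s : V} {t : List V}
    (h : IsTadpole (attachPath G a k E) (.inl p) (.inl q) (.inl c) (.inl r) (.inl s)
      (t.map .inl)) : IsTadpole G p q c r s t where
  cp := h.cp
  cq := h.cq
  pq := h.pq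
  cr := h.cr
  cs := h.cs
  rs := h.rs
  chain := by
    have := h.chain
    rw [← List.map_cons, List.isChain_map] at this
    exact this
  nodup := by
    have := h.nodup
    simp only [← List.map_cons] at this
    exact this.of_map _

/-- If no new long path can be attached at `a`, then `a` is close to two triangles with a common
vertex. -/
theorem IsExistentiallyComplete.nearTadpole
    (hG : IsExistentiallyComplete (twoTrianglesPath n) G) {a : V} {m : ℕ}
    (hf : ¬ Flexible (pathsFrom G m a)) : NearTadpole G n a := by
  rcases Nat.eq_zero_or_pos m with rfl | hm
  · exact absurd (fun F => ⟨[], ⟨rfl, by simp, by simp⟩, by simp⟩) hf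
  by_cases h : HasTadpole (attachPath G a m ∅) n
  · obtain ⟨p, q, c, r, s, t, h, hn⟩ := h
    obtain ⟨p, rfl⟩ := attachPath_triangle h.cp.symm h.pq h.cq
    obtain ⟨q, rfl⟩ := attachPath_triangle h.cq.symm h.pq.symm h.cp
    obtain ⟨c, rfl⟩ := attachPath_triangle h.cp h.cq h.pq
    obtain ⟨r, rfl⟩ := attachPath_triangle h.cr.symm h.rs h.cs
    obtain ⟨s, rfl⟩ := attachPath_triangle h.cs.symm h.rs.symm h.cr
    -- Both triangles are old, so only the tail enters the new path, and it can do so only from `a`.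
    -- The part before that is a tadpole with shorter tail ending at `a`.
    rcases exists_map_inl_or t with ⟨t', rfl⟩ | ⟨t', i, t'', rfl⟩
    · exact absurd ⟨_, _, _, _, _, _, h.of_attachPath, by simpa using hn⟩ hG.not_hasTadpole
    · have h' : IsTadpole G p q c r s t' := by
        have := h.take t'.length
        rw [List.take_left' (by simp)] at this
        exact this.of_attachPath
      refine ⟨p, q, c, r, s, t', h', ?_, ?_⟩
      · simp only [List.length_append, List.length_map, List.length_cons] at hn
        omega
      · have hc := h.chain
        rw [← List.cons_append, ← List.map_cons, List.isChain_append] at hc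
        have := hc.2.2 (.inl ((s :: t').getLast (by simp))) (by
          rw [List.getLast?_map, List.getLast?_eq_some_getLast (List.cons_ne_nil s t')]
          rfl) (.inr i) (by simp)
        obtain ⟨-, ⟨h1, -⟩ | ⟨h1, -⟩⟩ := this
        · rw [← h1]
          exact List.getLast_mem _
        · exact absurd h1 (by simp)
  · refine absurd (fun F => ?_) hf
    obtain ⟨y, hy, hF⟩ := hG.exists_isAttached hm Set.finite_empty h F
    refine ⟨(List.range m).map y, ⟨by simp, hy.isChain, List.nodup_cons.2 ⟨fun h => ?_, hy.nodup⟩⟩,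
      fun x hx => ?_⟩
    · obtain ⟨i, hi, h'⟩ := List.mem_map.1 h
      exact (hF i (List.mem_range.1 hi)).2.1 h'
    · obtain ⟨i, hi, rfl⟩ := List.mem_map.1 hx
      exact (hF i (List.mem_range.1 hi)).1

end Certificates

/-! ### Closing a finite set under certificates terminates -/

section Chains

variable {V : Type} {n : ℕ} {G : SimpleGraph V}

/-- `x` and `y` are joined by paths of some fixed length that avoid any given finite set. -/
def Linked (G : SimpleGraph V) (x y : V) : Prop :=
  ∃ k, Flexible (linksBetween G k x y)

theorem linksBetween_reverse {k : ℕ} {a h : V} {l : List V} (hl : l ∈ linksBetween G k a h) :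
    l.reverse ∈ linksBetween G k h a := by
  obtain ⟨h1, h2, h3⟩ := hl
  have e : h :: (l.reverse ++ [a]) = (a :: (l ++ [h])).reverse := by simp
  refine ⟨by simpa using h1, ?_, ?_⟩
  · rw [e, List.isChain_reverse]
    exact h2.imp fun _ _ h => h.symm
  · rw [e, List.nodup_reverse]
    exact h3

theorem Linked.symm {x y : V} (h : Linked G x y) : Linked G y x := by
  obtain ⟨k, h⟩ := h
  refine ⟨k, fun F => ?_⟩
  obtain ⟨l, hl, hF⟩ := h F
  exact ⟨l.reverse, linksBetween_reverse hl, fun x hx => hF x (List.mem_reverse.1 hx)⟩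

theorem SimpleGraph.Adj.linked {x y : V} (h : G.Adj x y) : Linked G x y :=
  ⟨0, fun _ => ⟨[], ⟨rfl, by simpa using h, by simpa using h.ne⟩, by simp⟩⟩

/-- The links are filled in from the end backwards, each chosen off the path already built. -/
theorem exists_path_of_linked_chain (xs : List V) : ∀ (x : V) (F : Finset V),
    (x :: xs).IsChain (Linked G) → (x :: xs).Nodup → (∀ y ∈ xs, y ∉ F) →
    ∃ l, (x :: l).IsChain G.Adj ∧ (x :: l).Nodup ∧ xs.length ≤ l.length ∧ ∀ y ∈ l, y ∉ F := by
  classical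
  induction xs with
  | nil => exact fun x F _ _ _ => ⟨[], by simp⟩
  | cons y xs ih =>
    intro x F hc hn hF
    rw [List.isChain_cons_cons] at hc
    have hx := (List.nodup_cons.1 hn).1
    obtain ⟨l, h1, h2, h3, h4⟩ := ih y (insert x F) hc.2 (List.nodup_cons.1 hn).2 (by
      intro z hz hz'
      rcases Finset.mem_insert.1 hz' with rfl | hz'
      · exact hx (List.mem_cons_of_mem _ hz)
      · exact hF z (List.mem_cons_of_mem _ hz) hz')
    obtain ⟨k, hk⟩ := hc.1
    obtain ⟨u, hu, huF⟩ := hk (F ∪ l.toFinset)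
    have hp := mem_pathsFrom_append (G := G) (a := x) (h := y) (l₁ := u) (l₂ := l)
      (by rw [hu.1]; exact hu) ⟨rfl, h1, h2⟩ (by
        intro z hz hz'
        rcases List.mem_cons.1 hz' with rfl | hz'
        · exact h4 z hz (Finset.mem_insert_self _ _)
        · exact huF z hz' (by simp [hz]))
    refine ⟨u ++ y :: l, hp.2.1, hp.2.2, by simp; omega, ?_⟩
    intro z hz
    simp only [List.mem_append, List.mem_cons] at hz
    rcases hz with hz | rfl | hz
    · exact fun h => huF z hz (Finset.mem_union_left _ h)
    · exact hF z (by simp)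
    · exact fun h => h4 z hz (Finset.mem_insert_of_mem h)

/-- A long sequence starting in a finite set `Z` leaves it for at least `n` steps. -/
theorem exists_run {R : V → V → Prop} (n k : ℕ) : ∀ (Z : Finset V) (x : V) (xs : List V),
    Z.card = k → (x :: xs).IsChain R → (x :: xs).Nodup → x ∈ Z → n * k ≤ xs.length →
    ∃ y run, y ∈ Z ∧ (y :: run).IsChain R ∧ (y :: run).Nodup ∧ run.length = n ∧
      (∀ z ∈ run, z ∉ Z) ∧ ∀ z ∈ y :: run, z ∈ x :: xs := by
  classical
  induction k with
  | zero =>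
    intro Z x xs hZ _ _ hx
    rw [Finset.card_eq_zero] at hZ
    simp [hZ] at hx
  | succ k ih =>
    intro Z x xs hZ hc hn hx hlen
    -- Either the next `n` steps avoid `Z`, or `Z` is revisited within `n` steps. In the latter case
    -- `x` is discarded from `Z`, so this happens fewer than `k` times.
    by_cases h : ∀ z ∈ xs.take n, z ∉ Z
    · have hsub : (x :: xs.take n) = (x :: xs).take (n + 1) := rfl
      refine ⟨x, xs.take n, hx, ?_, ?_, ?_, h, ?_⟩
      · rw [hsub]; exact hc.take _
      · rw [hsub]; exact hn.sublist (List.take_sublist _ _)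
      · rw [List.length_take]
        have : n ≤ n * (k + 1) := Nat.le_mul_of_pos_right _ (by omega)
        omega
      · intro z hz
        rw [hsub] at hz
        exact List.mem_of_mem_take hz
    · push Not at h
      obtain ⟨z, hz, hzZ⟩ := h
      obtain ⟨pre, post, hpp⟩ := List.append_of_mem hz
      have hxs : xs = pre ++ z :: (post ++ xs.drop n) := by
        conv_lhs => rw [← List.take_append_drop n xs, hpp]
        simp
      have hpre : pre.length < n := by
        have := congrArg List.length hpp
        simp only [List.length_take, List.length_append, List.length_cons] at this
        omega
      set rest := post ++ xs.drop n
      rw [hxs] at hc hn hlen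
      have hsuf : (x :: (pre ++ z :: rest)) = (x :: pre) ++ z :: rest := rfl
      rw [hsuf] at hc hn
      have hxz : x ≠ z := by
        rintro rfl
        simp at hn
      obtain ⟨y, run, h1, h2, h3, h4, h5, h6⟩ := ih (Z.erase x) z rest
        (by rw [Finset.card_erase_of_mem hx]; omega) (List.isChain_append.1 hc).2.1
        (List.nodup_append.1 hn).2.1 (Finset.mem_erase.2 ⟨hxz.symm, hzZ⟩) (by
          simp only [List.length_append, List.length_cons] at hlen
          rw [Nat.mul_succ] at hlen
          omega)
      refine ⟨y, run, Finset.mem_of_mem_erase h1, h2, h3, h4, ?_, ?_⟩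
      · intro w hw hwZ
        refine h5 w hw (Finset.mem_erase.2 ⟨?_, hwZ⟩)
        rintro rfl
        exact (List.nodup_append.1 hn).2.2 w (by simp) w (h6 w (List.mem_cons_of_mem _ hw)) rfl
      · intro w hw
        rw [hxs]
        have := h6 w hw
        simp only [List.mem_cons, List.mem_append] at this ⊢
        tauto

/-- A vertex from which two long disjoint linked sequences start is not close to two triangles with
a common vertex. -/
theorem not_nearTadpole (hG : ¬ HasTadpole G n) {x : V} {xs ys : List V}
    (hx : (x :: xs).IsChain (Linked G)) (hy : (x :: ys).IsChain (Linked G))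
    (hxn : (x :: xs).Nodup) (hyn : (x :: ys).Nodup) (hd : ∀ z ∈ xs, z ∉ ys)
    (hxl : n * (n + 5) ≤ xs.length) (hyl : n * (n + 5) ≤ ys.length) : ¬ NearTadpole G n x := by
  classical
  rintro ⟨p, q, c, r, s, t, ht, hlt, hxt⟩
  have hxc : x ≠ c := by
    rintro rfl
    have := ht.nodup
    simp only [List.nodup_cons, List.mem_cons] at this hxt
    tauto
  have main : ∀ l : List V, (x :: l).IsChain (Linked G) → (x :: l).Nodup →
      n * (n + 5) ≤ l.length → c ∉ l → False := by
    intro l h1 h2 h3 h4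
    set Z := (p :: q :: c :: r :: s :: t).toFinset with hZ
    have hcard : Z.card ≤ n + 5 := by
      refine (List.toFinset_card_le _).trans ?_
      simp only [List.length_cons]
      omega
    have hxZ : x ∈ Z := by
      rw [hZ, List.mem_toFinset]
      simp only [List.mem_cons] at hxt ⊢
      tauto
    obtain ⟨y, run, a1, a2, a3, a4, a5, a6⟩ := exists_run n Z.card Z x l rfl h1 h2 hxZ
      ((Nat.mul_le_mul_left n hcard).trans h3)
    obtain ⟨l', b1, b2, b3, b4⟩ := exists_path_of_linked_chain run y Z a2 a3 a5
    have hyc : y ≠ c := by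
      rintro rfl
      rcases List.mem_cons.1 (a6 y (by simp)) with h | h
      · exact hxc h.symm
      · exact h4 h
    exact hG (ht.hasTadpole_of_path (List.mem_toFinset.1 a1) hyc b1 (List.nodup_cons.1 b2).2
      (fun z hz hz' => b4 z hz (List.mem_toFinset.2 hz')) (a4 ▸ b3))
  -- The centre lies on at most one of the two sequences. The other one leaves the tadpole away from
  -- its centre and provides a tail of length `n`.
  by_cases hc : c ∈ xs
  · exact main ys hy hyn hyl (hd c hc)
  · exact main xs hx hxn hxl hc

/-- A triangle with two vertices that are not outer vertices of two triangles with a common vertex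
meets every other triangle in no or in two vertices. -/
theorem triangle_inter {a b x : V}
    (ha : ∀ p q c r, ¬ IsTadpole G p q c r a []) (hb : ∀ p q c r, ¬ IsTadpole G p q c r b [])
    (ab : G.Adj a b) (ax : G.Adj a x) (bx : G.Adj b x) {u v w : V} (uv : G.Adj u v)
    (uw : G.Adj u w) (vw : G.Adj v w) (hu : u = a ∨ u = b ∨ u = x) :
    (v = a ∨ v = b ∨ v = x) ∨ (w = a ∨ w = b ∨ w = x) := by
  by_contra hno
  have h1 := uv.ne
  have h2 := uw.ne
  have h3 := vw.ne
  have h4 := ab.ne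
  have h5 := ax.ne
  have h6 := bx.ne
  rcases hu with rfl | rfl | rfl
  · refine hb v w u x ⟨uv, uw, vw, ax, ab, bx.symm, by simp, ?_⟩
    simp only [List.nodup_cons, List.mem_cons, List.not_mem_nil, List.nodup_nil]
    grind
  · refine ha v w u x ⟨uv, uw, vw, bx, ab.symm, ax.symm, by simp, ?_⟩
    simp only [List.nodup_cons, List.mem_cons, List.not_mem_nil, List.nodup_nil]
    grind
  · refine ha v w u b ⟨uv, uw, vw, bx.symm, ax.symm, ab.symm, by simp, ?_⟩
    simp only [List.nodup_cons, List.mem_cons, List.not_mem_nil, List.nodup_nil]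
    grind

/-- By `triangle_inter` each successive triangle shares two vertices with the first one, `T`. So `T`
contains `a`, `b`, one of `c`, `d` and one of `e`, `f`: four distinct vertices among three. -/
theorem false_of_triangle_chain {a b c d e f : V} (hn : [a, b, c, d, e, f].Nodup)
    (hT : ∀ v ∈ [a, b, c, d, e, f], ∀ p q z r, ¬ IsTadpole G p q z r v [])
    (hab : ∃ x, G.Adj a b ∧ G.Adj a x ∧ G.Adj b x) (hbc : ∃ x, G.Adj b c ∧ G.Adj b x ∧ G.Adj c x)
    (hcd : ∃ x, G.Adj c d ∧ G.Adj c x ∧ G.Adj d x) (hde : ∃ x, G.Adj d e ∧ G.Adj d x ∧ G.Adj e x)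
    (hef : ∃ x, G.Adj e f ∧ G.Adj e x ∧ G.Adj f x) : False := by
  obtain ⟨x, ab, ax, bx⟩ := hab
  have h0 := fun {u v w} => triangle_inter (G := G) (u := u) (v := v) (w := w)
    (hT a (by simp)) (hT b (by simp)) ab ax bx
  let T : V → Prop := fun v => v = a ∨ v = b ∨ v = x
  have step : ∀ u v w y, (∀ p q z r, ¬ IsTadpole G p q z r u []) →
      (∀ p q z r, ¬ IsTadpole G p q z r v []) → (∃ z, (G.Adj u v ∧ G.Adj u z ∧ G.Adj v z) ∧
      ((T u ∧ T v) ∨ (T u ∧ T z) ∨ (T v ∧ T z))) → (G.Adj v w ∧ G.Adj v y ∧ G.Adj w y) →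
      ((T v ∧ T w) ∨ (T v ∧ T y) ∨ (T w ∧ T y)) := by
    rintro u v w y hu hv ⟨z, ⟨uv, uz, vz⟩, hz⟩ ⟨vw, vy, wy⟩
    have h1 := triangle_inter hu hv uv uz vz vw vy wy (Or.inr (Or.inl rfl))
    have h2 := h0 vw vy wy
    have h3 := h0 vw.symm wy vy
    have h4 := h0 vy.symm wy.symm vw
    change T v → T w ∨ T y at h2
    change T w → T v ∨ T y at h3
    change T y → T v ∨ T w at h4
    have h5 : T v ∨ T w ∨ T y := by
      clear_value T
      rcases h1 with (rfl | rfl | rfl) | (rfl | rfl | rfl)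
      · rcases hz with h | h | h
        · exact Or.inl h.2
        · exact Or.inr (Or.inl h.1)
        · exact Or.inl h.1
      · exact absurd rfl vw.ne
      · rcases hz with h | h | h
        · exact Or.inl h.2
        · exact Or.inr (Or.inl h.2)
        · exact Or.inl h.1
      · rcases hz with h | h | h
        · exact Or.inl h.2
        · exact Or.inr (Or.inr h.1)
        · exact Or.inl h.1
      · exact absurd rfl vy.ne
      · rcases hz with h | h | h
        · exact Or.inl h.2
        · exact Or.inr (Or.inr h.2)
        · exact Or.inl h.1
    rcases h5 with h | h | h
    · exact (h2 h).elim (fun h' => Or.inl ⟨h, h'⟩) fun h' => Or.inr (Or.inl ⟨h, h'⟩)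
    · exact (h3 h).elim (fun h' => Or.inl ⟨h', h⟩) fun h' => Or.inr (Or.inr ⟨h, h'⟩)
    · exact (h4 h).elim (fun h' => Or.inr (Or.inl ⟨h', h⟩)) fun h' => Or.inr (Or.inr ⟨h', h⟩)
  obtain ⟨y, hbc⟩ := hbc
  obtain ⟨z, hcd⟩ := hcd
  obtain ⟨s, hde⟩ := hde
  obtain ⟨t, hef⟩ := hef
  have s0 : T a ∧ T b := ⟨Or.inl rfl, Or.inr (Or.inl rfl)⟩
  have s1 := step a b c y (hT a (by simp)) (hT b (by simp)) ⟨x, ⟨ab, ax, bx⟩, Or.inl s0⟩ hbc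
  have s2 := step b c d z (hT b (by simp)) (hT c (by simp)) ⟨y, hbc, s1⟩ hcd
  have s3 := step c d e s (hT c (by simp)) (hT d (by simp)) ⟨z, hcd, s2⟩ hde
  have s4 := step d e f t (hT d (by simp)) (hT e (by simp)) ⟨s, hde, s3⟩ hef
  have cd : T c ∨ T d := s2.elim (fun h => Or.inl h.1) fun h => h.elim (fun h => Or.inl h.1)
    fun h => Or.inr h.1
  have ef : T e ∨ T f := s4.elim (fun h => Or.inl h.1) fun h => h.elim (fun h => Or.inl h.1)
    fun h => Or.inr h.1
  simp only [List.nodup_cons, List.mem_cons, List.not_mem_nil, or_false, not_or] at hn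
  simp only [T] at cd ef
  grind

/-- Sequences in which every vertex is linked to the next one, for a reason that depends on the
graph near the former, have bounded length. -/
theorem length_le_of_isChain (hG : ¬ HasTadpole G n) {K : V → Finset V}
    (hK : ∀ a, ∀ y ∈ K a, Linked G a y ∧
      (NearTadpole G n a ∨ ∃ x, G.Adj a y ∧ G.Adj a x ∧ G.Adj y x))
    {l : List V} (hc : l.IsChain fun a y => y ∈ K a) (hn : l.Nodup) :
    l.length ≤ 2 * (n * (n + 5)) + 6 := by
  by_contra hlen
  push Not at hlen
  have hL : l.IsChain (Linked G) := hc.imp fun a y h => (hK a y h).1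
  -- Links are symmetric, so the part before `x`, reversed, and the part after `x` are two disjoint
  -- linked sequences starting from `x`.
  have mid : ∀ l₁ x l₂, l = l₁ ++ x :: l₂ → n * (n + 5) ≤ l₁.length → n * (n + 5) ≤ l₂.length →
      ¬ NearTadpole G n x := by
    rintro l₁ x l₂ rfl h1 h2
    rw [List.isChain_split] at hL
    have hrev : (x :: l₁.reverse).IsChain (Linked G) := by
      have e : x :: l₁.reverse = (l₁ ++ [x]).reverse := by simp
      rw [e, List.isChain_reverse]
      exact hL.1.imp fun _ _ h => h.symm
    have hn' := List.nodup_append.1 hn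
    refine not_nearTadpole hG hL.2 hrev hn'.2.1 ?_ ?_ h2 (by simpa using h1)
    · rw [List.nodup_cons, List.nodup_reverse, List.mem_reverse]
      exact ⟨fun h => hn'.2.2 x h x (by simp) rfl, hn'.1⟩
    · intro z hz hz'
      exact hn'.2.2 z (List.mem_reverse.1 hz') z (List.mem_cons_of_mem _ hz) rfl
  set L := n * (n + 5) with hLdef
  obtain ⟨pre, rest, hl, hpre⟩ : ∃ pre rest, l = pre ++ rest ∧ pre.length = L :=
    ⟨l.take L, l.drop L, (List.take_append_drop L l).symm, by simp; omega⟩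
  have hrest : L + 7 ≤ rest.length := by
    have := congrArg List.length hl
    simp only [List.length_append] at this
    omega
  match rest, hrest, hl with
  | a :: b :: c :: d :: e :: f :: post, hrest, hl =>
    simp only [List.length_cons] at hrest
    have near : ∀ l₁ x l₂, a :: b :: c :: d :: e :: f :: post = l₁ ++ x :: l₂ →
        L ≤ l₂.length → ¬ NearTadpole G n x := by
      intro l₁ x l₂ h h'
      exact mid (pre ++ l₁) x l₂ (by rw [hl, h]; simp) (by simp; omega) h'
    have na := near [] a _ rfl (by simp; omega)
    have nb := near [a] b _ rfl (by simp; omega)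
    have nc := near [a, b] c _ rfl (by simp; omega)
    have nd := near [a, b, c] d _ rfl (by simp; omega)
    have ne := near [a, b, c, d] e _ rfl (by simp; omega)
    have nf := near [a, b, c, d, e] f _ rfl (by omega)
    -- For `n = 0` no vertex is near a tadpole, but then the bowtie itself is forbidden.
    have notad : ∀ x, ¬ NearTadpole G n x → ∀ p q z r, ¬ IsTadpole G p q z r x [] := by
      intro x hx p q z r h
      rcases Nat.eq_zero_or_pos n with rfl | hpos
      · exact hG (h.hasTadpole (Nat.zero_le _))
      · exact hx ⟨p, q, z, r, x, [], h, by simpa using hpos, by simp⟩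
    rw [hl] at hc hn
    have hc' := (List.isChain_append.1 hc).2.1
    simp only [List.isChain_cons_cons] at hc'
    have hn' := (List.nodup_append.1 hn).2.1
    refine false_of_triangle_chain (a := a) (b := b) (c := c) (d := d) (e := e) (f := f)
      (hn'.sublist (List.sublist_append_left [a, b, c, d, e, f] post)) ?_
      ((hK a b hc'.1).2.resolve_left na) ((hK b c hc'.2.1).2.resolve_left nb)
      ((hK c d hc'.2.2.1).2.resolve_left nc) ((hK d e hc'.2.2.2.1).2.resolve_left nd)
      ((hK e f hc'.2.2.2.2.1).2.resolve_left ne)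
    intro v hv
    apply notad
    simp only [List.mem_cons, List.not_mem_nil, or_false] at hv
    rcases hv with rfl | rfl | rfl | rfl | rfl | rfl <;> assumption
  | [], h, _ => simp at h
  | [_], h, _ => simp at h
  | [_, _], h, _ => simp at h
  | [_, _, _], h, _ => simp at h
  | [_, _, _, _], h, _ => simp at h
  | [_, _, _, _, _], h, _ => simp at h

/-- A vertex first reached at step `i + 1` ends a sequence of `i + 2` distinct vertices, so nothing
new appears after step `N`. -/
theorem exists_finite_closure {K : V → Finset V} {N : ℕ}
    (hK : ∀ l : List V, (l.IsChain fun a y => y ∈ K a) → l.Nodup → l.length ≤ N)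
    (A : Finset V) : ∃ B : Finset V, A ⊆ B ∧ ∀ b ∈ B, K b ⊆ B := by
  classical
  let step : Finset V → Finset V := fun S => S ∪ S.biUnion K
  let S : ℕ → Finset V := fun i => step^[i] A
  have hS : ∀ i, S (i + 1) = S i ∪ (S i).biUnion K := fun i =>
    Function.iterate_succ_apply' step i A
  have mono : ∀ i, S i ⊆ S (i + 1) := fun i => by
    rw [hS]; exact Finset.subset_union_left
  have chain : ∀ i, ∀ v ∈ S (i + 1), v ∉ S i → ∃ l : List V,
      ((l ++ [v]).IsChain fun a y => y ∈ K a) ∧ (l ++ [v]).Nodup ∧ l.length = i + 1 ∧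
        ∀ x ∈ l, x ∈ S i := by
    intro i
    induction i with
    | zero =>
      intro v hv hv'
      rw [hS, Finset.mem_union, Finset.mem_biUnion] at hv
      obtain ⟨w, hw, hvw⟩ := hv.resolve_left hv'
      refine ⟨[w], by simpa using hvw, ?_, rfl, by simpa using hw⟩
      have : w ≠ v := fun h => hv' (h ▸ hw)
      simpa using this
    | succ i ih =>
      intro v hv hv'
      rw [hS, Finset.mem_union, Finset.mem_biUnion] at hv
      obtain ⟨w, hw, hvw⟩ := hv.resolve_left hv'
      have hw' : w ∉ S i := by
        intro h
        refine hv' ?_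
        rw [hS]
        exact Finset.mem_union_right _ (Finset.mem_biUnion.2 ⟨w, h, hvw⟩)
      obtain ⟨l, h1, h2, h3, h4⟩ := ih w hw hw'
      have h5 : ∀ x ∈ l ++ [w], x ∈ S (i + 1) := by
        intro x hx
        rcases List.mem_append.1 hx with hx | hx
        · exact mono i (h4 x hx)
        · rwa [List.mem_singleton.1 hx]
      refine ⟨l ++ [w], ?_, ?_, by simp [h3], h5⟩
      · rw [List.append_assoc, List.singleton_append, List.isChain_split]
        exact ⟨h1, by simpa using hvw⟩
      · rw [List.nodup_append]
        refine ⟨h2, by simp, ?_⟩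
        rintro x hx y hy rfl
        rw [List.mem_singleton.1 hy] at hx
        exact hv' (h5 v hx)
  refine ⟨S N, ?_, fun b hb v hv => ?_⟩
  · have : ∀ i, A ⊆ S i := by
      intro i
      induction i with
      | zero => exact subset_rfl
      | succ i ih => exact ih.trans (mono i)
    exact this N
  · by_contra hno
    obtain ⟨l, h1, h2, h3, -⟩ := chain N v (by
      rw [hS]
      exact Finset.mem_union_right _ (Finset.mem_biUnion.2 ⟨b, hb, hv⟩)) hno
    have := hK _ h1 h2
    simp only [List.length_append, List.length_cons, List.length_nil] at this
    omega

end Chains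

/-! ### Back-and-forth between existentially complete graphs -/

section BackAndForth

variable {V V' W : Type} {n : ℕ} {G : SimpleGraph V} {G' : SimpleGraph V'}

/-- Path certificates contribute to `K` only if some family of paths at `a` is not flexible, which
puts `a` near a tadpole; the other members of `K` lie on triangles with `a`. This is the dichotomy
required by `length_le_of_isChain`. -/
theorem IsExistentiallyComplete.exists_certificates
    (hG : IsExistentiallyComplete (twoTrianglesPath n) G) (a : V) :
    ∃ K Q : Finset V, (∀ y ∈ K, Linked G a y ∧
        (NearTadpole G n a ∨ ∃ x, G.Adj a y ∧ G.Adj a x ∧ G.Adj y x)) ∧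
      (∀ m ≤ n, Flexible (pathsFrom G m a) ∨ ∀ (V' : Type) (G' : SimpleGraph V') (ι : V → V'),
        InducedOn G G' ι Q → ¬ HasTadpole G' n → ∀ l ∈ pathsFrom G' m (ι a),
          ∃ l₁ y l₂, l = l₁ ++ ι y :: l₂ ∧ y ∈ K ∧ Flexible (linksBetween G l₁.length a y)) ∧
      (Flexible (trianglesAt G a) ∨ ∀ (V' : Type) (G' : SimpleGraph V') (ι : V → V'),
        InducedOn G G' ι Q → ¬ HasTadpole G' n →
        ∀ u v, G'.Adj (ι a) u → G'.Adj (ι a) v → G'.Adj u v →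
          (∃ y ∈ K, u = ι y ∧ ((∃ z ∈ K, v = ι z) ∨ Flexible (linksBetween G 1 a y))) ∨
          (∃ y ∈ K, v = ι y ∧ ((∃ z ∈ K, u = ι z) ∨ Flexible (linksBetween G 1 a y)))) := by
  classical
  have hP : ∀ m, ∃ K Q : Finset V, (∀ y ∈ K, Linked G a y ∧ NearTadpole G n a) ∧
      (Flexible (pathsFrom G m a) ∨ ∀ (V' : Type) (G' : SimpleGraph V') (ι : V → V'),
        InducedOn G G' ι Q → ¬ HasTadpole G' n → ∀ l ∈ pathsFrom G' m (ι a),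
          ∃ l₁ y l₂, l = l₁ ++ ι y :: l₂ ∧ y ∈ K ∧ Flexible (linksBetween G l₁.length a y)) := by
    intro m
    by_cases hf : Flexible (pathsFrom G m a)
    · exact ⟨∅, ∅, by simp, Or.inl hf⟩
    · obtain ⟨K, Q, h1, h2⟩ := hG.exists_path_certificate a m hf
      refine ⟨K, Q, fun y hy => ⟨?_, hG.nearTadpole hf⟩, Or.inr h2⟩
      obtain ⟨k, -, hk⟩ := h1 y hy
      exact ⟨k, hk⟩
  have hT : ∃ K Q : Finset V, (∀ y ∈ K, ∃ x, G.Adj a y ∧ G.Adj a x ∧ G.Adj y x) ∧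
      (Flexible (trianglesAt G a) ∨ ∀ (V' : Type) (G' : SimpleGraph V') (ι : V → V'),
        InducedOn G G' ι Q → ¬ HasTadpole G' n →
        ∀ u v, G'.Adj (ι a) u → G'.Adj (ι a) v → G'.Adj u v →
          (∃ y ∈ K, u = ι y ∧ ((∃ z ∈ K, v = ι z) ∨ Flexible (linksBetween G 1 a y))) ∨
          (∃ y ∈ K, v = ι y ∧ ((∃ z ∈ K, u = ι z) ∨ Flexible (linksBetween G 1 a y)))) := by
    by_cases hf : Flexible (trianglesAt G a)
    · exact ⟨∅, ∅, by simp, Or.inl hf⟩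
    · obtain ⟨K, Q, h1, h2⟩ := hG.exists_triangle_certificate a hf
      exact ⟨K, Q, h1, Or.inr h2⟩
  choose KP QP hKP hQP using hP
  obtain ⟨KT, QT, hKT, hQT⟩ := hT
  have subK : ∀ m ≤ n, KP m ⊆ (Finset.range (n + 1)).biUnion KP ∪ KT := fun m hm x hx =>
    Finset.mem_union_left _ (Finset.mem_biUnion.2 ⟨m, by simpa using Nat.lt_succ_of_le hm, hx⟩)
  have subQ : ∀ m ≤ n, QP m ⊆ (Finset.range (n + 1)).biUnion QP ∪ QT := fun m hm x hx =>
    Finset.mem_union_left _ (Finset.mem_biUnion.2 ⟨m, by simpa using Nat.lt_succ_of_le hm, hx⟩)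
  have sKT : ∀ x ∈ KT, x ∈ (Finset.range (n + 1)).biUnion KP ∪ KT := fun x hx =>
    Finset.mem_union_right _ hx
  refine ⟨(Finset.range (n + 1)).biUnion KP ∪ KT, (Finset.range (n + 1)).biUnion QP ∪ QT, ?_, ?_,
    ?_⟩
  · intro y hy
    rcases Finset.mem_union.1 hy with hy | hy
    · obtain ⟨m, -, hy⟩ := Finset.mem_biUnion.1 hy
      exact ⟨(hKP m y hy).1, Or.inl (hKP m y hy).2⟩
    · obtain ⟨x, hx⟩ := hKT y hy
      exact ⟨hx.1.linked, Or.inr ⟨x, hx⟩⟩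
  · intro m hm
    refine (hQP m).imp id fun h V' G' ι hι hfree l hl => ?_
    obtain ⟨l₁, y, l₂, h1, h2, h3⟩ := h V' G' ι (hι.mono (Finset.coe_subset.2 (subQ m hm))) hfree l
      hl
    exact ⟨l₁, y, l₂, h1, subK m hm h2, h3⟩
  · refine hQT.imp id fun h V' G' ι hι hfree u v h1 h2 h3 => ?_
    refine (h V' G' ι (hι.mono (Finset.coe_subset.2 Finset.subset_union_right)) hfree u v h1 h2
      h3).imp ?_ ?_
    · rintro ⟨y, hy, hu, h4⟩
      exact ⟨y, sKT y hy, hu, h4.imp (fun ⟨z, hz, hv⟩ => ⟨z, sKT z hz, hv⟩) id⟩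
    · rintro ⟨y, hy, hu, h4⟩
      exact ⟨y, sKT y hy, hu, h4.imp (fun ⟨z, hz, hv⟩ => ⟨z, sKT z hz, hv⟩) id⟩

/-- The map `ι` maps `B` to a closed set, and preserves which families are flexible. -/
structure ClosedImage (n : ℕ) (G : SimpleGraph V) (G' : SimpleGraph V') (ι : V → V')
    (B : Set V) : Prop where
  triangles : ClosedForTriangles G' (ι '' B)
  paths : ClosedForPaths n G' (ι '' B)
  tri_iff : ∀ a ∈ B, Flexible (trianglesAt G a) ↔ Flexible (trianglesAt G' (ι a))
  path_iff : ∀ a ∈ B, ∀ m ≤ n, Flexible (pathsFrom G m a) ↔ Flexible (pathsFrom G' m (ι a))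
  link_iff : ∀ a ∈ B, ∀ b ∈ B, ∀ k ≤ n + 1,
    Flexible (linksBetween G k a b) ↔ Flexible (linksBetween G' k (ι a) (ι b))

/-- Every finite set of vertices is contained in a finite set that is closed, together with a finite
set of witnesses for this. -/
theorem IsExistentiallyComplete.exists_closedImage
    (hG : IsExistentiallyComplete (twoTrianglesPath n) G) (A : Finset V) :
    ∃ B Q : Finset V, A ⊆ B ∧ B ⊆ Q ∧ ∀ (V' : Type) (G' : SimpleGraph V') (ι : V → V'),
      IsExistentiallyComplete (twoTrianglesPath n) G' → InducedOn G G' ι Q →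
      ClosedImage n G G' ι B := by
  classical
  choose K Q hK hP hT using hG.exists_certificates
  choose P hPσ using hG.exists_flexible_iff
  obtain ⟨B, hAB, hB⟩ := exists_finite_closure
    (fun l hc hn => length_le_of_isChain hG.not_hasTadpole hK hc hn) A
  let Q₁ := B.biUnion Q
  let Q₂ := B.biUnion fun a => P (.tri a)
  let Q₃ := (Finset.range (n + 1) ×ˢ B).biUnion fun p => P (.path p.1 p.2)
  let Q₄ := (Finset.range (n + 2) ×ˢ B ×ˢ B).biUnion fun p => P (.link p.1 p.2.1 p.2.2)
  have s1 : ∀ a ∈ B, Q a ⊆ B ∪ Q₁ ∪ Q₂ ∪ Q₃ ∪ Q₄ := by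
    intro a ha x hx
    have : x ∈ Q₁ := Finset.mem_biUnion.2 ⟨a, ha, hx⟩
    simp [this]
  have s2 : ∀ a ∈ B, P (.tri a) ⊆ B ∪ Q₁ ∪ Q₂ ∪ Q₃ ∪ Q₄ := by
    intro a ha x hx
    have : x ∈ Q₂ := Finset.mem_biUnion.2 ⟨a, ha, hx⟩
    simp [this]
  have s3 : ∀ a ∈ B, ∀ m ≤ n, P (.path m a) ⊆ B ∪ Q₁ ∪ Q₂ ∪ Q₃ ∪ Q₄ := by
    intro a ha m hm x hx
    have : x ∈ Q₃ := Finset.mem_biUnion.2 ⟨(m, a), by simp [ha]; omega, hx⟩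
    simp [this]
  have s4 : ∀ a ∈ B, ∀ b ∈ B, ∀ k ≤ n + 1, P (.link k a b) ⊆ B ∪ Q₁ ∪ Q₂ ∪ Q₃ ∪ Q₄ := by
    intro a ha b hb k hk x hx
    have : x ∈ Q₄ := Finset.mem_biUnion.2 ⟨(k, a, b), by simp [ha, hb]; omega, hx⟩
    simp [this]
  refine ⟨B, B ∪ Q₁ ∪ Q₂ ∪ Q₃ ∪ Q₄, hAB, fun x hx => by simp [hx], ?_⟩
  intro V' G' ι hG' hι
  have tri : ∀ a ∈ B, Flexible (trianglesAt G a) ↔ Flexible (trianglesAt G' (ι a)) := fun a ha =>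
    hPσ (.tri a) V' G' ι hG' (hι.mono (Finset.coe_subset.2 (s2 a ha)))
  have path : ∀ a ∈ B, ∀ m ≤ n,
      Flexible (pathsFrom G m a) ↔ Flexible (pathsFrom G' m (ι a)) := fun a ha m hm =>
    hPσ (.path m a) V' G' ι hG' (hι.mono (Finset.coe_subset.2 (s3 a ha m hm)))
  have link : ∀ a ∈ B, ∀ b ∈ B, ∀ k ≤ n + 1,
      Flexible (linksBetween G k a b) ↔ Flexible (linksBetween G' k (ι a) (ι b)) :=
    fun a ha b hb k hk =>
      hPσ (.link k a b) V' G' ι hG' (hι.mono (Finset.coe_subset.2 (s4 a ha b hb k hk)))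
  refine ⟨?_, ?_, tri, path, link⟩
  · rintro _ ⟨a, ha, rfl⟩
    refine (hT a).imp (tri a ha).1 fun h u v h1 h2 h3 => ?_
    refine (h V' G' ι (hι.mono (Finset.coe_subset.2 (s1 a ha))) hG'.not_hasTadpole u v h1 h2
      h3).imp ?_ ?_
    · rintro ⟨y, hy, rfl, h4⟩
      have hyB := hB a ha hy
      exact ⟨⟨y, hyB, rfl⟩, h4.imp (fun ⟨z, hz, hv⟩ => ⟨z, hB a ha hz, hv.symm⟩)
        (link a ha y hyB 1 (by omega)).1⟩
    · rintro ⟨y, hy, rfl, h4⟩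
      have hyB := hB a ha hy
      exact ⟨⟨y, hyB, rfl⟩, h4.imp (fun ⟨z, hz, hv⟩ => ⟨z, hB a ha hz, hv.symm⟩)
        (link a ha y hyB 1 (by omega)).1⟩
  · rintro _ ⟨a, ha, rfl⟩ m hm
    refine (hP a m hm).imp (path a ha m hm).1 fun h l hl => ?_
    obtain ⟨l₁, y, l₂, rfl, hy, hf⟩ := h V' G' ι (hι.mono (Finset.coe_subset.2 (s1 a ha)))
      hG'.not_hasTadpole l hl
    have hyB := hB a ha hy
    refine ⟨l₁, ι y, l₂, rfl, ⟨y, hyB, rfl⟩, (link a ha y hyB l₁.length ?_).1 hf⟩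
    have := hl.1
    simp only [List.length_append, List.length_cons] at this
    omega

theorem exists_eq_map_of_isChain_map (e : V ↪ W) (l : List W) : ∀ a : V,
    (e a :: l).IsChain (G.map e).Adj → ∃ l', l = l'.map e ∧ (a :: l').IsChain G.Adj := by
  induction l with
  | nil => exact fun a _ => ⟨[], rfl, by simp⟩
  | cons b l ih =>
    intro a h
    rw [List.isChain_cons_cons] at h
    obtain ⟨v, w, hvw, h1, rfl⟩ := (SimpleGraph.map_adj _ _ _ _).1 h.1
    obtain rfl := e.injective h1
    obtain ⟨l', rfl, hl'⟩ := ih w h.2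
    exact ⟨w :: l', rfl, List.isChain_cons_cons.2 ⟨hvw, hl'⟩⟩

theorem inducedOn_map (e : V ↪ W) (Q : Set V) : InducedOn G (G.map e) e Q :=
  ⟨e.injective.injOn, fun _ _ _ _ => SimpleGraph.map_adj_apply⟩

theorem Shape.exists_eq_map (e : V ↪ W) {σ : Shape V} {l : List W}
    (hl : l ∈ (σ.map e).lists (G.map e)) : ∃ l' ∈ σ.lists G, l = l'.map e := by
  cases σ with
  | path m a =>
    obtain ⟨h1, h2, h3⟩ := hl
    obtain ⟨l', rfl, hl'⟩ := exists_eq_map_of_isChain_map e l a h2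
    rw [← List.map_cons] at h3
    exact ⟨l', ⟨by simpa using h1, hl', h3.of_map⟩, rfl⟩
  | link k a h =>
    obtain ⟨h1, h2, h3⟩ := hl
    obtain ⟨l'', hl'', hc⟩ := exists_eq_map_of_isChain_map e _ a h2
    obtain ⟨l', r, rfl, rfl, hr⟩ := List.map_eq_append_iff.1 hl''.symm
    obtain ⟨x, rfl, hx⟩ := List.map_eq_singleton_iff.1 hr
    obtain rfl := e.injective hx
    refine ⟨l', ⟨by simpa using h1, hc, ?_⟩, rfl⟩
    have : e a :: (l'.map e ++ [e x]) = (a :: (l' ++ [x])).map e := by simp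
    rw [this] at h3
    exact h3.of_map
  | tri a =>
    obtain ⟨u, v, rfl, h1, h2, h3⟩ := hl
    obtain ⟨a', u, -, -, rfl⟩ := (SimpleGraph.map_adj _ _ _ _).1 h1
    obtain ⟨a', v, -, -, rfl⟩ := (SimpleGraph.map_adj _ _ _ _).1 h2
    rw [SimpleGraph.map_adj_apply] at h1 h2 h3
    exact ⟨[u, v], ⟨u, v, rfl, h1, h2, h3⟩, rfl⟩

theorem Shape.flexible_map_iff (e : V ↪ W) (σ : Shape V) :
    Flexible ((σ.map e).lists (G.map e)) ↔ Flexible (σ.lists G) := by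
  classical
  constructor
  · intro h F
    obtain ⟨l, hl, hF⟩ := h (F.map e)
    obtain ⟨l', hl', rfl⟩ := Shape.exists_eq_map e hl
    exact ⟨l', hl', fun x hx hx' => hF (e x) (List.mem_map_of_mem hx) (Finset.mem_map_of_mem e hx')⟩
  · intro h F
    obtain ⟨l, hl, hF⟩ := h (F.preimage e e.injective.injOn)
    refine ⟨l.map e, Shape.map_mem_lists (inducedOn_map e Set.univ) (Set.subset_univ _)
      (fun _ _ => Set.mem_univ _) hl, fun x hx hx' => ?_⟩
    obtain ⟨y, hy, rfl⟩ := List.mem_map.1 hx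
    exact hF y hy (by simpa using hx')

theorem ClosedForTriangles.map {A : Set V} (h : ClosedForTriangles G A) (e : V ↪ W) :
    ClosedForTriangles (G.map e) (e '' A) := by
  rintro _ ⟨a, ha, rfl⟩
  refine (h a ha).imp (Shape.flexible_map_iff e (.tri a)).2 fun h' u v h1 h2 h3 => ?_
  obtain ⟨a', u, -, -, rfl⟩ := (SimpleGraph.map_adj _ _ _ _).1 h1
  obtain ⟨a', v, -, -, rfl⟩ := (SimpleGraph.map_adj _ _ _ _).1 h2
  rw [SimpleGraph.map_adj_apply] at h1 h2 h3
  refine (h' u v h1 h2 h3).imp ?_ ?_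
  · exact fun ⟨hu, h4⟩ => ⟨⟨u, hu, rfl⟩, h4.imp (fun hv => ⟨v, hv, rfl⟩)
      (Shape.flexible_map_iff e (.link 1 a u)).2⟩
  · exact fun ⟨hu, h4⟩ => ⟨⟨v, hu, rfl⟩, h4.imp (fun hv => ⟨u, hv, rfl⟩)
      (Shape.flexible_map_iff e (.link 1 a v)).2⟩

theorem ClosedForPaths.map {A : Set V} (h : ClosedForPaths n G A) (e : V ↪ W) :
    ClosedForPaths n (G.map e) (e '' A) := by
  rintro _ ⟨a, ha, rfl⟩ m hm
  refine (h a ha m hm).imp (Shape.flexible_map_iff e (.path m a)).2 fun h' l hl => ?_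
  obtain ⟨l', hl', rfl⟩ := Shape.exists_eq_map (σ := .path m a) e hl
  obtain ⟨l₁, b, l₂, rfl, hb, hf⟩ := h' l' hl'
  refine ⟨l₁.map e, e b, l₂.map e, by simp, ⟨b, hb, rfl⟩, ?_⟩
  rw [List.length_map]
  exact (Shape.flexible_map_iff e (.link l₁.length a b)).2 hf

/-- A finite isomorphism between closed sets that preserves which families are flexible. -/
structure IsGoodIso (n : ℕ) (G : SimpleGraph V) (G' : SimpleGraph V') (f : Finset (V × V')) :
    Prop where
  eq_iff : ∀ p ∈ f, ∀ q ∈ f, p.1 = q.1 ↔ p.2 = q.2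
  adj_iff : ∀ p ∈ f, ∀ q ∈ f, G.Adj p.1 q.1 ↔ G'.Adj p.2 q.2
  triangles : ClosedForTriangles G (Prod.fst '' (f : Set (V × V')))
  triangles' : ClosedForTriangles G' (Prod.snd '' (f : Set (V × V')))
  paths : ClosedForPaths n G (Prod.fst '' (f : Set (V × V')))
  paths' : ClosedForPaths n G' (Prod.snd '' (f : Set (V × V')))
  tri_iff : ∀ p ∈ f, Flexible (trianglesAt G p.1) ↔ Flexible (trianglesAt G' p.2)
  path_iff : ∀ p ∈ f, ∀ m ≤ n, Flexible (pathsFrom G m p.1) ↔ Flexible (pathsFrom G' m p.2)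
  link_iff : ∀ p ∈ f, ∀ q ∈ f, ∀ k ≤ n + 1,
    Flexible (linksBetween G k p.1 q.1) ↔ Flexible (linksBetween G' k p.2 q.2)

theorem IsGoodIso.swap {f : Finset (V × V')} (h : IsGoodIso n G G' f) :
    IsGoodIso n G' G (f.map (Equiv.prodComm V V').toEmbedding) := by
  have hm : ∀ p, p ∈ f.map (Equiv.prodComm V V').toEmbedding → (p.2, p.1) ∈ f := by
    intro p hp
    obtain ⟨q, hq, rfl⟩ := Finset.mem_map.1 hp
    exact hq
  have e1 : Prod.fst '' (↑(f.map (Equiv.prodComm V V').toEmbedding) : Set (V' × V)) =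
      Prod.snd '' (f : Set (V × V')) := by
    rw [Finset.coe_map, ← Set.image_comp]; rfl
  have e2 : Prod.snd '' (↑(f.map (Equiv.prodComm V V').toEmbedding) : Set (V' × V)) =
      Prod.fst '' (f : Set (V × V')) := by
    rw [Finset.coe_map, ← Set.image_comp]; rfl
  refine ⟨fun p hp q hq => (h.eq_iff _ (hm p hp) _ (hm q hq)).symm,
    fun p hp q hq => (h.adj_iff _ (hm p hp) _ (hm q hq)).symm, ?_, ?_, ?_, ?_,
    fun p hp => (h.tri_iff _ (hm p hp)).symm, fun p hp m hm' => (h.path_iff _ (hm p hp) m hm').symm,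
    fun p hp q hq k hk => (h.link_iff _ (hm p hp) _ (hm q hq) k hk).symm⟩
  · rw [e1]; exact h.triangles'
  · rw [e2]; exact h.triangles
  · rw [e1]; exact h.paths'
  · rw [e2]; exact h.paths

theorem IsGoodIso.overlap {f : Finset (V × V')} (h : IsGoodIso n G G' f) (e : V ↪ W) (e' : V' ↪ W)
    (he : ∀ p ∈ f, e p.1 = e' p.2) (hsep : ∀ x y, e x = e' y → (x, y) ∈ f) :
    Overlap n (G.map e) (G'.map e') (e '' (Prod.fst '' (f : Set (V × V')))) := by
  have hA : e '' (Prod.fst '' (f : Set (V × V'))) = e' '' (Prod.snd '' (f : Set (V × V'))) := by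
    rw [← Set.image_comp, ← Set.image_comp]
    exact Set.image_congr fun p hp => he p hp
  have key : ∀ a ∈ e '' (Prod.fst '' (f : Set (V × V'))), ∃ p ∈ f, a = e p.1 := by
    rintro _ ⟨_, ⟨p, hp, rfl⟩, rfl⟩
    exact ⟨p, hp, rfl⟩
  refine ⟨?_, ?_, h.triangles.map e, ?_, h.paths.map e, ?_, ?_, ?_, ?_⟩
  · intro v u u' hv h1 h2
    obtain ⟨x, -, -, rfl, -⟩ := (SimpleGraph.map_adj _ _ _ _).1 h1
    obtain ⟨y, -, -, h3, -⟩ := (SimpleGraph.map_adj _ _ _ _).1 h2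
    exact hv ⟨x, ⟨(x, y), hsep x y h3.symm, rfl⟩, rfl⟩
  · intro a ha b hb
    obtain ⟨p, hp, rfl⟩ := key a ha
    obtain ⟨q, hq, rfl⟩ := key b hb
    rw [SimpleGraph.map_adj_apply, he p hp, he q hq, SimpleGraph.map_adj_apply]
    exact h.adj_iff p hp q hq
  · rw [hA]; exact h.triangles'.map e'
  · rw [hA]; exact h.paths'.map e'
  · intro a ha
    obtain ⟨p, hp, rfl⟩ := key a ha
    refine (Shape.flexible_map_iff e (.tri p.1)).trans ((h.tri_iff p hp).trans ?_)
    rw [he p hp]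
    exact (Shape.flexible_map_iff e' (.tri p.2)).symm
  · intro a ha m hm
    obtain ⟨p, hp, rfl⟩ := key a ha
    refine (Shape.flexible_map_iff e (.path m p.1)).trans ((h.path_iff p hp m hm).trans ?_)
    rw [he p hp]
    exact (Shape.flexible_map_iff e' (.path m p.2)).symm
  · intro a ha b hb k hk
    obtain ⟨p, hp, rfl⟩ := key a ha
    obtain ⟨q, hq, rfl⟩ := key b hb
    refine (Shape.flexible_map_iff e (.link k p.1 q.1)).trans
      ((h.link_iff p hp q hq k hk).trans ?_)
    rw [he p hp, he q hq]
    exact (Shape.flexible_map_iff e' (.link k p.2 q.2)).symm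

theorem sup_map_adj_iff {e : V ↪ W} {e' : V' ↪ W} {A : Set W}
    (h : Overlap n (G.map e) (G'.map e') A) (hA : ∀ x y, e x = e' y → e x ∈ A) (x x' : V) :
    (G.map e ⊔ G'.map e').Adj (e x) (e x') ↔ G.Adj x x' := by
  constructor
  · rintro (h1 | h1)
    · exact SimpleGraph.map_adj_apply.1 h1
    · obtain ⟨y, y', -, h2, h3⟩ := (SimpleGraph.map_adj _ _ _ _).1 h1
      exact SimpleGraph.map_adj_apply.1
        ((h.agree _ (hA x y h2.symm) _ (hA x' y' h3.symm)).2 h1)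
  · exact fun h1 => Or.inl (SimpleGraph.map_adj_apply.2 h1)

/-- The two graphs are amalgamated over `f` without further identifications. The result is
tadpole-free because `f` is good, so a closed set of `G'` containing `b`, with its witnesses, can be
copied into `G` over the domain of `f`. -/
theorem IsGoodIso.extend (hG : IsExistentiallyComplete (twoTrianglesPath n) G)
    (hG' : IsExistentiallyComplete (twoTrianglesPath n) G') {f : Finset (V × V')}
    (h : IsGoodIso n G G' f) (b : V') :
    ∃ f', f ⊆ f' ∧ IsGoodIso n G G' f' ∧ ∃ p ∈ f', p.2 = b := by
  classical
  have := hG.1.1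
  have := hG'.1.1
  let φ : V' → V ⊕ V' := fun y => if hy : ∃ x, (x, y) ∈ f then .inl hy.choose else .inr y
  have φ1 : ∀ p ∈ f, φ p.2 = .inl p.1 := by
    intro p hp
    have hy : ∃ x, (x, p.2) ∈ f := ⟨p.1, hp⟩
    have h1 : φ p.2 = .inl hy.choose := dif_pos hy
    rw [h1]
    exact congrArg Sum.inl ((h.eq_iff _ hy.choose_spec p hp).2 rfl)
  have φ2 : ∀ y, (¬ ∃ x, (x, y) ∈ f) → φ y = .inr y := fun y hy => dif_neg hy
  have φ3 : ∀ x y, Sum.inl x = φ y → (x, y) ∈ f := by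
    intro x y hxy
    by_cases hy : ∃ x, (x, y) ∈ f
    · obtain ⟨x', hx'⟩ := hy
      rw [φ1 _ hx'] at hxy
      rwa [Sum.inl_injective hxy]
    · rw [φ2 y hy] at hxy
      simp at hxy
  have φinj : Function.Injective φ := by
    intro y y' hyy
    by_cases hy : ∃ x, (x, y) ∈ f
    · obtain ⟨x, hx⟩ := hy
      rw [φ1 _ hx] at hyy
      exact (h.eq_iff _ hx _ (φ3 _ _ hyy)).1 rfl
    · by_cases hy' : ∃ x, (x, y') ∈ f
      · obtain ⟨x, hx⟩ := hy'
        rw [φ1 _ hx] at hyy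
        exact absurd ⟨_, φ3 _ _ hyy.symm⟩ hy
      · rw [φ2 y hy, φ2 y' hy'] at hyy
        exact Sum.inr_injective hyy
  let e : V ↪ V ⊕ V' := Function.Embedding.inl
  let e' : V' ↪ V ⊕ V' := ⟨φ, φinj⟩
  have ho := h.overlap e e' (fun p hp => (φ1 p hp).symm) (fun x y hxy => φ3 x y hxy)
  have hmem : ∀ x y, e x = e' y → e x ∈ e '' (Prod.fst '' (f : Set (V × V'))) := fun x y hxy =>
    ⟨x, ⟨(x, y), φ3 x y hxy, rfl⟩, rfl⟩
  set H := G.map e ⊔ G'.map e' with hH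
  have hadj : ∀ x x', H.Adj (e x) (e x') ↔ G.Adj x x' := sup_map_adj_iff ho hmem
  have hadj' : ∀ y y', H.Adj (e' y) (e' y') ↔ G'.Adj y y' := by
    rw [hH, sup_comm]
    exact sup_map_adj_iff ho.symm fun y x hyx => hyx ▸ hmem x y hyx.symm
  have hC := twoTrianglesPath_exists_adj n
  have hHfree : IsCountableFree (twoTrianglesPath n) H :=
    ⟨inferInstance, free_iff_not_hasTadpole.2 (ho.not_hasTadpole
      (free_iff_not_hasTadpole.1 (hG.1.2.map hC e))
      (free_iff_not_hasTadpole.1 (hG'.1.2.map hC e')))⟩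
  obtain ⟨B, Q, hAB, hBQ, hcl⟩ := hG'.exists_closedImage (insert b (f.image Prod.snd))
  have hbB : b ∈ B := hAB (Finset.mem_insert_self _ _)
  let ε : G ↪g H := ⟨e, fun {x x'} => hadj x x'⟩
  obtain ⟨j, hj, hI⟩ := hG.locallyRetracts hHfree ε (f.image Prod.fst) (Q.image φ)
    ⟨φ b, Finset.mem_image_of_mem _ (hBQ hbB)⟩
  let ι : V' → V := fun y => j (φ y)
  have hQ : ∀ y ∈ Q, φ y ∈ (↑(Q.image φ) ∪ ε '' ↑(f.image Prod.fst) : Set (V ⊕ V')) :=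
    fun y hy => Or.inl (Finset.mem_coe.2 (Finset.mem_image_of_mem _ hy))
  have hι : InducedOn G' G ι Q :=
    ⟨fun y hy y' hy' hyy => φinj (hI.1 (hQ y hy) (hQ y' hy') hyy), fun y hy y' hy' =>
      (hI.2 _ (hQ y hy) _ (hQ y' hy')).trans (hadj' y y')⟩
  -- The same witnesses make the copy of `B` closed in `G` and, with the identity as the map, `B`
  -- closed in `G'`.
  have c1 := hcl V G ι hG hι
  have c2 := hcl V' G' id hG' (inducedOn_id _ _)
  have hιB := hι.mono (Finset.coe_subset.2 hBQ)
  have d1 : Prod.fst '' (↑(B.image fun y => (ι y, y)) : Set (V × V')) = ι '' ↑B := by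
    rw [Finset.coe_image, ← Set.image_comp]; rfl
  have d2 : Prod.snd '' (↑(B.image fun y => (ι y, y)) : Set (V × V')) = id '' (B : Set V') := by
    rw [Finset.coe_image, ← Set.image_comp]; rfl
  have mem : ∀ p ∈ B.image fun y => (ι y, y), p.2 ∈ B ∧ p.1 = ι p.2 := by
    intro p hp
    obtain ⟨y, hy, rfl⟩ := Finset.mem_image.1 hp
    exact ⟨hy, rfl⟩
  refine ⟨B.image fun y => (ι y, y), ?_, ⟨?_, ?_, ?_, ?_, ?_, ?_, ?_, ?_, ?_⟩, (ι b, b),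
    Finset.mem_image_of_mem _ hbB, rfl⟩
  · intro p hp
    refine Finset.mem_image.2 ⟨p.2, hAB (Finset.mem_insert_of_mem (Finset.mem_image_of_mem _ hp)),
      Prod.ext ?_ rfl⟩
    change j (φ p.2) = p.1
    rw [φ1 p hp]
    exact hj p.1 (Finset.mem_image_of_mem _ hp)
  · intro p hp q hq
    rw [(mem p hp).2, (mem q hq).2]
    exact hιB.1.eq_iff (mem p hp).1 (mem q hq).1
  · intro p hp q hq
    rw [(mem p hp).2, (mem q hq).2]
    exact hιB.2 _ (mem p hp).1 _ (mem q hq).1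
  · rw [d1]; exact c1.triangles
  · rw [d2]; exact c2.triangles
  · rw [d1]; exact c1.paths
  · rw [d2]; exact c2.paths
  · intro p hp
    rw [(mem p hp).2]
    exact (c1.tri_iff _ (mem p hp).1).symm
  · intro p hp m hm
    rw [(mem p hp).2]
    exact (c1.path_iff _ (mem p hp).1 m hm).symm
  · intro p hp q hq k hk
    rw [(mem p hp).2, (mem q hq).2]
    exact (c1.link_iff _ (mem p hp).1 _ (mem q hq).1 k hk).symm

theorem isGoodIso_empty : IsGoodIso n G G' ∅ := by
  constructor <;> simp [ClosedForTriangles, ClosedForPaths]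

/-- The good isomorphisms that contain a pair involving the given vertex. -/
def coveringIsos (hG : IsExistentiallyComplete (twoTrianglesPath n) G)
    (hG' : IsExistentiallyComplete (twoTrianglesPath n) G') :
    V ⊕ V' → Order.Cofinal {f : Finset (V × V') // IsGoodIso n G G' f}
  | .inl x =>
    { carrier := {f | ∃ p ∈ f.1, p.1 = x}
      isCofinal := by
        intro f
        obtain ⟨f', hf, hf', p, hp, hpx⟩ := f.2.swap.extend hG' hG x
        refine ⟨⟨_, hf'.swap⟩, ⟨(p.2, p.1), ?_, hpx⟩, ?_⟩
        · exact Finset.mem_map.2 ⟨p, hp, rfl⟩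
        · intro q hq
          exact Finset.mem_map.2 ⟨(q.2, q.1), hf (Finset.mem_map.2 ⟨q, hq, rfl⟩), rfl⟩ }
  | .inr y =>
    { carrier := {f | ∃ p ∈ f.1, p.2 = y}
      isCofinal := by
        intro f
        obtain ⟨f', hf, hf', hp⟩ := f.2.extend hG hG' y
        exact ⟨⟨f', hf'⟩, hp, hf⟩ }

/-- Any two existentially complete graphs are isomorphic. -/
theorem IsExistentiallyComplete.nonempty_iso
    (hG : IsExistentiallyComplete (twoTrianglesPath n) G)
    (hG' : IsExistentiallyComplete (twoTrianglesPath n) G') : Nonempty (G ≃g G') := by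
  classical
  have := hG.1.1
  have := hG'.1.1
  have : Encodable (V ⊕ V') := Encodable.ofCountable _
  let p := Order.sequenceOfCofinals ⟨∅, isGoodIso_empty⟩ (coveringIsos hG hG')
  have hp : Monotone p := Order.sequenceOfCofinals.monotone _ _
  have hcov : ∀ v, ∃ i, p i ∈ coveringIsos hG hG' v := fun v =>
    ⟨_, Order.sequenceOfCofinals.encode_mem _ (coveringIsos hG hG') v⟩
  have h1 : ∀ x, ∃ y, ∃ i, (x, y) ∈ (p i).1 := by
    intro x
    obtain ⟨i, q, hq, rfl⟩ := hcov (.inl x)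
    exact ⟨q.2, i, hq⟩
  have h2 : ∀ y, ∃ x, ∃ i, (x, y) ∈ (p i).1 := by
    intro y
    obtain ⟨i, q, hq, rfl⟩ := hcov (.inr y)
    exact ⟨q.1, i, hq⟩
  choose g hg using h1
  have common : ∀ {q q' : V × V'}, (∃ i, q ∈ (p i).1) → (∃ i, q' ∈ (p i).1) →
      ∃ i, q ∈ (p i).1 ∧ q' ∈ (p i).1 := by
    rintro q q' ⟨i, hi⟩ ⟨j, hj⟩
    exact ⟨max i j, hp (le_max_left i j) hi, hp (le_max_right i j) hj⟩
  refine ⟨⟨Equiv.ofBijective g ⟨fun x x' hxx => ?_, fun y => ?_⟩, fun {x x'} => ?_⟩⟩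
  · obtain ⟨i, hi, hi'⟩ := common (hg x) (hg x')
    exact ((p i).2.eq_iff _ hi _ hi').2 hxx
  · obtain ⟨x, hx⟩ := h2 y
    obtain ⟨i, hi, hi'⟩ := common (hg x) hx
    exact ⟨x, ((p i).2.eq_iff _ hi _ hi').1 rfl⟩
  · obtain ⟨i, hi, hi'⟩ := common (hg x) (hg x')
    exact ((p i).2.adj_iff _ hi _ hi').symm

end BackAndForth

/-! ### From isomorphism of graphs to categoricity and universality -/

section Main

open Language

theorem IsExistentiallyComplete.infinite {U V : Type} {C : SimpleGraph U}
    (hC : ∀ u, ∃ v, C.Adj u v) {G : SimpleGraph V} (hG : IsExistentiallyComplete C G) :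
    Infinite V := by
  classical
  by_contra hfin
  rw [not_infinite_iff_finite] at hfin
  have := Fintype.ofFinite V
  -- An added isolated vertex would have to be copied into `G` while every vertex of `G` stays
  -- fixed.
  have hH : IsCountableFree C (G.map (Function.Embedding.inl : V ↪ V ⊕ Unit)) :=
    ⟨inferInstance, hG.1.2.map hC _⟩
  obtain ⟨j, hj, hI⟩ := hG.locallyRetracts hH (SimpleGraph.Embedding.map _ G) Finset.univ
    {Sum.inr ()} (by simp)
  have h1 := hj (j (Sum.inr ())) (Finset.mem_univ _)
  have h2 := hI.1 (Or.inr ⟨j (Sum.inr ()), by simp, rfl⟩) (Or.inl (by simp)) h1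
  exact Sum.inl_ne_inr h2

theorem graphRealize_sentence_iff {V : Type} (G : SimpleGraph V) (φ : Language.graph.Sentence) :
    GraphRealize G φ Empty.elim ↔ @Sentence.Realize _ V G.structure φ := by
  unfold GraphRealize Sentence.Realize
  rw [Subsingleton.elim (Empty.elim : Empty → V) default]

theorem IsExistentiallyComplete.model {U V : Type} {C : SimpleGraph U} {G : SimpleGraph V}
    (hG : IsExistentiallyComplete C G) :
    @Theory.Model _ V G.structure (existentiallyCompleteTheory C) :=
  @Theory.Model.mk _ V G.structure _ fun φ hφ => (graphRealize_sentence_iff G φ).1 (hφ V G hG)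

/-- A model of `T*_C` is a graph. -/
theorem model_simpleGraph_of_model {U N : Type} {C : SimpleGraph U} [Language.graph.Structure N]
    (h : N ⊨ existentiallyCompleteTheory C) : N ⊨ Theory.simpleGraph := by
  refine ⟨fun φ hφ => h.realize_of_mem φ fun V G _ => ?_⟩
  rw [graphRealize_sentence_iff]
  exact (simpleGraph_model G).realize_of_mem φ hφ

theorem nonempty_equiv_of_iso {N V : Type} [Language.graph.Structure N] [N ⊨ Theory.simpleGraph]
    {G : SimpleGraph V} (e : simpleGraphOfStructure N ≃g G) :
    Nonempty (@Language.Equiv Language.graph N V _ G.structure) := by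
  let := G.structure
  refine ⟨⟨e.toEquiv, fun f => isEmptyElim f, fun {k} r x => ?_⟩⟩
  match k, r, x with
  | 2, .adj, x =>
    have h1 : G.Adj (e (x 0)) (e (x 1)) ↔ Structure.RelMap adj ![x 0, x 1] := e.map_adj_iff
    have h2 : ![x 0, x 1] = x := by
      funext i
      match i with
      | 0 => rfl
      | 1 => rfl
    rw [h2] at h1
    exact h1

end Main

theorem proposition8 (n : ℕ) :
    IsAleph0Categorical (existentiallyCompleteTheory (twoTrianglesPath n)) ∧
      ∃ (V : Type) (G : SimpleGraph V), IsUniversalFree (twoTrianglesPath n) G := by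
  have hC := twoTrianglesPath_exists_adj n
  have hbot : IsCountableFree (twoTrianglesPath n) (⊥ : SimpleGraph Empty) :=
    ⟨inferInstance, fun ⟨f⟩ => (f (0 : Fin (n + 5))).elim⟩
  obtain ⟨V, G, hG, -⟩ := exists_isExistentiallyComplete_embedding hC hbot
  have hV := hG.nonempty hC
  have hVc := hG.1.1
  have hVi := hG.infinite hC
  refine ⟨⟨@Language.Theory.ModelType.mk _ _ V G.structure hG.model hV,
    Cardinal.mk_eq_aleph0 V, fun N hN => ?_⟩, V, G, hG.1, fun W H hH => ?_⟩
  · have hNg : N ⊨ Language.Theory.simpleGraph := model_simpleGraph_of_model N.is_model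
    have hmod : ModelsEC (twoTrianglesPath n) (Language.simpleGraphOfStructure N) := by
      intro φ hφ
      rw [graphRealize_sentence_iff, Language.structure_simpleGraphOfStructure]
      exact N.is_model.realize_of_mem φ hφ
    obtain ⟨e⟩ := (hmod.isExistentiallyComplete hC).nonempty_iso hG
    exact nonempty_equiv_of_iso e
  · obtain ⟨V', G', hG', ⟨e⟩⟩ := exists_isExistentiallyComplete_embedding hC hH
    obtain ⟨i⟩ := hG'.nonempty_iso hG
    exact ⟨e.trans i.toEmbedding⟩
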